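/- **Setting.** A *Frölicher space* is a set $X$ with a set $\mathcal C_X$ of curves $\mathbb R\to X$ and a set $\mathcal F_X$ of functions $X\to\mathbb R$ such that $\mathcal C_X=\{\gamma : f\circ\gamma\in C^\infty(\mathbb R,\mathbb R)\ \forall f\in\mathcal F_X\}$ and $\mathcal F_X=\{f : f\circ\gamma\in C^\infty(\mathbb R,\mathbb R)\ \forall \gamma\in\mathcal C_X\}$. A map is *Fr-smooth* if it maps smooth curves to smooth curves. The tangent space is $T_xX=\{\gamma\in\mathcal C_X:\gamma(0)=x\}/\sim$, where $\gamma_1\sim\gamma_2$ iff $(f\circ\gamma_1)'(0)=(f\circ\gamma_2)'(0)$ for all $f\in\mathcal F_X$; put $r[\gamma]=[t\mapsto\gamma(rt)]$ and $[\gamma]f=(f\circ\gamma)'(0)$. The tangent bundle $TX$ carries the Frölicher structure generated by the differentials $\mathrm Df:TX\to T\mathbb R\cong\mathbb R^2$, $f\in\mathcal F_X$, and subsets carry the subspace structure (generated by the ambient smooth curves with values in the subset). Let $\mathcal O(S^1)$ be the space of real-analytic functions $S^1\to\mathbb C$, with the locally convex inductive limit topology of the spaces $\mathcal O(U_n)$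 of holomorphic functions (with uniform convergence on compact sets) on the annuli $U_n=\{1-\frac1n<|z|<1+\frac1n\}$, $n\ge1$, and with the Frölicher structure whose smooth curves are the $C^\infty$ curves into this topological vector space. Let $\mathrm{Vect}_{\mathbb C}$ be the space of real-analytic complex-valued vector fields $v=v(z)\partial_z$ on $S^1$, identified with $\mathcal O(S^1)$ via $v\mapsto v(z)$ and regarded as a Lie algebra over $\mathbb R$ with bracket $[v,w]=(w\,v'-v\,w')\,\partial_z$. Let $\mathrm{Def}_{\mathbb C}\subset\mathcal O(S^1)$ be the set of injective real-analytic maps $\phi:S^1\to\mathbb C\setminus\{0\}$ with winding number $+1$ around $0$ (complex deformations), with the subspace Frölicher structure. For $\phi\in\mathrm{Def}_{\mathbb C}$ let $U(\phi)\subset\mathbb C$ be the compact set consisting of $S^1\cup\phi(S^1)$ and all connected components of $\hat{\mathbb C}\setminus(S^1\cup\phi(S^1))$ that contain neither $0$ nor $\infty$. The composition $\phi\circ\psi$ is defined if $\phi$ extends to an injective, zero-free holomorphic function on an open neighbourhood of $U(\psi)$, as the composition of this extension with $\psi$. The inverse of $\phi$ is defined if $\phi^{-1}:\phi(S^1)\to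 S^1$ extends to an injective, zero-free holomorphic function on an open neighbourhood of $U(\phi)$, as the restriction of this extension to $S^1$. **Proposition.** 1. The map $\Xi:T_{\mathrm{id}}\mathrm{Def}_{\mathbb C}\to T_0T_{\mathrm{id}}\mathrm{Def}_{\mathbb C}$, $[\gamma]\mapsto\big[t\mapsto t[\gamma]\big]$, is bijective. 2. $T_{\mathrm{id}}\mathrm{Def}_{\mathbb C}$ is a Lie algebra over $\mathbb R$ with scalar multiplication $r[\gamma]=[t\mapsto\gamma(rt)]$, with the addition satisfying $(X+Y)f=Xf+Yf$ for all $f\in\mathcal F_{\mathrm{Def}_{\mathbb C}}$, and with the bracket $$\big[[\gamma],[\eta]\big]=\Xi^{-1}\Big(\big[s\mapsto[t\mapsto\gamma(s)\circ\eta(t)\circ\gamma(s)^{-1}\circ\eta(t)^{-1}]\big]\Big),$$ where the fourfold composition is read as $((\gamma(s)\circ\eta(t))\circ\gamma(s)^{-1})\circ\eta(t)^{-1}$. Here all compositions and inverses are defined in $\mathrm{Def}_{\mathbb C}$ for small times; the inner class is that of any smooth curve in $\mathrm{Def}_{\mathbb C}$ rooted at $\mathrm{id}$ that equals the commutator for $t$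 near $0$ (for each $s$ near $0$), and the outer class is that of any smooth curve in $T_{\mathrm{id}}\mathrm{Def}_{\mathbb C}$ rooted at $0$ that equals the inner class for $s$ near $0$. Such curves exist, and the result depends neither on their choice nor on the representatives $\gamma,\eta$. 3. For $w\in\mathrm{Vect}_{\mathbb C}$, the right- and left-trivializing flow equations $$\dot\Phi^w(t,z)=(\Phi^w)'(t,z)\,w(z),\quad \Phi^w(0,z)=z,\qquad\text{and}\qquad \dot\Phi_w(t,z)=w(\Phi_w(t,z)),\quad\Phi_w(0,z)=z$$ (with $w$ continued analytically to a neighbourhood of $S^1$) have solutions for $t$ near $0$, in the form of smooth curves in $\mathrm{Def}_{\mathbb C}$ rooted at $\mathrm{id}$ that satisfy the equation for $t$ near $0$; all these curves, for both equations, have the same tangent class. The resulting map $$\mathrm{Vect}_{\mathbb C}\longrightarrow T_{\mathrm{id}}\mathrm{Def}_{\mathbb C},\qquad w\longmapsto[t\mapsto\Phi^w]=[t\mapsto\Phi_w],$$ is an isomorphism of Lie algebras over $\mathbb R$, Fr-smooth with Fr-smooth inverse. -/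

import Mathlib

open Topology Filter
open scoped ContDiff

noncomputable section

namespace CircleDef

/-! ## Frölicher spaces -/

/-- A Frölicher structure on `X`: smooth curves `ℝ → X` and smooth functions `X → ℝ`
determining each other. -/
class FrolicherSpace (X : Type*) where
  curves : Set (ℝ → X)
  functions : Set (X → ℝ)
  mem_curves_iff : ∀ γ : ℝ → X, γ ∈ curves ↔ ∀ f ∈ functions, ContDiff ℝ ∞ (f ∘ γ)
  mem_functions_iff : ∀ f : X → ℝ, f ∈ functions ↔ ∀ γ ∈ curves, ContDiff ℝ ∞ (f ∘ γ)

/-- The set of smooth curves of a Frölicher space. -/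
abbrev Curves (X : Type*) [FrolicherSpace X] : Set (ℝ → X) := FrolicherSpace.curves

/-- The set of smooth real-valued functions on a Frölicher space. -/
abbrev Functions (X : Type*) [FrolicherSpace X] : Set (X → ℝ) := FrolicherSpace.functions

/-- Frölicher smooth maps. -/
def FrSmooth {X Y : Type*} [FrolicherSpace X] [FrolicherSpace Y] (φ : X → Y) : Prop :=
  ∀ γ ∈ Curves X, φ ∘ γ ∈ Curves Y

/-- The Frölicher structure generated by a set of curves. -/
@[reducible] def FrolicherSpace.ofCurves {X : Type*} (C : Set (ℝ → X)) : FrolicherSpace X where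
  functions := {f | ∀ γ ∈ C, ContDiff ℝ ∞ (f ∘ γ)}
  curves := {γ | ∀ f : X → ℝ, (∀ c ∈ C, ContDiff ℝ ∞ (f ∘ c)) → ContDiff ℝ ∞ (f ∘ γ)}
  mem_curves_iff _ := Iff.rfl
  mem_functions_iff f :=
    ⟨fun hf _ hγ => hγ f hf, fun h γ hγ => h γ fun _ hg => hg γ hγ⟩

/-- The Frölicher structure generated by a set of functions. -/
@[reducible] def FrolicherSpace.ofFunctions {X : Type*} (F : Set (X → ℝ)) :
    FrolicherSpace X where
  curves := {γ | ∀ f ∈ F, ContDiff ℝ ∞ (f ∘ γ)}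
  functions := {f | ∀ γ : ℝ → X, (∀ g ∈ F, ContDiff ℝ ∞ (g ∘ γ)) → ContDiff ℝ ∞ (f ∘ γ)}
  mem_curves_iff γ :=
    ⟨fun hγ _ hf => hf γ hγ, fun h f hf => h f fun _ hc => hc f hf⟩
  mem_functions_iff _ := Iff.rfl

/-- The subspace structure: generated by the curves that are smooth in the ambient space. -/
@[reducible] def FrolicherSpace.induced {S X : Type*} [FrolicherSpace X] (i : S → X) :
    FrolicherSpace S :=
  FrolicherSpace.ofCurves {γ | i ∘ γ ∈ Curves X}

theorem FrolicherSpace.mem_curves_induced {S X : Type*} [FrolicherSpace X] {i : S → X} {γ : ℝ → S}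
    (h : i ∘ γ ∈ Curves X) : γ ∈ (FrolicherSpace.induced i).curves :=
  fun _ hf => hf γ h

theorem FrolicherSpace.mem_curves_ofFunctions {X : Type*} (F : Set (X → ℝ)) (γ : ℝ → X) :
    γ ∈ (FrolicherSpace.ofFunctions F).curves ↔ ∀ f ∈ F, ContDiff ℝ ∞ (f ∘ γ) :=
  Iff.rfl

/-! ## Curvaceous tangent spaces -/

section Tangent

variable {X : Type*} [FrolicherSpace X]

/-- Smooth curves rooted at `x`. -/
def RootedCurve (x : X) : Type _ := {γ : ℝ → X // γ ∈ Curves X ∧ γ 0 = x}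

/-- Two rooted curves are equivalent if all smooth functions have the same derivative
along them at time `0`. -/
def tangentSetoid (x : X) : Setoid (RootedCurve x) where
  r γ₁ γ₂ := ∀ f ∈ Functions X, deriv (f ∘ γ₁.1) 0 = deriv (f ∘ γ₂.1) 0
  iseqv := ⟨fun _ _ _ => rfl, fun h f hf => (h f hf).symm,
    fun h₁ h₂ f hf => (h₁ f hf).trans (h₂ f hf)⟩

/-- The (curvaceous) tangent space `T_x X`. -/
def Tangent (x : X) : Type _ := Quotient (tangentSetoid x)

/-- The tangent vector `[γ]` of a rooted curve. -/
def Tangent.mk {x : X} (γ : RootedCurve x) : Tangent x := Quotient.mk (tangentSetoid x) γ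

/-- The action `[γ] f = (f ∘ γ)'(0)` of tangent vectors on smooth functions. -/
def Tangent.act {x : X} (f : Functions X) (v : Tangent x) : ℝ :=
  Quotient.lift (s := tangentSetoid x) (fun γ : RootedCurve x => deriv (f.1 ∘ γ.1) 0)
    (fun _ _ h => h f.1 f.2) v

theorem Tangent.ext {x : X} {v w : Tangent x} (h : ∀ f, Tangent.act f v = Tangent.act f w) :
    v = w := by
  induction v using Quotient.inductionOn
  induction w using Quotient.inductionOn
  exact Quotient.sound (s := tangentSetoid x) fun f hf => h ⟨f, hf⟩

/-- The tangent bundle. -/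
def TBundle (X : Type*) [FrolicherSpace X] : Type _ := Σ x : X, Tangent x

/-- The Frölicher structure on `TX` generated by the differentials `TX → Tℝ ≅ ℝ × ℝ` of smooth
functions, i.e. by their two components. -/
instance : FrolicherSpace (TBundle X) :=
  FrolicherSpace.ofFunctions
    {g | ∃ f : Functions X, g = (fun v => f.1 v.1) ∨ g = (fun v => Tangent.act f v.2)}

/-- The fibre `T_x X` as a subspace of `TX`. -/
instance (x : X) : FrolicherSpace (Tangent x) :=
  FrolicherSpace.induced (X := TBundle X) (fun v => ⟨x, v⟩)

/-- The curve `t ↦ γ (r t)`. -/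
def RootedCurve.scale {x : X} (r : ℝ) (γ : RootedCurve x) : RootedCurve x :=
  ⟨fun t => γ.1 (r * t), by
    refine ⟨(FrolicherSpace.mem_curves_iff _).2 fun f hf => ?_, by simp [γ.2.2]⟩
    have h := (FrolicherSpace.mem_curves_iff _).1 γ.2.1 f hf
    exact h.comp (contDiff_const.mul contDiff_id)⟩

theorem RootedCurve.deriv_scale {x : X} (r : ℝ) (γ : RootedCurve x) (f : X → ℝ) :
    deriv (f ∘ (γ.scale r).1) 0 = r * deriv (f ∘ γ.1) 0 := by
  have := deriv_comp_mul_left r (f ∘ γ.1) 0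
  simpa [RootedCurve.scale, Function.comp_def] using this

/-- Scalar multiplication of tangent vectors, `r [γ] = [t ↦ γ (r t)]`. -/
def Tangent.scale {x : X} (r : ℝ) (v : Tangent x) : Tangent x :=
  Quotient.map' (s₁ := tangentSetoid x) (s₂ := tangentSetoid x) (RootedCurve.scale r)
    (fun γ₁ γ₂ h f hf => by
      rw [RootedCurve.deriv_scale, RootedCurve.deriv_scale, h f hf]) v

theorem Tangent.act_scale {x : X} (r : ℝ) (v : Tangent x) (f : Functions X) :
    Tangent.act f (v.scale r) = r * Tangent.act f v := by
  induction v using Quotient.inductionOn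
  exact RootedCurve.deriv_scale r _ f.1

/-- The zero tangent vector, the class of the constant curve. -/
def Tangent.zero (x : X) : Tangent x :=
  Tangent.mk ⟨fun _ => x, (FrolicherSpace.mem_curves_iff _).2 fun _ _ => contDiff_const, rfl⟩

theorem Tangent.act_zero (x : X) (f : Functions X) : Tangent.act f (Tangent.zero x) = 0 :=
  deriv_const (0 : ℝ) (f.1 x)

/-- The smooth curve `t ↦ t v` in `T_x X`, rooted at zero. -/
def Tangent.ray {x : X} (v : Tangent x) : RootedCurve (Tangent.zero x) :=
  ⟨fun t => v.scale t, by
    constructor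
    · refine FrolicherSpace.mem_curves_induced ?_
      refine (FrolicherSpace.mem_curves_ofFunctions _ _).2 fun g hg => ?_
      obtain ⟨k, rfl | rfl⟩ := hg
      · exact (contDiff_const : ContDiff ℝ ∞ fun _ : ℝ => k.1 x)
      · have h : ContDiff ℝ ∞ fun t : ℝ => t * Tangent.act k v := contDiff_id.mul contDiff_const
        have e : (fun t : ℝ => Tangent.act k (v.scale t)) = fun t => t * Tangent.act k v :=
          funext fun t => Tangent.act_scale t v k
        rw [← e] at h
        exact h
    · exact Tangent.ext fun f => by rw [Tangent.act_scale, Tangent.act_zero, zero_mul]⟩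

/-- The map `Ξ : T_x X → T_0 T_x X`, `v ↦ [t ↦ t v]`. -/
def Tangent.xi (x : X) (v : Tangent x) : Tangent (Tangent.zero x) := Tangent.mk v.ray

end Tangent

/-! ## Smooth curves in topological vector spaces -/

/-- A curve is smooth if all its iterated derivatives (limits of difference quotients) exist;
`d n` is the `n`-th derivative. -/
def IsSmoothCurve {E : Type*} [AddCommGroup E] [Module ℝ E] [TopologicalSpace E]
    (c : ℝ → E) : Prop :=
  ∃ d : ℕ → ℝ → E, d 0 = c ∧ ∀ n t,
    Tendsto (fun h : ℝ => h⁻¹ • (d n (t + h) - d n t)) (𝓝[≠] 0) (𝓝 (d (n + 1) t))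

/-! ## The space `𝒪(S¹)` -/

/-- The annulus `1 - 1/(n+1) < |z| < 1 + 1/(n+1)`. -/
def annulus (n : ℕ) : Set ℂ := {z | 1 - 1 / ((n : ℝ) + 1) < ‖z‖ ∧ ‖z‖ < 1 + 1 / ((n : ℝ) + 1)}

theorem coe_mem_annulus (n : ℕ) (z : Circle) : (z : ℂ) ∈ annulus n := by
  have : (0 : ℝ) < 1 / ((n : ℝ) + 1) := by positivity
  constructor <;> rw [Circle.norm_coe] <;> linarith

theorem isOpen_annulus (n : ℕ) : IsOpen (annulus n) :=
  (isOpen_lt continuous_const continuous_norm).inter (isOpen_lt continuous_norm continuous_const)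

theorem annulus_mono {m n : ℕ} (h : m ≤ n) : annulus n ⊆ annulus m := by
  intro z hz
  have : 1 / ((n : ℝ) + 1) ≤ 1 / ((m : ℝ) + 1) := by gcongr
  exact ⟨by linarith [hz.1], by linarith [hz.2]⟩

/-- `F` is a holomorphic function on the annulus `annulus n` restricting to `f` on the circle. -/
def IsExtension (n : ℕ) (F : ℂ → ℂ) (f : Circle → ℂ) : Prop :=
  DifferentiableOn ℂ F (annulus n) ∧ ∀ z : Circle, F z = f z

theorem IsExtension.mono {m n : ℕ} (h : m ≤ n) {F : ℂ → ℂ} {f : Circle → ℂ}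
    (hF : IsExtension m F f) : IsExtension n F f :=
  ⟨hF.1.mono (annulus_mono h), hF.2⟩

/-- The algebra of real-analytic functions `S¹ → ℂ`, i.e. of the restrictions to the circle of
functions that are holomorphic on some annulus around the circle. -/
def analyticSubalgebra : Subalgebra ℂ (Circle → ℂ) where
  carrier := {f | ∃ n F, IsExtension n F f}
  mul_mem' := by
    rintro f g ⟨m, F, hF⟩ ⟨n, G, hG⟩
    have hF' := hF.mono (le_max_left m n)
    have hG' := hG.mono (le_max_right m n)
    exact ⟨max m n, F * G, hF'.1.mul hG'.1, fun z => by simp [hF.2, hG.2]⟩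
  add_mem' := by
    rintro f g ⟨m, F, hF⟩ ⟨n, G, hG⟩
    have hF' := hF.mono (le_max_left m n)
    have hG' := hG.mono (le_max_right m n)
    exact ⟨max m n, F + G, hF'.1.add hG'.1, fun z => by simp [hF.2, hG.2]⟩
  algebraMap_mem' a := ⟨0, fun _ => a, differentiableOn_const a, fun _ => rfl⟩

/-- The space `𝒪(S¹)` of real-analytic functions `S¹ → ℂ`. -/
def OS1 : Type := ↥analyticSubalgebra

namespace OS1

instance : CommRing OS1 := inferInstanceAs (CommRing ↥analyticSubalgebra)
instance : Algebra ℂ OS1 := inferInstanceAs (Algebra ℂ ↥analyticSubalgebra)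
instance : Algebra ℝ OS1 := inferInstanceAs (Algebra ℝ ↥analyticSubalgebra)
instance : CoeFun OS1 fun _ => Circle → ℂ := ⟨Subtype.val⟩

theorem ext {f g : OS1} (h : ∀ z : Circle, f z = g z) : f = g := Subtype.ext (funext h)

end OS1

/-- The space `𝒪(U)` of holomorphic functions on the annulus `annulus n`. As a subspace of
`C(annulus n, ℂ)` it carries the topology of uniform convergence on compact sets. -/
def Hol (n : ℕ) : Submodule ℂ C(annulus n, ℂ) where
  carrier := {f | ∃ F : ℂ → ℂ, DifferentiableOn ℂ F (annulus n) ∧ ∀ z : annulus n, F z = f z}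
  add_mem' := by
    rintro f g ⟨F, hF, hFf⟩ ⟨G, hG, hGg⟩
    exact ⟨F + G, hF.add hG, fun z => by simp [hFf, hGg]⟩
  zero_mem' := ⟨0, differentiableOn_const 0, fun _ => rfl⟩
  smul_mem' := by
    rintro a f ⟨F, hF, hFf⟩
    exact ⟨a • F, hF.const_smul a, fun z => by simp [hFf]⟩

/-- The restriction map `𝒪(U) → 𝒪(S¹)`. -/
def restrict (n : ℕ) : Hol n →ₗ[ℂ] OS1 where
  toFun f := ⟨fun z => f.1 ⟨z, coe_mem_annulus n z⟩, by
    obtain ⟨F, hF, hFf⟩ := f.2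
    exact ⟨n, F, hF, fun z => hFf ⟨z, coe_mem_annulus n z⟩⟩⟩
  map_add' _ _ := rfl
  map_smul' _ _ := rfl

/-- The locally convex inductive limit topology on `𝒪(S¹)`: the finest locally convex vector space
topology for which all restriction maps are continuous. -/
instance : TopologicalSpace OS1 :=
  sInf {τ | @IsTopologicalAddGroup OS1 τ _ ∧ @ContinuousSMul ℂ OS1 _ _ τ ∧
    @LocallyConvexSpace ℝ OS1 _ _ _ _ τ ∧
    ∀ n, @Continuous (Hol n) OS1 _ τ (restrict n)}

/-- The Frölicher structure of `𝒪(S¹)` given by the smooth curves in this topological vector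
space. -/
instance : FrolicherSpace OS1 := FrolicherSpace.ofCurves {c | IsSmoothCurve c}

/-! ## Complex-valued vector fields on the circle -/

/-- The derivative `f'(z) = -i z⁻¹ ∂_θ f(z e^{iθ})` at `θ = 0`. -/
def circleDeriv (f : Circle → ℂ) (z : Circle) : ℂ :=
  deriv (fun θ : ℝ => f (z * Circle.exp θ)) 0 / (Complex.I * z)

theorem IsExtension.hasDerivAt {n : ℕ} {F : ℂ → ℂ} {f : Circle → ℂ} (hF : IsExtension n F f)
    (z : Circle) : HasDerivAt F (circleDeriv f z) z := by
  have hd : HasDerivAt F (deriv F z) z :=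
    (hF.1.differentiableAt ((isOpen_annulus n).mem_nhds (coe_mem_annulus n z))).hasDerivAt
  have hi : HasDerivAt (fun θ : ℝ => (z : ℂ) * Complex.exp (θ * Complex.I))
      (z * Complex.I) 0 := by
    have h1 : HasDerivAt (fun θ : ℝ => (θ : ℂ) * Complex.I) Complex.I 0 := by
      simpa using (Complex.ofRealCLM.hasDerivAt (x := (0 : ℝ))).mul_const Complex.I
    simpa using (h1.cexp).const_mul (z : ℂ)
  have hc : HasDerivAt (fun θ : ℝ => f (z * Circle.exp θ)) (deriv F z * (z * Complex.I)) 0 := by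
    have h2 : HasDerivAt F (deriv F z) ((z : ℂ) * Complex.exp (((0 : ℝ) : ℂ) * Complex.I)) := by
      simpa using hd
    have h3 := HasDerivAt.comp (0 : ℝ) h2 hi
    refine h3.congr_of_eventuallyEq (Eventually.of_forall fun θ => ?_)
    simp [← hF.2, Circle.coe_exp]
  have : circleDeriv f z = deriv F z := by
    unfold circleDeriv
    rw [hc.deriv]
    have hz : (z : ℂ) ≠ 0 := Circle.coe_ne_zero z
    field_simp
  rwa [this]

/-- The derivative as a map `𝒪(S¹) → 𝒪(S¹)`. -/
def OS1.d (f : OS1) : OS1 :=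
  ⟨circleDeriv f, by
    obtain ⟨n, F, hF⟩ := f.2
    exact ⟨n, deriv F, hF.1.deriv (isOpen_annulus n), fun z => (hF.hasDerivAt z).deriv⟩⟩

theorem OS1.d_add (f g : OS1) : (f + g).d = f.d + g.d := by
  obtain ⟨m, F, hF⟩ := f.2
  obtain ⟨n, G, hG⟩ := g.2
  have h : IsExtension (max m n) (F + G) (f + g : OS1) :=
    ⟨(hF.mono (le_max_left m n)).1.add (hG.mono (le_max_right m n)).1,
      fun z => congrArg₂ (· + ·) (hF.2 z) (hG.2 z)⟩
  exact OS1.ext fun z => (h.hasDerivAt z).unique ((hF.hasDerivAt z).add (hG.hasDerivAt z))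

theorem OS1.d_mul (f g : OS1) : (f * g).d = f.d * g + f * g.d := by
  obtain ⟨m, F, hF⟩ := f.2
  obtain ⟨n, G, hG⟩ := g.2
  have h : IsExtension (max m n) (F * G) (f * g : OS1) :=
    ⟨(hF.mono (le_max_left m n)).1.mul (hG.mono (le_max_right m n)).1,
      fun z => congrArg₂ (· * ·) (hF.2 z) (hG.2 z)⟩
  refine OS1.ext fun z =>
    ((h.hasDerivAt z).unique ((hF.hasDerivAt z).mul (hG.hasDerivAt z))).trans ?_
  rw [hF.2, hG.2]
  rfl

theorem OS1.d_smul (r : ℝ) (f : OS1) : (r • f).d = r • f.d := by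
  obtain ⟨m, F, hF⟩ := f.2
  have h : IsExtension m (fun z => r • F z) (r • f : OS1) :=
    ⟨hF.1.const_smul r, fun z => congrArg (r • ·) (hF.2 z)⟩
  exact OS1.ext fun z => (h.hasDerivAt z).unique ((hF.hasDerivAt z).const_smul r)

theorem OS1.d_sub (f g : OS1) : (f - g).d = f.d - g.d := by
  have h := OS1.d_add (f - g) g
  rw [sub_add_cancel] at h
  rw [h, add_sub_cancel_right]

/-- Real-analytic complex-valued vector fields `v(z) ∂_z` on the circle, identified with their
coordinate functions. -/
def VectC : Type := OS1

namespace VectC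

instance : AddCommGroup VectC := inferInstanceAs (AddCommGroup OS1)
instance : Module ℝ VectC := inferInstanceAs (Module ℝ OS1)
instance : TopologicalSpace VectC := inferInstanceAs (TopologicalSpace OS1)
instance : FrolicherSpace VectC := inferInstanceAs (FrolicherSpace OS1)

/-- The coordinate function of a vector field. -/
def coeff (v : VectC) : OS1 := v

/-- The Lie bracket `[v, w] = (w v' - v w') ∂_z`. -/
instance : Bracket VectC VectC := ⟨fun v w => (w.coeff * v.coeff.d - v.coeff * w.coeff.d : OS1)⟩

theorem bracket_def (v w : VectC) :
    ⁅v, w⁆ = (w.coeff * v.coeff.d - v.coeff * w.coeff.d : OS1) := rfl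

instance : LieRing VectC where
  add_lie u v w := by
    change w.coeff * (u.coeff + v.coeff).d - (u.coeff + v.coeff) * w.coeff.d =
      (w.coeff * u.coeff.d - u.coeff * w.coeff.d) + (w.coeff * v.coeff.d - v.coeff * w.coeff.d)
    rw [OS1.d_add]; ring
  lie_add u v w := by
    change (v.coeff + w.coeff) * u.coeff.d - u.coeff * (v.coeff + w.coeff).d =
      (v.coeff * u.coeff.d - u.coeff * v.coeff.d) + (w.coeff * u.coeff.d - u.coeff * w.coeff.d)
    rw [OS1.d_add]; ring
  lie_self v := sub_self (v.coeff * v.coeff.d)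
  leibniz_lie u v w := by
    change (w.coeff * v.coeff.d - v.coeff * w.coeff.d) * u.coeff.d -
        u.coeff * (w.coeff * v.coeff.d - v.coeff * w.coeff.d).d =
      (w.coeff * (v.coeff * u.coeff.d - u.coeff * v.coeff.d).d -
        (v.coeff * u.coeff.d - u.coeff * v.coeff.d) * w.coeff.d) +
      ((w.coeff * u.coeff.d - u.coeff * w.coeff.d) * v.coeff.d -
        v.coeff * (w.coeff * u.coeff.d - u.coeff * w.coeff.d).d)
    simp only [OS1.d_sub, OS1.d_mul]
    ring

instance : LieAlgebra ℝ VectC where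
  lie_smul r v w := by
    change (r • w.coeff) * v.coeff.d - v.coeff * (r • w.coeff).d =
      r • (w.coeff * v.coeff.d - v.coeff * w.coeff.d)
    rw [OS1.d_smul, smul_mul_assoc, mul_smul_comm, smul_sub]

end VectC

/-! ## Complex deformations of the circle -/

/-- The loop `φ : S¹ → ℂ ∖ {0}` has winding number `k` around `0`: `φ(e^{iθ}) = exp (L θ)` with a
continuous `L` increasing by `2πik` over a period. -/
def HasWindingNumber (φ : Circle → ℂ) (k : ℤ) : Prop :=
  ∃ L : ℝ → ℂ, Continuous L ∧ (∀ θ : ℝ, φ (Circle.exp θ) = Complex.exp (L θ)) ∧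
    ∀ θ : ℝ, L (θ + 2 * Real.pi) = L θ + 2 * Real.pi * k * Complex.I

/-- Complex deformations of the circle: injective real-analytic maps `S¹ → ℂ ∖ {0}` of winding
number one around `0`. -/
def DefC : Type :=
  {φ : OS1 // Function.Injective (φ : Circle → ℂ) ∧ (∀ z, φ z ≠ 0) ∧ HasWindingNumber φ 1}

namespace DefC

instance : CoeFun DefC fun _ => Circle → ℂ := ⟨fun φ => φ.1⟩

/-- The subspace Frölicher structure. -/
instance : FrolicherSpace DefC := FrolicherSpace.induced (fun φ : DefC => φ.1)

/-- The identity. -/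
def id : DefC :=
  ⟨⟨fun z => z, 0, fun z => z, differentiableOn_id, fun _ => rfl⟩,
    fun _ _ h => Circle.ext h, fun z => Circle.coe_ne_zero z,
    fun θ => θ * Complex.I, by fun_prop, fun θ => Circle.coe_exp θ,
    fun θ => by push_cast; ring⟩

/-- The union of the unit circle and the image of `φ`. -/
def twoCurves (φ : DefC) : Set ℂ := Metric.sphere 0 1 ∪ Set.range (φ : Circle → ℂ)

/-- The compact region `U(φ)` between `S¹` and `φ(S¹)`: the two curves together with all connected
components of their complement in the Riemann sphere containing neither `0` nor `∞`
(a component contains `∞` iff it is unbounded in `ℂ`). -/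
def region (φ : DefC) : Set ℂ :=
  twoCurves φ ∪ {z | (0 : ℂ) ∉ connectedComponentIn (twoCurves φ)ᶜ z ∧
    Bornology.IsBounded (connectedComponentIn (twoCurves φ)ᶜ z)}

/-- `F` is holomorphic, injective and without zeros on an open neighbourhood of `K`. -/
def IsUnivalentNear (F : ℂ → ℂ) (K : Set ℂ) : Prop :=
  ∃ W : Set ℂ, IsOpen W ∧ K ⊆ W ∧ DifferentiableOn ℂ F W ∧ Set.InjOn F W ∧ ∀ z ∈ W, F z ≠ 0

/-- The pair `(φ, ψ)` is composable with composition `χ = φ ∘ ψ`: `φ` extends univalently and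
without zeros to a neighbourhood of `U(ψ)`, and `χ` is the composition of the extension
with `ψ`. -/
def IsComp (φ ψ χ : DefC) : Prop :=
  ∃ F : ℂ → ℂ, IsUnivalentNear F (region ψ) ∧ (∀ z : Circle, F z = φ z) ∧
    ∀ z : Circle, χ z = F (ψ z)

/-- `φ` is invertible with inverse `χ`: the inverse map `φ(S¹) → S¹` extends univalently and without
zeros to a neighbourhood of `U(φ)`, and `χ` is the restriction of the extension to `S¹`. -/
def IsInv (φ χ : DefC) : Prop :=
  ∃ G : ℂ → ℂ, IsUnivalentNear G (region φ) ∧ (∀ z : Circle, G (φ z) = z) ∧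
    ∀ z : Circle, χ z = G z

/-- `κ = φ ∘ ψ ∘ φ⁻¹ ∘ ψ⁻¹`, with all inverses and compositions defined. -/
def IsCommutator (φ ψ κ : DefC) : Prop :=
  ∃ φi ψi a b : DefC, IsInv φ φi ∧ IsInv ψ ψi ∧ IsComp φ ψ a ∧ IsComp a φi b ∧ IsComp b ψi κ

/-- The tangent vector `[t ↦ φ ∘ η(t) ∘ φ⁻¹ ∘ η(t)⁻¹]` is defined and equal to `v`. Since the
commutator is only defined for small `t`, it is the class of any smooth curve in `DefC` that is
equal to it for small `t`. -/
def IsCommutatorVector (φ : DefC) (η : RootedCurve DefC.id) (v : Tangent DefC.id) : Prop :=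
  ∃ κ : RootedCurve DefC.id, (∀ᶠ t in 𝓝 (0 : ℝ), IsCommutator φ (η.1 t) (κ.1 t)) ∧
    Tangent.mk κ = v

/-- `c` is a smooth curve in `T_id DefC`, rooted at zero, with
`c(s) = [t ↦ γ(s) ∘ η(t) ∘ γ(s)⁻¹ ∘ η(t)⁻¹]` for small `s`. -/
def IsCommutatorCurve (γ η : RootedCurve DefC.id) (c : RootedCurve (Tangent.zero DefC.id)) :
    Prop :=
  ∀ᶠ s in 𝓝 (0 : ℝ), IsCommutatorVector (γ.1 s) η (c.1 s)

/-- For small times, `γ` solves the right-trivializing flow equation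
`∂_t Φ(t, z) = Φ'(t, z) w(z)`, `Φ(0, z) = z`. -/
def IsRightFlow (w : VectC) (γ : RootedCurve DefC.id) : Prop :=
  ∀ᶠ t in 𝓝 (0 : ℝ), ∀ z : Circle,
    HasDerivAt (fun s => γ.1 s z) ((γ.1 t).1.d z * w.coeff z) t

/-- For small times, `γ` solves the left-trivializing flow equation
`∂_t Φ(t, z) = w(Φ(t, z))`, `Φ(0, z) = z`, where `w` is continued analytically to an annulus. -/
def IsLeftFlow (w : VectC) (γ : RootedCurve DefC.id) : Prop :=
  ∃ (n : ℕ) (W : ℂ → ℂ), IsExtension n W w.coeff ∧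
    ∀ᶠ t in 𝓝 (0 : ℝ), ∀ z : Circle,
      γ.1 t z ∈ annulus n ∧ HasDerivAt (fun s => γ.1 s z) (W (γ.1 t z)) t

end DefC

end CircleDef

end

noncomputable section

namespace CircleDef

/-! ## Boman's theorem -/

section Boman

open MeasureTheory

variable {V : Type*} [NormedAddCommGroup V] [NormedSpace ℝ V]

/-! The analytic core is a concrete description of smooth curves in `OS1`: locally in time such a
curve is a family of holomorphic functions on one fixed annulus, jointly smooth in `(t, z)`
(`ScalarSmooth.exists_smoothFamily`). To see this, test the Laurent coefficients with functionals `f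
↦ ∑ w_k β_k a_k(f)`, `w` subexponential and `β` bounded. Uniform boundedness gives bounds that are
uniform in time for each weight `w`, and a sequence that stays bounded against every subexponential
weight decays exponentially. Interpolation between a function and its high derivatives then gives
all time derivatives a common exponential rate. Conversely, a smooth family on one annulus is a
smooth curve, because its difference quotients already converge in a single step of the inductive
limit. Hence smoothness of curves can be checked with scalar functionals alone
(`mem_curves_OS1_iff`).

The tangent space is computed from two classical facts. Boman's theorem makes `F(s, t) = f(id + t
a(s))` jointly smooth near `t = 0` for every smooth function `f` on `DefC` and every smooth curve
`a`. Hadamard's lemma writes a rooted curve as `id + t g(t)`. Since `F(s, 0)` does not depend on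
`s`, the derivatives of `F(t, t)` and `F(0, t)` at `0` agree, so the class of the curve depends only
on `g(0)`; point evaluations show that it determines `g(0)`. Thus `tangentOf` identifies `OS1` with
the tangent space. Additivity holds because a smooth function that is homogeneous of degree one is
linear. The same argument one level higher gives the bijectivity of `Ξ`.

For the bracket, cutting off time turns both curves into families as close to the identity as
desired, on a common annulus (`NearId`). There inverses and compositions exist, and `U(ψ)` lies in a
thin annulus, where everything is univalent. Extensions are only required near `U(ψ)`, so uniqueness
of compositions and inverses needs a connected piece of `U(ψ)` that joins `S¹` to `ψ(S¹)`, along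
which the identity theorem propagates equality. Differentiating the commutator at `t = 0` gives the
adjoint action of `γ(s)` on the velocity `v` of `η`, minus `v`; differentiating that at `s = 0`
gives `u' v - u v'` with `u` the velocity of `γ`.

The right flow is the Lie series `∑ tⁿ/n! (W ∂_z)ⁿ z`, convergent by Cauchy estimates; inverting it
at time `-t` solves the left equation. Both have velocity `w` at time `0`. The Lie algebra structure
on the tangent space is transported from `VectC`, so its axioms need no separate argument. -/

theorem summable_two_pow_mul_sq (C : ℝ) (j : ℕ) :
    Summable fun n : ℕ => (2 : ℝ) ^ (n * j) * C * (1 / 2 : ℝ) ^ (n ^ 2) := by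
  have h : Summable fun n : ℕ => |C| * (1 / 2 : ℝ) ^ n :=
    (summable_geometric_of_lt_one (by norm_num) (by norm_num)).mul_left _
  refine Summable.of_norm_bounded_eventually_nat h ?_
  filter_upwards [eventually_ge_atTop (j + 1)] with n hn
  -- The part `n j` of the exponent cancels `2 ^ (n j)`, the part `n` leaves a geometric series, and
  -- the rest only makes the term smaller.
  have e : n ^ 2 = n * j + n + n * (n - (j + 1)) := by
    obtain ⟨m, rfl⟩ := Nat.exists_eq_add_of_le hn
    simp only [Nat.add_sub_cancel_left]; ring
  rw [e, pow_add, pow_add, norm_mul, norm_mul, norm_mul, norm_mul, Real.norm_eq_abs C]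
  simp only [norm_pow, Real.norm_eq_abs]
  have h1 : |(2 : ℝ)| ^ (n * j) * |(1 / 2 : ℝ)| ^ (n * j) = 1 := by
    rw [← mul_pow]; norm_num
  have h2 : |(1 / 2 : ℝ)| ^ (n * (n - (j + 1))) ≤ 1 :=
    pow_le_one₀ (abs_nonneg _) (by norm_num [abs_of_pos])
  have h3 : |(1 / 2 : ℝ)| = 1 / 2 := abs_of_pos (by norm_num)
  calc _ = (|(2 : ℝ)| ^ (n * j) * |(1 / 2 : ℝ)| ^ (n * j)) * (|C| * |(1 / 2 : ℝ)| ^ n) *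
        |(1 / 2 : ℝ)| ^ (n * (n - (j + 1))) := by ring
    _ ≤ (|(2 : ℝ)| ^ (n * j) * |(1 / 2 : ℝ)| ^ (n * j)) * (|C| * |(1 / 2 : ℝ)| ^ n) * 1 := by
        gcongr
    _ = _ := by rw [h1, h3]; ring

/-- A sum of bumps at the points `2⁻ⁿ` with rapidly decreasing coefficients is smooth. -/
theorem contDiff_tsum_scaled_bump [CompleteSpace V] {φ : ℝ → ℝ} (hφ : ContDiff ℝ ∞ φ)
    (hc : HasCompactSupport φ) {p : ℕ → V} (hp : ∀ n, ‖p n‖ ≤ (1 / 2 : ℝ) ^ (n ^ 2)) :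
    ContDiff ℝ ∞ fun τ : ℝ => ∑' n : ℕ, φ (2 ^ n * τ - 1) • p n := by
  have hb : ∀ j : ℕ, ∃ C, ∀ x, ‖iteratedFDeriv ℝ j φ x‖ ≤ C := fun j =>
    (hφ.continuous_iteratedFDeriv (mod_cast le_top)).bounded_above_of_compact_support
      (hc.iteratedFDeriv j)
  choose C hC using hb
  -- Each derivative of the `n`-th bump costs a factor `2 ^ n`; the coefficients of size `2 ^ (-n²)`
  -- pay for any fixed number of them.
  refine contDiff_tsum (v := fun j n => 2 ^ (n * j) * C j * (1 / 2 : ℝ) ^ (n ^ 2))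
    (fun n => by fun_prop) (fun j _ => summable_two_pow_mul_sq _ _) fun j n x _ => ?_
  have hs : ContDiff ℝ j fun y : ℝ => φ (y - 1) := by
    have : ContDiff ℝ ∞ fun y : ℝ => φ (y - 1) := by fun_prop
    exact this.of_le (mod_cast le_top)
  have e1 : iteratedFDeriv ℝ j (fun τ : ℝ => φ (2 ^ n * τ - 1) • p n) x =
      iteratedFDeriv ℝ j ((ContinuousLinearMap.smulRight (1 : ℝ →L[ℝ] ℝ) (p n)) ∘
        fun τ : ℝ => φ (2 ^ n * τ - 1)) x := by
    congr 1
  have e2 : ‖iteratedFDeriv ℝ j (fun τ : ℝ => φ (2 ^ n * τ - 1)) x‖ ≤ 2 ^ (n * j) * C j := by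
    rw [norm_iteratedFDeriv_eq_norm_iteratedDeriv,
      iteratedDeriv_comp_const_smul (f := fun y => φ (y - 1)) hs (2 ^ n)]
    simp only [norm_smul, norm_pow, Real.norm_ofNat, ← pow_mul]
    gcongr
    rw [iteratedDeriv_comp_sub_const, ← norm_iteratedFDeriv_eq_norm_iteratedDeriv]
    exact hC _ _
  rw [e1]
  have hs2 : ContDiffAt ℝ j (fun τ : ℝ => φ (2 ^ n * τ - 1)) x := by
    have : ContDiff ℝ ∞ fun y : ℝ => φ (2 ^ n * y - 1) := by fun_prop
    exact (this.of_le (mod_cast le_top)).contDiffAt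
  refine (ContinuousLinearMap.norm_iteratedFDeriv_comp_left _ hs2 le_rfl).trans ?_
  have hn : ‖ContinuousLinearMap.smulRight (1 : ℝ →L[ℝ] ℝ) (p n)‖ ≤ (1 / 2 : ℝ) ^ (n ^ 2) := by
    rw [ContinuousLinearMap.norm_smulRight_apply]; simpa using hp n
  calc _ ≤ (1 / 2 : ℝ) ^ (n ^ 2) * (2 ^ (n * j) * C j) := by gcongr
    _ = _ := by ring

/-- The special curve lemma: a smooth curve with prescribed affine pieces near the points
`2⁻ⁿ`. -/
theorem exists_contDiff_curve_through [CompleteSpace V] {p v : ℕ → V}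
    (hp : ∀ n, ‖p n‖ ≤ (1 / 2 : ℝ) ^ (n ^ 2)) (hv : ∀ n, ‖v n‖ ≤ (1 / 2 : ℝ) ^ (n ^ 2)) :
    ∃ c : ℝ → V, ContDiff ℝ ∞ c ∧
      ∀ n : ℕ, ∀ᶠ τ in 𝓝 (0 : ℝ), c ((1 / 2) ^ n + τ) = p n + τ • v n := by
  -- If `2 ^ n τ` is within `1/8` of `1`, then `2 ^ m τ` is below `9/16` for `m < n` and above `7/4`
  -- for `m > n`. Both are farther than `1/4` from `1`, so only the `n`-th bump is seen near `2⁻ⁿ`,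
  -- and it equals `1` there.
  let χ : ContDiffBump (0 : ℝ) := ⟨1 / 8, 1 / 4, by norm_num, by norm_num⟩
  have hχ : ContDiff ℝ ∞ χ := χ.contDiff
  have hχ2 : ContDiff ℝ ∞ fun y : ℝ => y * χ y := contDiff_id.mul hχ
  have hv' : ∀ n, ‖(1 / 2 : ℝ) ^ n • v n‖ ≤ (1 / 2 : ℝ) ^ (n ^ 2) := fun n => by
    rw [norm_smul]
    refine (mul_le_of_le_one_left (norm_nonneg _) ?_).trans (hv n)
    rw [norm_pow]; exact pow_le_one₀ (norm_nonneg _) (by norm_num)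
  refine ⟨fun τ => (∑' n : ℕ, χ (2 ^ n * τ - 1) • p n) +
    ∑' n : ℕ, ((2 ^ n * τ - 1) * χ (2 ^ n * τ - 1)) • ((1 / 2 : ℝ) ^ n • v n),
    (contDiff_tsum_scaled_bump hχ χ.hasCompactSupport hp).add
      (contDiff_tsum_scaled_bump hχ2 χ.hasCompactSupport.mul_left hv'), fun n => ?_⟩
  have hlt : ∀ᶠ τ : ℝ in 𝓝 0, |2 ^ n * τ| < 1 / 8 := by
    have : Tendsto (fun τ : ℝ => |2 ^ n * τ|) (𝓝 0) (𝓝 0) := by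
      have h : Continuous fun τ : ℝ => |2 ^ n * τ| := by fun_prop
      simpa using h.tendsto 0
    exact this.eventually (gt_mem_nhds (by norm_num))
  filter_upwards [hlt] with τ hτ
  have h2 : (2 : ℝ) ^ n * (1 / 2) ^ n = 1 := by rw [← mul_pow]; norm_num
  have e0 : (2 : ℝ) ^ n * ((1 / 2) ^ n + τ) - 1 = 2 ^ n * τ := by rw [mul_add, h2]; ring
  have h1 : χ (2 ^ n * ((1 / 2) ^ n + τ) - 1) = 1 := by
    rw [e0]; exact χ.one_of_mem_closedBall (by
      rw [Metric.mem_closedBall, dist_zero_right, Real.norm_eq_abs]; exact hτ.le)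
  have h0 : ∀ m, m ≠ n → χ (2 ^ m * ((1 / 2) ^ n + τ) - 1) = 0 := by
    intro m hm
    refine χ.zero_of_le_dist ?_
    rw [dist_zero_right, Real.norm_eq_abs]
    change (1 / 4 : ℝ) ≤ _
    have hx : 7 / 8 < 2 ^ n * ((1 / 2) ^ n + τ) ∧ 2 ^ n * ((1 / 2) ^ n + τ) < 9 / 8 := by
      have := abs_lt.1 hτ
      constructor <;> linarith
    set x := 2 ^ n * ((1 / 2) ^ n + τ) with hxdef
    rcases lt_or_gt_of_ne hm with h | h
    · obtain ⟨k, rfl⟩ := Nat.exists_eq_add_of_lt h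
      have : 2 * (2 ^ m * ((1 / 2) ^ (m + k + 1) + τ)) ≤ x := by
        rw [hxdef, pow_add, pow_add]
        have hk : (1 : ℝ) ≤ 2 ^ k := one_le_pow₀ (by norm_num)
        have hpos : 0 < (2 : ℝ) ^ m * ((1 / 2) ^ (m + k + 1) + τ) := by
          have h3 : 0 < 2 ^ (m + k + 1) * ((1 / 2 : ℝ) ^ (m + k + 1) + τ) := by linarith [hx.1]
          have h4 : 0 < (1 / 2 : ℝ) ^ (m + k + 1) + τ := pos_of_mul_pos_right h3 (by positivity)
          positivity
        have hpos' : 0 < (2 : ℝ) ^ m * ((1 / 2) ^ m * (1 / 2) ^ k * (1 / 2) ^ 1 + τ) := by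
          rwa [pow_add, pow_add] at hpos
        calc _ = 1 * (2 * (2 ^ m * ((1 / 2 : ℝ) ^ m * (1 / 2) ^ k * (1 / 2) ^ 1 + τ))) := by
              rw [one_mul]
          _ ≤ 2 ^ k * (2 * (2 ^ m * ((1 / 2 : ℝ) ^ m * (1 / 2) ^ k * (1 / 2) ^ 1 + τ))) := by
              gcongr
          _ = _ := by ring
      rw [abs_of_neg (by linarith [hx.2])]
      linarith [hx.2]
    · obtain ⟨k, rfl⟩ := Nat.exists_eq_add_of_lt h
      have : 2 * x ≤ 2 ^ (n + k + 1) * ((1 / 2) ^ n + τ) := by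
        have hk : (1 : ℝ) ≤ 2 ^ k := one_le_pow₀ (by norm_num)
        calc 2 * x = 1 * (2 * x) := by ring
          _ ≤ 2 ^ k * (2 * x) := by
              have : 0 < x := by linarith [hx.1]
              gcongr
          _ = _ := by rw [hxdef]; ring
      rw [abs_of_pos (by linarith [hx.1])]
      linarith [hx.1]
  rw [tsum_eq_single n fun m hm => by rw [h0 m hm, zero_smul],
    tsum_eq_single n fun m hm => by rw [h0 m hm, mul_zero, zero_smul], h1, one_smul, mul_one, e0,
    smul_smul]
  congr 2
  calc (2 : ℝ) ^ n * τ * (1 / 2) ^ n = (2 ^ n * (1 / 2) ^ n) * τ := by ring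
    _ = τ := by rw [h2, one_mul]

/-- A function that is smooth along all smooth curves. -/
def ArcSmooth (F : V → ℝ) : Prop := ∀ c : ℝ → V, ContDiff ℝ ∞ c → ContDiff ℝ ∞ (F ∘ c)

/-- The `k`-th derivative of `F` at `q` in the direction `v`. -/
def dirDeriv (k : ℕ) (F : V → ℝ) (q v : V) : ℝ :=
  iteratedDeriv k (fun τ : ℝ => F (q + τ • v)) 0

theorem ArcSmooth.line {F : V → ℝ} (hF : ArcSmooth F) (q v : V) :
    ContDiff ℝ ∞ fun τ : ℝ => F (q + τ • v) :=
  hF (fun τ => q + τ • v) (by fun_prop)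

theorem dirDeriv_add_smul (k : ℕ) (F : V → ℝ) (q v : V) (τ : ℝ) :
    dirDeriv k F (q + τ • v) v = iteratedDeriv k (fun τ : ℝ => F (q + τ • v)) τ := by
  have h := congrFun (iteratedDeriv_comp_const_add k (fun τ : ℝ => F (q + τ • v)) τ) 0
  rw [add_zero] at h
  rw [← h, dirDeriv]
  congr 1
  ext σ
  rw [add_smul, add_assoc]

theorem ArcSmooth.hasDerivAt_dirDeriv {F : V → ℝ} (hF : ArcSmooth F) (k : ℕ) (q v : V) (τ : ℝ) :
    HasDerivAt (fun τ : ℝ => dirDeriv k F (q + τ • v) v) (dirDeriv (k + 1) F (q + τ • v) v) τ := by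
  simp_rw [dirDeriv_add_smul]
  rw [iteratedDeriv_succ]
  exact ((hF.line q v).differentiable_iteratedDeriv k (mod_cast WithTop.coe_lt_top _) τ).hasDerivAt

theorem ArcSmooth.dirDeriv_smul {F : V → ℝ} (hF : ArcSmooth F) (k : ℕ) (q v : V) (r : ℝ) :
    dirDeriv k F q (r • v) = r ^ k * dirDeriv k F q v := by
  have h := congrFun (iteratedDeriv_comp_const_smul (n := k) (f := fun τ : ℝ => F (q + τ • v))
    ((hF.line q v).of_le (mod_cast le_top)) r) 0
  rw [mul_zero] at h
  rw [dirDeriv, dirDeriv, ← smul_eq_mul, ← h]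
  congr 1
  ext τ
  rw [smul_smul, mul_comm]

/-- Directional derivatives of arc-smooth functions are locally bounded. -/
theorem ArcSmooth.exists_dirDeriv_bound [CompleteSpace V] {F : V → ℝ} (hF : ArcSmooth F) (k : ℕ)
    (p : V) : ∃ ε > 0, ∃ C, ∀ q, ‖q - p‖ < ε → ∀ v, ‖v‖ ≤ 1 → |dirDeriv k F q v| ≤ C := by
  -- Otherwise there are points `q n` within `2 ^ (-n²)` of `p` whose `k`-th directional derivatives
  -- exceed `n 2 ^ (n² k)`. A smooth curve runs through `q n` at time `2⁻ⁿ` with velocity `2 ^ (-n²)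
  -- v n`. The `k`-th derivative of `F` along it at time `2⁻ⁿ` has size at least `n`, although it
  -- must converge as `n → ∞`.
  by_contra! hcon
  have h1 : ∀ n : ℕ, ∃ q v, ‖q - p‖ < (1 / 2 : ℝ) ^ (n ^ 2) ∧ ‖v‖ ≤ 1 ∧
      n * ((2 : ℝ) ^ (n ^ 2)) ^ k < |dirDeriv k F q v| := by
    intro n
    obtain ⟨q, hq, v, hv, h⟩ := hcon ((1 / 2 : ℝ) ^ (n ^ 2)) (by positivity)
      (n * ((2 : ℝ) ^ (n ^ 2)) ^ k)
    exact ⟨q, v, hq, hv, h⟩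
  choose q v hq hv hD using h1
  obtain ⟨c, hc, hcn⟩ := exists_contDiff_curve_through (p := fun n => q n - p)
    (v := fun n => (1 / 2 : ℝ) ^ (n ^ 2) • v n) (fun n => (hq n).le) (fun n => by
      rw [norm_smul, norm_pow, Real.norm_of_nonneg (by norm_num)]
      exact mul_le_of_le_one_right (by positivity) (hv n))
  have hs : ContDiff ℝ ∞ (F ∘ fun τ => p + c τ) := hF _ (by fun_prop)
  have hlim : Tendsto (fun n : ℕ => iteratedDeriv k (F ∘ fun τ => p + c τ) ((1 / 2 : ℝ) ^ n)) atTop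
      (𝓝 (iteratedDeriv k (F ∘ fun τ => p + c τ) 0)) :=
    ((hs.continuous_iteratedDeriv k (mod_cast le_top)).tendsto 0).comp
      (tendsto_pow_atTop_nhds_zero_of_lt_one (by norm_num) (by norm_num))
  have heq : ∀ n : ℕ, iteratedDeriv k (F ∘ fun τ => p + c τ) ((1 / 2 : ℝ) ^ n) =
      ((1 / 2 : ℝ) ^ (n ^ 2)) ^ k * dirDeriv k F (q n) (v n) := by
    intro n
    rw [← hF.dirDeriv_smul, dirDeriv]
    have h := congrFun (iteratedDeriv_comp_const_add k (F ∘ fun τ => p + c τ) ((1 / 2 : ℝ) ^ n)) 0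
    rw [add_zero] at h
    rw [← h]
    refine Filter.EventuallyEq.iteratedDeriv_eq k ?_
    filter_upwards [hcn n] with τ hτ
    simp only [Function.comp, hτ]
    congr 1
    abel
  have hb : ∀ n : ℕ, (n : ℝ) ≤ ‖iteratedDeriv k (F ∘ fun τ => p + c τ) ((1 / 2 : ℝ) ^ n)‖ := by
    intro n
    rw [heq, norm_mul, Real.norm_eq_abs (dirDeriv _ _ _ _), norm_pow, norm_pow,
      Real.norm_of_nonneg (by norm_num : (0 : ℝ) ≤ 1 / 2)]
    have h := hD n
    have e : ((1 / 2 : ℝ) ^ (n ^ 2)) ^ k * ((2 : ℝ) ^ (n ^ 2)) ^ k = 1 := by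
      rw [← mul_pow, ← mul_pow]; norm_num
    calc (n : ℝ) = ((1 / 2 : ℝ) ^ (n ^ 2)) ^ k * (n * ((2 : ℝ) ^ (n ^ 2)) ^ k) := by
          rw [mul_left_comm, e, mul_one]
      _ ≤ _ := by gcongr
  exact not_tendsto_nhds_of_tendsto_atTop (tendsto_atTop_mono hb tendsto_natCast_atTop_atTop) _
    hlim.norm

/-- A local bound for first directional derivatives gives, by the mean value inequality on the
segment from `p` to `q`, the estimate `|F q - F p| ≤ C ‖q - p‖`. -/
theorem ArcSmooth.continuous [CompleteSpace V] {F : V → ℝ} (hF : ArcSmooth F) : Continuous F := by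
  rw [continuous_iff_continuousAt]
  intro p
  obtain ⟨ε, hε, C, hC⟩ := hF.exists_dirDeriv_bound 1 p
  have hC0 : 0 ≤ C := (abs_nonneg _).trans (hC p (by simpa) 0 (by simp))
  have key : ∀ q, ‖q - p‖ < ε → |F q - F p| ≤ C * ‖q - p‖ := by
    intro q hq
    have h1 : ∀ τ ∈ Set.Icc (0 : ℝ) 1, HasDerivWithinAt (fun τ : ℝ => F (p + τ • (q - p)))
        (dirDeriv 1 F (p + τ • (q - p)) (q - p)) (Set.Icc 0 1) τ := fun τ _ => by
      have h := (hF.hasDerivAt_dirDeriv 0 p (q - p) τ).hasDerivWithinAt (s := Set.Icc 0 1)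
      simpa [dirDeriv] using h
    have h2 : ∀ τ ∈ Set.Ico (0 : ℝ) 1, ‖dirDeriv 1 F (p + τ • (q - p)) (q - p)‖ ≤
        C * ‖q - p‖ := by
      intro τ hτ
      have e : q - p = ‖q - p‖ • (‖q - p‖⁻¹ • (q - p)) := by
        rcases eq_or_ne (q - p) 0 with h | h
        · simp [h]
        · rw [smul_smul, mul_inv_cancel₀ (norm_ne_zero_iff.2 h), one_smul]
      have hu : ‖‖q - p‖⁻¹ • (q - p)‖ ≤ 1 := by
        rw [norm_smul, norm_inv, norm_norm]; exact inv_mul_le_one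
      have := hC (p + τ • (q - p)) (by
        rw [add_sub_cancel_left, norm_smul, Real.norm_of_nonneg hτ.1]
        exact (mul_le_of_le_one_left (norm_nonneg _) hτ.2.le).trans_lt hq) _ hu
      have h3 : dirDeriv 1 F (p + τ • (q - p)) (q - p) = ‖q - p‖ *
          dirDeriv 1 F (p + τ • (q - p)) (‖q - p‖⁻¹ • (q - p)) := by
        conv_lhs => rw [e, hF.dirDeriv_smul, pow_one]
        rw [← e]
      rw [h3, norm_mul, norm_norm, mul_comm]
      gcongr
      exact this
    have h := norm_image_sub_le_of_norm_deriv_le_segment' h1 h2 1 (by simp)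
    simpa using h
  rw [ContinuousAt, tendsto_iff_norm_sub_tendsto_zero]
  have hz : Tendsto (fun q => C * ‖q - p‖) (𝓝 p) (𝓝 0) := by
    have h : Continuous fun q => C * ‖q - p‖ := by fun_prop
    simpa using h.tendsto p
  refine squeeze_zero' (Eventually.of_forall fun _ => norm_nonneg _) ?_ hz
  filter_upwards [Metric.ball_mem_nhds p hε] with q hq
  exact key q (by simpa [dist_eq_norm] using hq)

end Boman

/-! ### Boman's theorem through decay of the Fourier transform -/

section BomanFourier

open MeasureTheory
open scoped FourierTransform RealInnerProductSpace

theorem dirDeriv_eq_zero_of_notMem_tsupport {V : Type*} [NormedAddCommGroup V] [NormedSpace ℝ V]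
    {F : V → ℝ} (k : ℕ) {q v : V}
    (hq : q ∉ tsupport F) : dirDeriv k F q v = 0 := by
  have h : (fun τ : ℝ => F (q + τ • v)) =ᶠ[𝓝 0] fun _ => 0 := by
    have h0 : F =ᶠ[𝓝 q] 0 := notMem_tsupport_iff_eventuallyEq.1 hq
    have hc : Tendsto (fun τ : ℝ => q + τ • v) (𝓝 0) (𝓝 q) := by
      have : Continuous fun τ : ℝ => q + τ • v := by fun_prop
      simpa using this.tendsto 0
    exact hc.eventually h0
  rw [dirDeriv, h.iteratedDeriv_eq]
  simp

variable {V : Type*} [NormedAddCommGroup V] [InnerProductSpace ℝ V] [FiniteDimensional ℝ V]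
  [MeasurableSpace V] [BorelSpace V]

/-- Continuity of the directional derivatives in the base point is not yet known, but as sequential
limits of difference quotients they are measurable, which suffices for integration. -/
theorem ArcSmooth.measurable_dirDeriv {F : V → ℝ} (hF : ArcSmooth F) (v : V) (k : ℕ) :
    Measurable fun x => dirDeriv k F x v := by
  induction k with
  | zero => simpa [dirDeriv] using hF.continuous.measurable
  | succ k ih =>
    refine measurable_of_tendsto_metrizable (f := fun (n : ℕ) (x : V) =>
      ((1 : ℝ) / (n + 1))⁻¹ * (dirDeriv k F (x + ((1 : ℝ) / (n + 1)) • v) v - dirDeriv k F x v))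
      (fun n => ?_) ?_
    · exact ((ih.comp (measurable_id.add_const _)).sub ih).const_mul _
    · rw [tendsto_pi_nhds]
      intro x
      have h := hF.hasDerivAt_dirDeriv k x v 0
      rw [hasDerivAt_iff_tendsto_slope_zero] at h
      have hn : Tendsto (fun n : ℕ => (1 : ℝ) / (n + 1)) atTop (𝓝[≠] 0) :=
        tendsto_nhdsWithin_iff.2 ⟨tendsto_one_div_add_atTop_nhds_zero_nat,
          Eventually.of_forall fun n => by simp; positivity⟩
      simpa [Function.comp_def] using h.comp hn

theorem ArcSmooth.exists_dirDeriv_bound_of_compact {V : Type*} [NormedAddCommGroup V]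
    [InnerProductSpace ℝ V] [FiniteDimensional ℝ V] {F : V → ℝ} (hF : ArcSmooth F)
    (hc : HasCompactSupport F) (k : ℕ) :
    ∃ C, ∀ q v, ‖v‖ ≤ 1 → |dirDeriv k F q v| ≤ C := by
  have h : ∃ C, ∀ q ∈ tsupport F, ∀ v, ‖v‖ ≤ 1 → |dirDeriv k F q v| ≤ C := by
    refine IsCompact.induction_on (p := fun S => ∃ C, ∀ q ∈ S, ∀ v, ‖v‖ ≤ 1 →
      |dirDeriv k F q v| ≤ C) hc ⟨0, by simp⟩ (fun s t hst ⟨C, hC⟩ =>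
        ⟨C, fun q hq => hC q (hst hq)⟩) ?_ ?_
    · rintro s t ⟨C, hC⟩ ⟨D, hD⟩
      refine ⟨max C D, fun q hq v hv => ?_⟩
      rcases hq with hq | hq
      · exact (hC q hq v hv).trans (le_max_left _ _)
      · exact (hD q hq v hv).trans (le_max_right _ _)
    · intro p _
      obtain ⟨ε, hε, C, hC⟩ := hF.exists_dirDeriv_bound k p
      exact ⟨Metric.ball p ε, mem_nhdsWithin_of_mem_nhds (Metric.ball_mem_nhds p hε), C,
        fun q hq => hC q (by simpa [dist_eq_norm] using hq)⟩
  obtain ⟨C, hC⟩ := h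
  refine ⟨max C 0, fun q v hv => ?_⟩
  by_cases hq : q ∈ tsupport F
  · exact (hC q hq v hv).trans (le_max_left _ _)
  · rw [dirDeriv_eq_zero_of_notMem_tsupport k hq, abs_zero]; exact le_max_right _ _

theorem ArcSmooth.integrable_dirDeriv {F : V → ℝ} (hF : ArcSmooth F) (hc : HasCompactSupport F)
    (k : ℕ) (v : V) : Integrable fun x => (dirDeriv k F x v : ℂ) := by
  have hb : ∃ C, ∀ x, |dirDeriv k F x v| ≤ C := by
    obtain ⟨C, hC⟩ := hF.exists_dirDeriv_bound_of_compact hc k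
    refine ⟨‖v‖ ^ k * C, fun x => ?_⟩
    rcases eq_or_ne v 0 with rfl | hv
    · have h := hF.dirDeriv_smul k x 0 0
      have h0 := hC x 0 (by simp)
      rcases Nat.eq_zero_or_pos k with rfl | hk
      · simpa using h0
      · rw [zero_pow hk.ne', zero_smul, zero_mul] at h
        rw [h]; simp [zero_pow hk.ne']
    · have e : v = ‖v‖ • (‖v‖⁻¹ • v) := by
        rw [smul_smul, mul_inv_cancel₀ (norm_ne_zero_iff.2 hv), one_smul]
      rw [e, hF.dirDeriv_smul, abs_mul, ← e, abs_pow, abs_norm]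
      gcongr
      refine hC _ _ ?_
      rw [norm_smul, norm_inv, norm_norm]; exact inv_mul_le_one
  obtain ⟨C, hC⟩ := hb
  refine Integrable.ofReal ?_
  rw [← integrableOn_iff_integrable_of_support_subset (s := tsupport F) fun x hx => by
    by_contra h; exact hx (dirDeriv_eq_zero_of_notMem_tsupport k h)]
  exact Measure.integrableOn_of_bounded (M := C) hc.measure_lt_top.ne
    (hF.measurable_dirDeriv v k).aestronglyMeasurable
    (Eventually.of_forall fun x => by rw [Real.norm_eq_abs]; exact hC x)

/-- Integration by parts in the direction `v`. It only needs line derivatives and integrability,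
which are available before smoothness of `F` is. -/
theorem ArcSmooth.fourier_dirDeriv_succ {F : V → ℝ} (hF : ArcSmooth F) (hc : HasCompactSupport F)
    (k : ℕ) (v ξ : V) :
    𝓕 (fun x => (dirDeriv (k + 1) F x v : ℂ)) ξ =
      (2 * Real.pi * Complex.I * ⟪v, ξ⟫) * 𝓕 (fun x => (dirDeriv k F x v : ℂ)) ξ := by
  have he : ∀ x, HasLineDerivAt ℝ (fun x : V => (𝐞 (-⟪x, ξ⟫) : ℂ))
      (-(2 * Real.pi * Complex.I * ⟪v, ξ⟫) * (𝐞 (-⟪x, ξ⟫) : ℂ)) x v := by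
    intro x
    have h1 : HasDerivAt (fun t : ℝ => -⟪x + t • v, ξ⟫) (-⟪v, ξ⟫) 0 := by
      have : (fun t : ℝ => -⟪x + t • v, ξ⟫) = fun t : ℝ => -⟪x, ξ⟫ + t * (-⟪v, ξ⟫) := by
        ext t; rw [inner_add_left, real_inner_smul_left]; ring
      rw [this]
      simpa using ((hasDerivAt_id (0 : ℝ)).mul_const (-⟪v, ξ⟫)).const_add (-⟪x, ξ⟫)
    have h2 := (Real.hasDerivAt_fourierChar (-⟪x + (0 : ℝ) • v, ξ⟫)).scomp 0 h1
    unfold HasLineDerivAt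
    convert! h2 using 1
    simp
    ring
  have hg : ∀ j, ∀ x, HasLineDerivAt ℝ (fun x => (dirDeriv j F x v : ℂ))
      (dirDeriv (j + 1) F x v : ℂ) x v := by
    intro j x
    have h := (hF.hasDerivAt_dirDeriv j x v 0).ofReal_comp
    simpa [HasLineDerivAt] using h
  have hint : ∀ j, Integrable fun x => (𝐞 (-⟪x, ξ⟫) : ℂ) * (dirDeriv j F x v : ℂ) := by
    intro j
    have h := (Real.fourierIntegral_convergent_iff (f := fun x => (dirDeriv j F x v : ℂ)) ξ).2
      (hF.integrable_dirDeriv hc j v)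
    simpa [Circle.smul_def] using h
  have key := integral_bilinear_hasLineDerivAt_right_eq_neg_left_of_integrable
    (μ := (volume : Measure V)) (B := ContinuousLinearMap.mul ℝ ℂ)
    (f := fun x : V => (𝐞 (-⟪x, ξ⟫) : ℂ))
    (f' := fun x : V => -(2 * Real.pi * Complex.I * ⟪v, ξ⟫) * (𝐞 (-⟪x, ξ⟫) : ℂ))
    (g := fun x => (dirDeriv k F x v : ℂ)) (g' := fun x => (dirDeriv (k + 1) F x v : ℂ)) (v := v)
    (by simpa [mul_assoc] using ((hint k).const_mul (-(2 * Real.pi * Complex.I * ⟪v, ξ⟫))))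
    (by simpa using hint (k + 1)) (by simpa using hint k) (fun x _ => he x) (fun x _ => hg k x)
  simp only [ContinuousLinearMap.mul_apply'] at key
  rw [Real.fourier_eq, Real.fourier_eq]
  simp only [Circle.smul_def, smul_eq_mul]
  rw [key, ← integral_neg, ← integral_const_mul]
  congr 1
  ext x
  ring

/-- The Fourier transform decays faster than every power, so it has integrable moments of every
order and Fourier inversion exhibits `F` as a smooth function. -/
theorem ArcSmooth.contDiff_of_hasCompactSupport {F : V → ℝ} (hF : ArcSmooth F)
    (hc : HasCompactSupport F) : ContDiff ℝ ∞ F := by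
  set f : V → ℂ := fun x => (F x : ℂ) with hf
  have hfd : ∀ v, f = fun x => (dirDeriv 0 F x v : ℂ) := fun v => by ext; simp [hf, dirDeriv]
  have hcont : Continuous f := Complex.continuous_ofReal.comp hF.continuous
  have hint : Integrable f := by rw [hfd 0]; exact hF.integrable_dirDeriv hc 0 0
  have hdecay : ∀ k : ℕ, ∃ C, ∀ ξ, ‖ξ‖ ^ k * ‖𝓕 f ξ‖ ≤ C := by
    intro k
    obtain ⟨C, hC⟩ := hF.exists_dirDeriv_bound_of_compact hc k
    have hC0 : 0 ≤ C := (abs_nonneg _).trans (hC 0 0 (by simp))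
    -- The indicator term dominates the `k`-th directional derivatives for `ξ ≠ 0`; the term `‖f x‖`
    -- takes care of `ξ = 0`.
    refine ⟨∫ x, Set.indicator (tsupport F) (fun _ => C) x + ‖f x‖, fun ξ => ?_⟩
    have hind : Integrable (Set.indicator (tsupport F) fun _ : V => C) :=
      (integrable_indicator_iff (isClosed_tsupport F).measurableSet).2
        (integrableOn_const hc.measure_lt_top.ne)
    have hpos : ∀ x, 0 ≤ Set.indicator (tsupport F) (fun _ : V => C) x := fun x =>
      Set.indicator_nonneg (fun _ _ => hC0) x
    rcases eq_or_ne ξ 0 with rfl | hξ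
    · calc ‖(0 : V)‖ ^ k * ‖𝓕 f 0‖ ≤ 1 * ‖𝓕 f 0‖ := by
            gcongr
            rcases Nat.eq_zero_or_pos k with rfl | hk
            · simp
            · simp [hk.ne']
        _ ≤ ∫ x, ‖f x‖ := by
            rw [one_mul, Real.fourier_eq]
            refine (norm_integral_le_integral_norm _).trans_eq ?_
            simp
        _ ≤ _ := integral_mono hint.norm (hind.add hint.norm) fun x => by
            simpa using hpos x
    -- Differentiating in the direction of the frequency itself makes every integration by parts
    -- gain the full factor `‖ξ‖`; the bounds are uniform over unit directions.
    set v := ‖ξ‖⁻¹ • ξ with hv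
    have hv1 : ‖v‖ ≤ 1 := by rw [hv, norm_smul, norm_inv, norm_norm]; exact inv_mul_le_one
    have hvξ : ⟪v, ξ⟫ = ‖ξ‖ := by
      rw [hv, real_inner_smul_left, real_inner_self_eq_norm_sq, sq, ← mul_assoc,
        inv_mul_cancel₀ (norm_ne_zero_iff.2 hξ), one_mul]
    have hiter : ∀ j : ℕ, 𝓕 (fun x => (dirDeriv j F x v : ℂ)) ξ =
        (2 * Real.pi * Complex.I * ‖ξ‖) ^ j * 𝓕 f ξ := by
      intro j
      induction j with
      | zero => rw [pow_zero, one_mul, ← hfd]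
      | succ j ih => rw [hF.fourier_dirDeriv_succ hc, ih, hvξ]; ring
    have h1 : ‖ξ‖ ^ k * ‖𝓕 f ξ‖ ≤ ‖𝓕 (fun x => (dirDeriv k F x v : ℂ)) ξ‖ := by
      rw [hiter, norm_mul, norm_pow]
      gcongr
      simp only [norm_mul, Complex.norm_ofNat, Complex.norm_real, Complex.norm_I, mul_one,
        Real.norm_eq_abs, abs_of_pos Real.pi_pos, abs_norm]
      have : 1 ≤ 2 * Real.pi := by linarith [Real.pi_gt_three]
      exact le_mul_of_one_le_left (norm_nonneg _) this
    refine h1.trans ?_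
    rw [Real.fourier_eq]
    refine (norm_integral_le_integral_norm _).trans ?_
    simp only [Circle.norm_smul]
    refine integral_mono (hF.integrable_dirDeriv hc k v).norm (hind.add hint.norm) fun x => ?_
    simp only [Complex.norm_real, Real.norm_eq_abs]
    by_cases hx : x ∈ tsupport F
    · rw [Set.indicator_of_mem hx]
      linarith [hC x v hv1, norm_nonneg (f x)]
    · rw [dirDeriv_eq_zero_of_notMem_tsupport k hx, abs_zero]
      linarith [hpos x, norm_nonneg (f x)]
  have hmom : ∀ k : ℕ, Integrable fun ξ => ‖ξ‖ ^ k * ‖𝓕 f ξ‖ := by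
    intro k
    obtain ⟨C₁, h1⟩ := hdecay 0
    obtain ⟨C₂, h2⟩ := hdecay (k + (volume : Measure V).integrablePower)
    refine integrable_of_le_of_pow_mul_le (C₁ := C₁) (C₂ := C₂) (fun x => by simpa using h1 x) h2 ?_
    exact (VectorFourier.fourierIntegral_continuous Real.continuous_fourierChar
      (by exact continuous_inner) hint).aestronglyMeasurable
  have hFf : Integrable (𝓕 f) := by
    refine (integrable_norm_iff ?_).1 (by simpa using hmom 0)
    exact (VectorFourier.fourierIntegral_continuous Real.continuous_fourierChar
      (by exact continuous_inner) hint).aestronglyMeasurable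
  have hinv := hcont.fourierInv_fourier_eq hint hFf
  have hsm : ContDiff ℝ ∞ (𝓕 (𝓕 f)) := Real.contDiff_fourier fun n _ => hmom n
  have hfs : ContDiff ℝ ∞ f := by
    rw [← hinv]
    have : 𝓕⁻ (𝓕 f) = fun w => 𝓕 (𝓕 f) (-w) := by
      ext w; exact Real.fourierInv_eq_fourier_neg _ _
    rw [this]
    exact hsm.comp contDiff_neg
  have : F = fun x => Complex.reCLM (f x) := by ext; simp [hf]
  rw [this]
  exact Complex.reCLM.contDiff.comp hfs

/-- **Boman's theorem**: a function that is smooth along smooth curves is smooth. -/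
theorem ArcSmooth.contDiff {V : Type*} [NormedAddCommGroup V] [InnerProductSpace ℝ V]
    [FiniteDimensional ℝ V] {F : V → ℝ} (hF : ArcSmooth F) : ContDiff ℝ ∞ F := by
  borelize V
  rw [contDiff_iff_contDiffAt]
  intro p
  let χ : ContDiffBump p := ⟨1, 2, one_pos, one_lt_two⟩
  have hs : ArcSmooth fun x => χ x * F x := fun c hc =>
    ((χ.contDiff (n := ⊤)).comp hc).mul (hF c hc)
  have h := hs.contDiff_of_hasCompactSupport χ.hasCompactSupport.mul_right
  refine h.contDiffAt.congr_of_eventuallyEq ?_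
  filter_upwards [χ.eventuallyEq_one] with x hx
  rw [hx]; simp

/-- Boman's theorem in the plane. -/
theorem contDiff_of_comp_curves {F : ℝ × ℝ → ℝ}
    (hF : ∀ a b : ℝ → ℝ, ContDiff ℝ ∞ a → ContDiff ℝ ∞ b → ContDiff ℝ ∞ fun τ => F (a τ, b τ)) :
    ContDiff ℝ ∞ F := by
  -- The sup norm of the product is not an inner product norm, so the Fourier argument is applied on
  -- the Euclidean plane and transported.
  let e : WithLp 2 (ℝ × ℝ) ≃L[ℝ] ℝ × ℝ := WithLp.prodContinuousLinearEquiv 2 ℝ ℝ ℝ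
  have h : ArcSmooth (F ∘ e) := fun c hc => by
    have hc' : ContDiff ℝ ∞ (e ∘ c) := e.contDiff.comp hc
    exact hF _ _ (contDiff_fst.comp hc') (contDiff_snd.comp hc')
  have h2 : F = (F ∘ e) ∘ e.symm := by ext x; simp
  rw [h2]
  exact h.contDiff.comp e.symm.contDiff

end BomanFourier

/-! ## Laurent coefficients of analytic functions on the circle -/

theorem OS1.add_apply (f g : OS1) (z : Circle) : (f + g) z = f z + g z := rfl

theorem OS1.smul_apply (a : ℂ) (f : OS1) (z : Circle) : (a • f) z = a * f z := rfl

theorem OS1.real_smul_apply (r : ℝ) (f : OS1) (z : Circle) : (r • f) z = r * f z :=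
  Complex.real_smul

theorem OS1.continuous (f : OS1) : Continuous (f : Circle → ℂ) := by
  obtain ⟨n, F, hF⟩ := f.2
  have h : (f : Circle → ℂ) = F ∘ ((↑) : Circle → ℂ) := funext fun z => (hF.2 z).symm
  rw [h]
  exact hF.1.continuousOn.comp_continuous continuous_subtype_val fun z => coe_mem_annulus n z

instance factTwoPi : Fact (0 < 2 * Real.pi) := ⟨Real.two_pi_pos⟩

/-- The `k`-th Laurent coefficient. -/
def coef (k : ℤ) : OS1 →ₗ[ℂ] ℂ where
  toFun f := fourierCoeff (T := 2 * Real.pi) (fun x => f x.toCircle) k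
  map_add' f g := by
    have h : ∀ f : OS1, MeasureTheory.Integrable
        (fun x : AddCircle (2 * Real.pi) => f x.toCircle) AddCircle.haarAddCircle := fun f =>
      (f.continuous.comp AddCircle.continuous_toCircle).integrable_of_hasCompactSupport
        (HasCompactSupport.of_compactSpace _)
    exact congrFun (fourierCoeff.add (h f) (h g)) k
  map_smul' a f := fourierCoeff.const_smul (fun x => f x.toCircle) a k

theorem toCircle_two_pi (x : ℝ) : AddCircle.toCircle (T := 2 * Real.pi) (x : AddCircle _) =
    Circle.exp x := by
  rw [AddCircle.toCircle_apply_mk, div_self Real.two_pi_pos.ne', one_mul]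

/-- As a Cauchy integral the Fourier coefficient can be moved to any other circle in the annulus of
holomorphy. -/
theorem coef_eq_circleIntegral (k : ℤ) (f : OS1) {F : ℂ → ℂ} (hF : ∀ z : Circle, F z = f z) :
    coef k f = (2 * Real.pi * Complex.I)⁻¹ • ∮ z in C(0, 1), z ^ (-k - 1) * F z := by
  change fourierCoeff (T := 2 * Real.pi) (fun x => f x.toCircle) k = _
  rw [fourierCoeff_eq_intervalIntegral _ _ 0, zero_add, circleIntegral]
  have h : ∀ x : ℝ, deriv (circleMap 0 1) x • (circleMap 0 1 x ^ (-k - 1) * F (circleMap 0 1 x)) =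
      Complex.I * ((fourier (-k)) (x : AddCircle (2 * Real.pi)) •
        f (AddCircle.toCircle (T := 2 * Real.pi) (x : AddCircle _))) := by
    intro x
    have e : circleMap 0 1 x = (Circle.exp x : ℂ) := by simp [circleMap, Circle.coe_exp]
    have hz : (Circle.exp x : ℂ) ≠ 0 := Circle.coe_ne_zero _
    rw [deriv_circleMap, toCircle_two_pi, fourier_coe_apply, ← hF, e, zpow_sub_one₀ hz,
      smul_eq_mul, smul_eq_mul]
    have e2 : Complex.exp (2 * Real.pi * Complex.I * ((-k : ℤ) : ℂ) * x / ((2 * Real.pi : ℝ) : ℂ)) =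
        (Circle.exp x : ℂ) ^ (-k) := by
      rw [Circle.coe_exp, ← Complex.exp_int_mul]
      congr 1
      have : (Real.pi : ℂ) ≠ 0 := Complex.ofReal_ne_zero.2 Real.pi_ne_zero
      push_cast
      field_simp
    rw [e2]
    field_simp
  simp_rw [h]
  rw [intervalIntegral.integral_const_mul, smul_eq_mul, Complex.real_smul]
  have : (Real.pi : ℂ) ≠ 0 := Complex.ofReal_ne_zero.2 Real.pi_ne_zero
  push_cast
  field_simp

theorem circleIntegral_eq_of_annulus {n : ℕ} {G : ℂ → ℂ} (hG : DifferentiableOn ℂ G (annulus n))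
    {r R : ℝ} (h0 : 0 < r) (hr : 1 - 1 / ((n : ℝ) + 1) < r) (hrR : r ≤ R)
    (hR : R < 1 + 1 / ((n : ℝ) + 1)) : ∮ z in C(0, R), G z = ∮ z in C(0, r), G z := by
  have hsub : Metric.closedBall (0 : ℂ) R \ Metric.ball 0 r ⊆ annulus n := by
    rintro z ⟨h1, h2⟩
    simp only [Metric.mem_closedBall, Metric.mem_ball, dist_zero_right, not_lt] at h1 h2
    exact ⟨hr.trans_le h2, h1.trans_lt hR⟩
  refine Complex.circleIntegral_eq_of_differentiable_on_annulus_off_countable h0 hrR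
    Set.countable_empty (hG.continuousOn.mono hsub) fun z hz => ?_
  refine hG.differentiableAt ((isOpen_annulus n).mem_nhds (hsub ⟨?_, ?_⟩))
  · exact Metric.ball_subset_closedBall hz.1.1
  · exact fun h => hz.1.2 (Metric.ball_subset_closedBall h)

theorem norm_coef_le_of_extension {n : ℕ} {F : ℂ → ℂ} {f : OS1} (hF : IsExtension n F f) (k : ℤ)
    {ρ B : ℝ} (h0 : 0 < ρ) (h1 : 1 - 1 / ((n : ℝ) + 1) < ρ) (h2 : ρ < 1 + 1 / ((n : ℝ) + 1))
    (hB : ∀ z : ℂ, ‖z‖ = ρ → ‖F z‖ ≤ B) : ‖coef k f‖ ≤ ρ ^ (-k) * B := by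
  have hn : (0 : ℝ) < 1 / ((n : ℝ) + 1) := by positivity
  have hn1 : 1 / ((n : ℝ) + 1) ≤ 1 := by
    rw [div_le_one (by positivity)]; linarith [Nat.cast_nonneg (α := ℝ) n]
  have hG : DifferentiableOn ℂ (fun z : ℂ => z ^ (-k - 1) * F z) (annulus n) := by
    refine DifferentiableOn.mul (fun z hz => ?_) hF.1
    have hz0 : z ≠ 0 := by
      rintro rfl
      have := hz.1
      simp only [norm_zero] at this
      linarith
    exact (differentiableAt_zpow.2 (Or.inl hz0)).differentiableWithinAt
  have e : ∮ z in C(0, 1), z ^ (-k - 1) * F z = ∮ z in C(0, ρ), z ^ (-k - 1) * F z := by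
    rcases le_total ρ 1 with h | h
    · exact circleIntegral_eq_of_annulus hG h0 h1 h (by linarith)
    · exact (circleIntegral_eq_of_annulus hG one_pos (by linarith) h h2).symm
  rw [coef_eq_circleIntegral k f hF.2, e]
  refine (circleIntegral.norm_two_pi_i_inv_smul_integral_le_of_norm_le_const h0.le
    (C := ρ ^ (-k - 1) * B) fun z hz => ?_).trans_eq ?_
  · have hz' : ‖z‖ = ρ := by simpa using hz
    rw [norm_mul, norm_zpow, hz']
    gcongr
    exact hB z hz'
  · rw [zpow_sub_one₀ h0.ne']
    field_simp

/-- A radius between `1` and the outer radius of `annulus n`. -/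
def midRadius (n : ℕ) : ℝ := 1 + 1 / (2 * ((n : ℝ) + 1))

theorem one_lt_midRadius (n : ℕ) : 1 < midRadius n := by
  have : (0 : ℝ) < 1 / (2 * ((n : ℝ) + 1)) := by positivity
  unfold midRadius; linarith

theorem midRadius_lt (n : ℕ) : midRadius n < 1 + 1 / ((n : ℝ) + 1) := by
  unfold midRadius
  gcongr
  linarith [Nat.cast_nonneg (α := ℝ) n]

theorem lt_inv_midRadius (n : ℕ) : 1 - 1 / ((n : ℝ) + 1) < (midRadius n)⁻¹ := by
  have h0 : (0 : ℝ) < 1 / ((n : ℝ) + 1) := by positivity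
  have hm := one_lt_midRadius n
  have h1 : 1 - (midRadius n)⁻¹ ≤ midRadius n - 1 := by
    rw [← sub_nonneg]
    have : midRadius n - 1 - (1 - (midRadius n)⁻¹) = (midRadius n - 1) ^ 2 * (midRadius n)⁻¹ := by
      field_simp
    rw [this]; positivity
  linarith [midRadius_lt n]

/-- The two circles of radius `midRadius n` and `(midRadius n)⁻¹`. -/
def midCircles (n : ℕ) : Set ℂ := {z | ‖z‖ = midRadius n ∨ ‖z‖ = (midRadius n)⁻¹}

theorem isCompact_midCircles (n : ℕ) : IsCompact (midCircles n) := by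
  have h : midCircles n = Metric.sphere 0 (midRadius n) ∪ Metric.sphere 0 (midRadius n)⁻¹ := by
    ext z; simp [midCircles]
  rw [h]
  exact (isCompact_sphere _ _).union (isCompact_sphere _ _)

theorem midCircles_subset (n : ℕ) : midCircles n ⊆ annulus n := by
  have h1 := one_lt_midRadius n
  have h2 := midRadius_lt n
  have h3 := lt_inv_midRadius n
  have h4 : (midRadius n)⁻¹ < 1 := inv_lt_one_of_one_lt₀ h1
  have h5 : (0 : ℝ) < 1 / ((n : ℝ) + 1) := by positivity
  rintro z (hz | hz) <;> constructor <;> rw [hz] <;> linarith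

/-- For `k ≥ 0` the contour is moved to the outer circle, for `k ≤ 0` to the inner one; the radii
are mutually inverse, so both give the same exponential rate. -/
theorem norm_coef_le {n : ℕ} {F : ℂ → ℂ} {f : OS1} (hF : IsExtension n F f) (k : ℤ)
    {B : ℝ} (hB : ∀ z ∈ midCircles n, ‖F z‖ ≤ B) :
    ‖coef k f‖ ≤ B * (midRadius n)⁻¹ ^ k.natAbs := by
  have h1 := one_lt_midRadius n
  have h4 : (midRadius n)⁻¹ < 1 := inv_lt_one_of_one_lt₀ h1
  have h5 : (0 : ℝ) < 1 / ((n : ℝ) + 1) := by positivity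
  rcases Int.natAbs_eq k with hk | hk
  · have := norm_coef_le_of_extension hF k (ρ := midRadius n) (by linarith) (by linarith)
      (midRadius_lt n) fun z hz => hB z (Or.inl hz)
    refine this.trans_eq ?_
    conv_lhs => rw [hk]
    rw [mul_comm, zpow_neg, zpow_natCast, inv_pow]
  · have := norm_coef_le_of_extension hF k (ρ := (midRadius n)⁻¹) (by positivity)
      (lt_inv_midRadius n) (by linarith) fun z hz => hB z (Or.inr hz)
    refine this.trans_eq ?_
    conv_lhs => rw [hk]
    rw [mul_comm, neg_neg, zpow_natCast]

theorem summable_pow_natAbs {r : ℝ} (h0 : 0 ≤ r) (h1 : r < 1) :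
    Summable fun k : ℤ => r ^ k.natAbs := by
  refine Summable.of_nat_of_neg ?_ ?_ <;>
    simpa using summable_geometric_of_lt_one h0 h1

theorem exists_coef_bound (f : OS1) : ∃ r, 0 < r ∧ r < 1 ∧ ∃ C, 0 ≤ C ∧
    ∀ k, ‖coef k f‖ ≤ C * r ^ k.natAbs := by
  obtain ⟨n, F, hF⟩ := f.2
  obtain ⟨B, hB⟩ := (isCompact_midCircles n).exists_bound_of_continuousOn
    (hF.1.continuousOn.mono (midCircles_subset n))
  have h1 := one_lt_midRadius n
  refine ⟨(midRadius n)⁻¹, by positivity, inv_lt_one_of_one_lt₀ h1, max B 0, le_max_right _ _,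
    fun k => (norm_coef_le hF k hB).trans ?_⟩
  gcongr
  exact le_max_left _ _

/-- Exponential decay makes the Fourier coefficients summable, so the Fourier series converges
pointwise to the function. -/
theorem hasSum_coef (f : OS1) (z : Circle) : HasSum (fun k : ℤ => coef k f * (z : ℂ) ^ k) (f z) := by
  obtain ⟨r, hr0, hr1, C, hC0, hC⟩ := exists_coef_bound f
  let g : C(AddCircle (2 * Real.pi), ℂ) :=
    ⟨fun x => f x.toCircle, f.continuous.comp AddCircle.continuous_toCircle⟩
  have hs : Summable (fourierCoeff g) :=
    Summable.of_norm_bounded ((summable_pow_natAbs hr0.le hr1).mul_left C) hC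
  obtain ⟨θ, hθ⟩ : ∃ θ : ℝ, Circle.exp θ = z := ⟨_, Circle.exp_arg z⟩
  have h := has_pointwise_sum_fourier_series_of_summable hs (θ : AddCircle (2 * Real.pi))
  have e : g (θ : AddCircle (2 * Real.pi)) = f z := by
    change f (AddCircle.toCircle (θ : AddCircle (2 * Real.pi))) = _
    rw [toCircle_two_pi, hθ]
  rw [e] at h
  have e2 : (fun k : ℤ => coef k f * (z : ℂ) ^ k) = fun k =>
      fourierCoeff g k • fourier k (θ : AddCircle (2 * Real.pi)) := by
    ext k
    rw [fourier_apply, AddCircle.toCircle_zsmul, toCircle_two_pi, hθ]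
    rfl
  rwa [e2]

/-! ## Continuous functionals on the space of analytic functions -/

/-- Linear functionals on `𝒪(S¹)` that are continuous on all `𝒪(U_n)`. -/
def IsDual (ℓ : OS1 →ₗ[ℂ] ℂ) : Prop := ∀ n, Continuous fun f : Hol n => ℓ (restrict n f)

/-- The limit topology is the infimum of all admissible topologies, and the topology pulled back
along `ℓ` is admissible. -/
theorem IsDual.continuous {ℓ : OS1 →ₗ[ℂ] ℂ} (h : IsDual ℓ) : Continuous ℓ := by
  let τ : TopologicalSpace OS1 := TopologicalSpace.induced ℓ inferInstance
  refine continuous_sInf_dom (t := τ) ⟨topologicalAddGroup_induced ℓ, continuousSMul_induced ℓ,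
    ?_, fun n => continuous_induced_rng.2 (h n)⟩ continuous_induced_dom
  exact LocallyConvexSpace.induced (𝕜 := ℝ) (ℓ.restrictScalars ℝ)

theorem continuous_restrict (n : ℕ) : Continuous (restrict n) :=
  continuous_sInf_rng.2 fun _ h => h.2.2.2 n

/-- A linear functional bounded by the supremum over a compact set is continuous. -/
theorem isDual_of_bound {ℓ : OS1 →ₗ[ℂ] ℂ}
    (h : ∀ n : ℕ, ∃ K : Set ℂ, IsCompact K ∧ K ⊆ annulus n ∧ ∃ C : ℝ, ∀ (F : ℂ → ℂ) (f : OS1),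
      IsExtension n F f → ∀ B, (∀ z ∈ K, ‖F z‖ ≤ B) → ‖ℓ f‖ ≤ C * B) : IsDual ℓ := by
  intro n
  obtain ⟨K, hK, hKn, C, hC⟩ := h n
  have h0 : ContinuousAt (ℓ.comp (restrict n)) 0 := by
    rw [ContinuousAt, map_zero, Metric.tendsto_nhds]
    intro ε hε
    set δ := ε / (|C| + 1) with hδ
    have hδ0 : 0 < δ := by positivity
    have hK' : IsCompact ((↑) ⁻¹' K : Set (annulus n)) := by
      rw [Subtype.isCompact_iff, Subtype.image_preimage_coe, Set.inter_eq_right.2 hKn]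
      exact hK
    have ho : IsOpen {f : C(annulus n, ℂ) | Set.MapsTo f ((↑) ⁻¹' K) (Metric.ball 0 δ)} :=
      ContinuousMap.isOpen_setOfPred_mapsTo hK' Metric.isOpen_ball
    have hm : ∀ᶠ f : Hol n in 𝓝 0, Set.MapsTo f.1 ((↑) ⁻¹' K) (Metric.ball 0 δ) :=
      continuous_subtype_val.continuousAt.eventually
        (ho.mem_nhds fun z _ => by simpa using hδ0)
    filter_upwards [hm] with f hf
    obtain ⟨F, hF, hFf⟩ := f.2
    have := hC F (restrict n f) ⟨hF, fun z => hFf ⟨z, coe_mem_annulus n z⟩⟩ δ fun z hz => by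
      have h1 := hf (x := ⟨z, hKn hz⟩) hz
      rw [hFf ⟨z, hKn hz⟩]
      exact (by simpa using h1 : ‖_‖ < δ).le
    rw [dist_zero_right]
    calc ‖ℓ (restrict n f)‖ ≤ C * δ := this
      _ ≤ |C| * δ := by gcongr; exact le_abs_self C
      _ < (|C| + 1) * δ := by gcongr; linarith
      _ = ε := by rw [hδ]; field_simp
  exact continuous_of_continuousAt_zero (ℓ.comp (restrict n)) h0

/-- Evaluation at a point of the circle. -/
def evalAt (z : Circle) : OS1 →ₗ[ℂ] ℂ where
  toFun f := f z
  map_add' _ _ := rfl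
  map_smul' _ _ := rfl

theorem isDual_evalAt (z : Circle) : IsDual (evalAt z) :=
  isDual_of_bound fun n => ⟨{(z : ℂ)}, isCompact_singleton,
    by simpa using coe_mem_annulus n z, 1, fun F f hF B hB => by
      rw [one_mul]
      change ‖f z‖ ≤ B
      rw [← hF.2]
      exact hB z rfl⟩

/-- Sequences of subexponential growth. -/
def Subexponential (w : ℤ → ℂ) : Prop :=
  ∀ R : ℝ, 1 < R → ∃ C, ∀ k, ‖w k‖ ≤ C * R ^ k.natAbs

theorem Subexponential.summable_of_lt {w : ℤ → ℂ} (hw : Subexponential w) {r : ℝ} (h0 : 0 < r)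
    (h1 : r < 1) : Summable fun k : ℤ => ‖w k‖ * r ^ k.natAbs := by
  -- The growth rate `R = (1 + r⁻¹)/2` lies strictly between `1` and `r⁻¹`, so that `R r = (1 + r)/2
  -- < 1` is a summable rate.
  obtain ⟨C, hC⟩ := hw ((1 + r⁻¹) / 2) (by
    have := (one_lt_inv₀ h0).2 h1
    linarith)
  have hr : (1 + r⁻¹) / 2 * r = (r + 1) / 2 := by field_simp
  refine Summable.of_nonneg_of_le (fun k => by positivity) (fun k => ?_)
    ((summable_pow_natAbs (r := (r + 1) / 2) (by positivity) (by linarith)).mul_left C)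
  calc ‖w k‖ * r ^ k.natAbs ≤ C * ((1 + r⁻¹) / 2) ^ k.natAbs * r ^ k.natAbs := by
        gcongr; exact hC k
    _ = _ := by rw [mul_assoc, ← mul_pow, hr]

theorem Subexponential.summable {w : ℤ → ℂ} (hw : Subexponential w) (f : OS1) :
    Summable fun k : ℤ => ‖w k‖ * ‖coef k f‖ := by
  obtain ⟨r, h0, h1, C, -, hC⟩ := exists_coef_bound f
  refine Summable.of_nonneg_of_le (fun k => by positivity) (fun k => ?_)
    ((hw.summable_of_lt h0 h1).mul_left C)
  calc ‖w k‖ * ‖coef k f‖ ≤ ‖w k‖ * (C * r ^ k.natAbs) := by gcongr; exact hC k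
    _ = _ := by ring

theorem Subexponential.summable' {w : ℤ → ℂ} (hw : Subexponential w) (f : OS1) :
    Summable fun k : ℤ => w k * coef k f :=
  Summable.of_norm (by simpa using hw.summable f)

theorem Subexponential.mul_bounded {w : ℤ → ℂ} (hw : Subexponential w)
    (β : BoundedContinuousFunction ℤ ℂ) : Subexponential fun k => w k * β k := by
  intro R hR
  obtain ⟨C, hC⟩ := hw R hR
  refine ⟨C * ‖β‖, fun k => ?_⟩
  have h0 : 0 ≤ C * R ^ k.natAbs := (norm_nonneg _).trans (hC k)
  calc ‖w k * β k‖ = ‖w k‖ * ‖β k‖ := norm_mul _ _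
    _ ≤ (C * R ^ k.natAbs) * ‖β‖ := by gcongr; exacts [hC k, β.norm_coe_le_norm k]
    _ = _ := by ring

/-- The functional `f ↦ ∑ w_k a_k(f)`. -/
def pairing {w : ℤ → ℂ} (hw : Subexponential w) : OS1 →ₗ[ℂ] ℂ where
  toFun f := ∑' k : ℤ, w k * coef k f
  map_add' f g := by
    rw [← (hw.summable' f).tsum_add (hw.summable' g)]
    simp [mul_add]
  map_smul' a f := by
    rw [RingHom.id_apply, smul_eq_mul, ← tsum_mul_left]
    simp [mul_left_comm]

theorem isDual_pairing {w : ℤ → ℂ} (hw : Subexponential w) : IsDual (pairing hw) :=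
  isDual_of_bound fun n => ⟨midCircles n, isCompact_midCircles n, midCircles_subset n,
    ∑' k : ℤ, ‖w k‖ * (midRadius n)⁻¹ ^ k.natAbs, fun F f hF B hB => by
      have h1 := one_lt_midRadius n
      rw [← tsum_mul_right]
      have hs := (hw.summable_of_lt (r := (midRadius n)⁻¹) (by positivity)
        (inv_lt_one_of_one_lt₀ h1)).mul_right B
      refine (norm_tsum_le_tsum_norm (by simpa using hw.summable f)).trans ?_
      refine Summable.tsum_le_tsum (fun k => ?_) (by simpa using hw.summable f) hs
      rw [norm_mul]
      calc ‖w k‖ * ‖coef k f‖ ≤ ‖w k‖ * (B * (midRadius n)⁻¹ ^ k.natAbs) := by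
            gcongr; exact norm_coef_le hF k hB
        _ = _ := by ring⟩

theorem subexponential_single (k : ℤ) : Subexponential (Pi.single k 1) := by
  intro R hR
  refine ⟨1, fun j => ?_⟩
  rw [one_mul]
  refine le_trans ?_ (one_le_pow₀ hR.le)
  rcases eq_or_ne j k with rfl | h
  · simp
  · simp [h]

theorem pairing_single (k : ℤ) (f : OS1) : pairing (subexponential_single k) f = coef k f := by
  change ∑' j : ℤ, (Pi.single k 1 : ℤ → ℂ) j * coef j f = _
  rw [tsum_eq_single k fun j hj => by simp [hj]]
  simp

theorem isDual_coef (k : ℤ) : IsDual (coef k) := by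
  have : coef k = pairing (subexponential_single k) :=
    LinearMap.ext fun f => (pairing_single k f).symm
  rw [this]
  exact isDual_pairing _

/-- Curves in `𝒪(S¹)` that are smooth when tested with continuous linear functionals. -/
def ScalarSmooth (c : ℝ → OS1) : Prop := ∀ ℓ, IsDual ℓ → ContDiff ℝ ∞ fun t => ℓ (c t)

theorem contDiff_of_hasDerivAt_seq {E : Type*} [NormedAddCommGroup E] [NormedSpace ℝ E]
    {φ : ℕ → ℝ → E} (h : ∀ n t, HasDerivAt (φ n) (φ (n + 1) t) t) : ContDiff ℝ ∞ (φ 0) := by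
  have key : ∀ m : ℕ, ∀ n, ContDiff ℝ m (φ n) := by
    intro m
    induction m with
    | zero =>
      intro n
      rw [Nat.cast_zero, contDiff_zero]
      exact continuous_iff_continuousAt.2 fun t => (h n t).continuousAt
    | succ m ih =>
      intro n
      rw [Nat.cast_succ, contDiff_succ_iff_deriv]
      refine ⟨fun t => (h n t).differentiableAt, fun h' => by simp at h', ?_⟩
      rw [funext fun t => (h n t).deriv]
      exact ih (n + 1)
  exact contDiff_infty.2 fun m => key m 0

theorem IsSmoothCurve.scalarSmooth {c : ℝ → OS1} (hc : IsSmoothCurve c) : ScalarSmooth c := by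
  intro ℓ hℓ
  obtain ⟨d, hd0, hd⟩ := hc
  rw [← hd0]
  refine contDiff_of_hasDerivAt_seq (φ := fun n t => ℓ (d n t)) fun n t => ?_
  rw [hasDerivAt_iff_tendsto_slope_zero]
  have h := (hℓ.continuous.tendsto _).comp (hd n t)
  refine h.congr fun r => ?_
  simp only [Function.comp]
  have : (r⁻¹ • (d n (t + r) - d n t) : OS1) = ((r⁻¹ : ℝ) : ℂ) • (d n (t + r) - d n t) :=
    OS1.ext fun z => by rw [OS1.real_smul_apply, OS1.smul_apply]
  rw [this, map_smul, map_sub]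
  exact (Complex.real_smul).symm

theorem re_mem_functions {ℓ : OS1 →ₗ[ℂ] ℂ} (hℓ : IsDual ℓ) :
    (fun f => (ℓ f).re) ∈ Functions OS1 := fun _ hc =>
  Complex.reCLM.contDiff.comp (IsSmoothCurve.scalarSmooth hc ℓ hℓ)

theorem im_mem_functions {ℓ : OS1 →ₗ[ℂ] ℂ} (hℓ : IsDual ℓ) :
    (fun f => (ℓ f).im) ∈ Functions OS1 := fun _ hc =>
  Complex.imCLM.contDiff.comp (IsSmoothCurve.scalarSmooth hc ℓ hℓ)

theorem contDiff_of_re_im {φ : ℝ → ℂ} (h1 : ContDiff ℝ ∞ fun t => (φ t).re)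
    (h2 : ContDiff ℝ ∞ fun t => (φ t).im) : ContDiff ℝ ∞ φ := by
  have : φ = fun t => ((φ t).re : ℂ) + (φ t).im * Complex.I := funext fun t =>
    (Complex.re_add_im _).symm
  rw [this]
  exact (Complex.ofRealCLM.contDiff.comp h1).add
    ((Complex.ofRealCLM.contDiff.comp h2).mul contDiff_const)

theorem scalarSmooth_of_mem_curves {c : ℝ → OS1} (hc : c ∈ Curves OS1) : ScalarSmooth c :=
  fun _ hℓ => contDiff_of_re_im (hc _ (re_mem_functions hℓ)) (hc _ (im_mem_functions hℓ))

/-! ## Uniform bounds for coefficients of smooth curves -/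

/-- The functional `β ↦ ∑ w_k β_k a_k(f)` on bounded sequences. -/
def boundedPairing {w : ℤ → ℂ} (hw : Subexponential w) (f : OS1) :
    BoundedContinuousFunction ℤ ℂ →L[ℂ] ℂ :=
  LinearMap.mkContinuous
    { toFun := fun β => pairing (hw.mul_bounded β) f
      map_add' := fun β β' => by
        change ∑' k : ℤ, (w k * (β k + β' k)) * coef k f = _
        rw [tsum_congr (g := fun k => w k * β k * coef k f + w k * β' k * coef k f)
          fun k => by ring]
        exact ((hw.mul_bounded β).summable' f).tsum_add ((hw.mul_bounded β').summable' f)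
      map_smul' := fun a β => by
        change ∑' k : ℤ, (w k * (a * β k)) * coef k f = a * ∑' k : ℤ, (w k * β k) * coef k f
        rw [← tsum_mul_left]
        exact tsum_congr fun k => by ring }
    (∑' k : ℤ, ‖w k‖ * ‖coef k f‖) (fun β => by
      rw [← tsum_mul_right]
      change ‖∑' k : ℤ, (w k * β k) * coef k f‖ ≤ _
      have h1 : Summable fun k : ℤ => ‖w k * β k * coef k f‖ := by
        simpa using (hw.mul_bounded β).summable f
      refine (norm_tsum_le_tsum_norm h1).trans
        (h1.tsum_le_tsum (fun k => ?_) ((hw.summable f).mul_right _))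
      rw [norm_mul, norm_mul, mul_right_comm]
      gcongr
      exact β.norm_coe_le_norm k)

/-- The pairings are functionals on the Banach space of bounded sequences `β`. Their time
derivatives are pointwise bounded on a compact interval, hence uniformly bounded in norm, and unit
sequences `β` extract the single coefficients. -/
theorem ScalarSmooth.exists_weighted_bound {c : ℝ → OS1} (hc : ScalarSmooth c) {w : ℤ → ℂ}
    (hw : Subexponential w) (j : ℕ) (a b : ℝ) :
    ∃ C, ∀ t ∈ Set.Icc a b, ∀ k, ‖w k‖ * ‖iteratedDeriv j (fun t => coef k (c t)) t‖ ≤ C := by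
  have hsm : ∀ β, ContDiff ℝ ∞ fun t => pairing (hw.mul_bounded β) (c t) := fun β =>
    hc _ (isDual_pairing _)
  -- The time derivatives remain continuous in `β`, because a pointwise limit of a sequence of
  -- continuous functionals on a Banach space is continuous.
  have hΛ : ∀ j t, ∃ Λ : BoundedContinuousFunction ℤ ℂ →L[ℂ] ℂ, ∀ β,
      Λ β = iteratedDeriv j (fun t => pairing (hw.mul_bounded β) (c t)) t := by
    intro j
    induction j with
    | zero => exact fun t => ⟨boundedPairing hw (c t), fun β => by rw [iteratedDeriv_zero]; rfl⟩
    | succ j ih =>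
      intro t
      choose Λ hΛ using ih
      have hlim : Tendsto (fun (n : ℕ) (β : BoundedContinuousFunction ℤ ℂ) =>
          ((((1 : ℝ) / (n + 1))⁻¹ : ℝ) : ℂ) • (Λ (t + 1 / (n + 1)) - Λ t) β) atTop
          (𝓝 fun β => iteratedDeriv (j + 1) (fun t => pairing (hw.mul_bounded β) (c t)) t) := by
        rw [tendsto_pi_nhds]
        intro β
        have h : HasDerivAt (iteratedDeriv j fun t => pairing (hw.mul_bounded β) (c t))
            (iteratedDeriv (j + 1) (fun t => pairing (hw.mul_bounded β) (c t)) t) t := by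
          rw [iteratedDeriv_succ]
          exact ((hsm β).differentiable_iteratedDeriv j
            (mod_cast WithTop.coe_lt_top _) t).hasDerivAt
        rw [hasDerivAt_iff_tendsto_slope_zero] at h
        have hn : Tendsto (fun n : ℕ => (1 : ℝ) / (n + 1)) atTop (𝓝[≠] 0) :=
          tendsto_nhdsWithin_iff.2 ⟨tendsto_one_div_add_atTop_nhds_zero_nat,
            Eventually.of_forall fun n => by simp; positivity⟩
        refine (h.comp hn).congr fun n => ?_
        simp only [Function.comp, sub_apply, hΛ]
        exact Complex.real_smul
      exact ⟨continuousLinearMapOfTendsto (fun n : ℕ => ((((1 : ℝ) / (n + 1))⁻¹ : ℝ) : ℂ) •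
        (Λ (t + 1 / (n + 1)) - Λ t)) hlim, fun β => rfl⟩
  choose Λ hΛ using hΛ
  obtain ⟨C, hC⟩ := banach_steinhaus (g := fun t : Set.Icc a b => Λ j t) fun β => by
    obtain ⟨C, hC⟩ := (isCompact_Icc (a := a) (b := b)).exists_bound_of_continuousOn
      ((hsm β).continuous_iteratedDeriv j (mod_cast le_top)).continuousOn
    exact ⟨C, fun t => by rw [hΛ]; exact hC t t.2⟩
  refine ⟨C, fun t ht k => ?_⟩
  let β : BoundedContinuousFunction ℤ ℂ :=
    BoundedContinuousFunction.ofNormedAddCommGroupDiscrete (Pi.single k 1 : ℤ → ℂ) 1 fun i => by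
      rcases eq_or_ne i k with rfl | h
      · simp
      · simp [h]
  have hβ : ‖β‖ ≤ 1 := BoundedContinuousFunction.norm_ofNormedAddCommGroup_le _ zero_le_one _
  have hp : ∀ f, pairing (hw.mul_bounded β) f = w k * coef k f := by
    intro f
    change ∑' i : ℤ, (w i * (Pi.single k 1 : ℤ → ℂ) i) * coef i f = _
    rw [tsum_eq_single k fun j hj => by simp [hj]]
    simp
  have h1 := (Λ j t).le_of_opNorm_le (hC ⟨t, ht⟩) β
  rw [hΛ] at h1
  simp only [hp] at h1
  have e : iteratedDeriv j (fun t => w k * coef k (c t)) t =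
      w k * iteratedDeriv j (fun t => coef k (c t)) t := by
    have := iteratedDeriv_const_mul (n := j) (x := t) (w k)
      (((hc _ (isDual_coef k)).of_le (mod_cast le_top)).contDiffAt)
    exact this
  rw [e, norm_mul] at h1
  refine h1.trans (mul_le_of_le_one_right ((norm_nonneg _).trans (hC ⟨t, ht⟩)) hβ)

/-- A sequence that stays bounded after multiplication with all subexponential sequences decays
exponentially. -/
theorem exists_exponential_bound {M : ℤ → ℝ}
    (h : ∀ w : ℤ → ℂ, Subexponential w → ∃ C, ∀ k, ‖w k‖ * M k ≤ C) :
    ∃ r, 0 < r ∧ r < 1 ∧ ∃ C, 0 ≤ C ∧ ∀ k, M k ≤ C * r ^ k.natAbs := by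
  -- Otherwise, with rates `r n` increasing to `1`, each `n` has an index `k n` at which `M` exceeds
  -- `n r n ^ |k n|`. The weight that equals an inverse power of these rates on the indices `k n`
  -- and `0` elsewhere is subexponential, yet its product with `M` is unbounded.
  by_contra! hcon
  set r : ℕ → ℝ := fun n => 1 - 1 / ((n : ℝ) + 2) with hr
  have hr0 : ∀ n, 0 < r n := fun n => by
    have : 1 / ((n : ℝ) + 2) < 1 := by
      rw [div_lt_one (by positivity)]; linarith [Nat.cast_nonneg (α := ℝ) n]
    simp only [hr]; linarith
  have hr1 : ∀ n, r n < 1 := fun n => by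
    have : 0 < 1 / ((n : ℝ) + 2) := by positivity
    simp only [hr]; linarith
  have hk : ∀ n : ℕ, ∃ k : ℤ, n * r n ^ k.natAbs < M k := fun n =>
    hcon (r n) (hr0 n) (hr1 n) n (Nat.cast_nonneg n)
  choose k hk using hk
  classical
  -- Several `n` may give the same index; the least one has the smallest rate and therefore the
  -- largest weight, so the lower bound holds for all of them.
  let w : ℤ → ℂ := fun i => if hi : ∃ n, k n = i then (((r (Nat.find hi))⁻¹ ^ i.natAbs : ℝ) : ℂ)
    else 0
  have hw : Subexponential w := by
    intro R hR
    obtain ⟨N, hN⟩ : ∃ N : ℕ, ∀ n ≥ N, (r n)⁻¹ ≤ R := by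
      have ht : Tendsto (fun n => (r n)⁻¹) atTop (𝓝 1) := by
        have h1 : Tendsto (fun n : ℕ => (1 : ℝ) / ((n : ℝ) + 2)) atTop (𝓝 0) := by
          have := (tendsto_one_div_add_atTop_nhds_zero_nat (𝕜 := ℝ)).comp (tendsto_add_atTop_nat 1)
          refine this.congr fun n => ?_
          simp only [Function.comp]; push_cast; ring
        have h2 : Tendsto r atTop (𝓝 1) := by simpa [hr] using h1.const_sub 1
        simpa using h2.inv₀ one_ne_zero
      exact eventually_atTop.1 (ht.eventually (ge_mem_nhds hR))
    -- Only finitely many `n` have an inverse rate above `R`, and their weights are absorbed into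
    -- the constant.
    set S := ∑ n ∈ Finset.range N, ‖w (k n)‖ with hS
    have hS0 : 0 ≤ S := Finset.sum_nonneg fun _ _ => norm_nonneg _
    refine ⟨S + 1, fun i => ?_⟩
    have hR1 : 1 ≤ R ^ i.natAbs := one_le_pow₀ hR.le
    by_cases hi : ∃ n, k n = i
    · rcases lt_or_ge (Nat.find hi) N with hlt | hge
      · have : ‖w i‖ ≤ S := by
          have h1 : ‖w (k (Nat.find hi))‖ ≤ S :=
            Finset.single_le_sum (f := fun n => ‖w (k n)‖) (fun _ _ => norm_nonneg _)
              (Finset.mem_range.2 hlt)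
          rwa [Nat.find_spec hi] at h1
        nlinarith
      · have : ‖w i‖ = (r (Nat.find hi))⁻¹ ^ i.natAbs := by
          simp only [w, dif_pos hi, Complex.norm_real, Real.norm_eq_abs]
          exact abs_of_nonneg (pow_nonneg (inv_nonneg.2 (hr0 _).le) _)
        rw [this]
        have h2 : (r (Nat.find hi))⁻¹ ^ i.natAbs ≤ R ^ i.natAbs :=
          pow_le_pow_left₀ (inv_nonneg.2 (hr0 _).le) (hN _ hge) _
        nlinarith
    · have : w i = 0 := by simp only [w, dif_neg hi]
      rw [this, norm_zero]; positivity
  obtain ⟨C, hC⟩ := h w hw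
  obtain ⟨n, hn⟩ := exists_nat_gt C
  have hi : ∃ m, k m = k n := ⟨n, rfl⟩
  have hm : Nat.find hi ≤ n := Nat.find_min' hi rfl
  have hwn : ‖w (k n)‖ = (r (Nat.find hi))⁻¹ ^ (k n).natAbs := by
    simp only [w, dif_pos hi, Complex.norm_real, Real.norm_eq_abs]
    exact abs_of_nonneg (pow_nonneg (inv_nonneg.2 (hr0 _).le) _)
  have hmono : r (Nat.find hi) ≤ r n := by
    simp only [hr]
    gcongr
  have h1 : (r n)⁻¹ ^ (k n).natAbs ≤ ‖w (k n)‖ := by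
    rw [hwn]
    exact pow_le_pow_left₀ (inv_nonneg.2 (hr0 _).le) (inv_anti₀ (hr0 _) hmono) _
  have h2 : (r n)⁻¹ ^ (k n).natAbs * (n * r n ^ (k n).natAbs) = n := by
    rw [mul_left_comm, ← mul_pow, inv_mul_cancel₀ (hr0 n).ne', one_pow, mul_one]
  have h3 : (n : ℝ) ≤ ‖w (k n)‖ * M (k n) := by
    rw [← h2]
    have := hr0 n
    gcongr
    exact (hk n).le
  linarith [hC (k n)]

/-! ## Interpolation of derivatives -/

section Interpolation

variable {ψ : ℝ → ℝ} {a b : ℝ}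

theorem iteratedDeriv_eq_zero_of_notMem_tsupport {E : Type*} [NormedAddCommGroup E]
    [NormedSpace ℝ E] {φ : ℝ → E} {x : ℝ} (hx : x ∉ tsupport φ) (j : ℕ) :
    iteratedDeriv j φ x = 0 := by
  have h0 : φ =ᶠ[𝓝 x] fun _ => 0 := notMem_tsupport_iff_eventuallyEq.1 hx
  rw [h0.iteratedDeriv_eq]
  simp

theorem hasDerivAt_iteratedDeriv_of_contDiff {E : Type*} [NormedAddCommGroup E]
    [NormedSpace ℝ E] {φ : ℝ → E} (h : ContDiff ℝ ∞ φ) (j : ℕ) (x : ℝ) :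
    HasDerivAt (iteratedDeriv j φ) (iteratedDeriv (j + 1) φ x) x := by
  rw [iteratedDeriv_succ]
  exact (h.differentiable_iteratedDeriv j (mod_cast WithTop.coe_lt_top _) x).hasDerivAt

/-- Each integration by parts moves one derivative to the other factor; the boundary terms vanish by
compact support, and the sign is lost in the absolute value. -/
theorem abs_integral_iteratedDeriv_mul (h : ContDiff ℝ ∞ ψ) (hs : tsupport ψ ⊆ Set.Ioo a b)
    (i l : ℕ) : |∫ x in a..b, iteratedDeriv i ψ x * iteratedDeriv l ψ x| =
      |∫ x in a..b, ψ x * iteratedDeriv (i + l) ψ x| := by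
  induction i generalizing l with
  | zero => simp
  | succ i ih =>
    have hc : ∀ j, Continuous (iteratedDeriv j ψ) := fun j =>
      h.continuous_iteratedDeriv j (mod_cast le_top)
    have hz : ∀ x, x ∉ Set.Ioo a b → ∀ j, iteratedDeriv j ψ x = 0 := fun x hx j =>
      iteratedDeriv_eq_zero_of_notMem_tsupport (fun h' => hx (hs h')) j
    have key := intervalIntegral.integral_mul_deriv_eq_deriv_mul (a := a) (b := b)
      (u := iteratedDeriv i ψ) (v := iteratedDeriv l ψ) (fun x _ => hasDerivAt_iteratedDeriv_of_contDiff h i x)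
      (fun x _ => hasDerivAt_iteratedDeriv_of_contDiff h l x) ((hc _).intervalIntegrable _ _)
      ((hc _).intervalIntegrable _ _)
    rw [hz a (by simp) i, hz b (by simp) i, zero_mul, zero_mul, sub_zero, zero_sub] at key
    rw [← abs_neg, ← key, ih (l + 1)]
    congr 4
    ext x
    congr 2
    ring

/-- The square of the `j`-th derivative is the integral of twice its product with the next one, at
most the sum of two squared `L²` norms. Integration by parts turns these norms into integrals of `ψ`
against derivatives of double order, so each carries a factor `ε`. Thus a small function with
bounded derivatives has small derivatives, at the cost of a square root. -/
theorem sq_iteratedDeriv_le (hab : a ≤ b) (h : ContDiff ℝ ∞ ψ) (hs : tsupport ψ ⊆ Set.Ioo a b)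
    {ε : ℝ} (hε : ∀ x, |ψ x| ≤ ε) {C : ℕ → ℝ} (hC : ∀ j x, |iteratedDeriv j ψ x| ≤ C j) (j : ℕ)
    (x : ℝ) : iteratedDeriv j ψ x ^ 2 ≤
      ε * ((b - a) * (C (j + j) + C (j + 1 + (j + 1)))) := by
  have hc : ∀ j, Continuous (iteratedDeriv j ψ) := fun j =>
    h.continuous_iteratedDeriv j (mod_cast le_top)
  have hz : ∀ x, x ∉ Set.Ioo a b → ∀ j, iteratedDeriv j ψ x = 0 := fun x hx j =>
    iteratedDeriv_eq_zero_of_notMem_tsupport (fun h' => hx (hs h')) j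
  have hε0 : 0 ≤ ε := (abs_nonneg _).trans (hε 0)
  have hC0 : ∀ j, 0 ≤ C j := fun j => (abs_nonneg _).trans (hC j 0)
  have hint : ∀ j, ∫ x in a..b, iteratedDeriv j ψ x * iteratedDeriv j ψ x ≤
      ε * ((b - a) * C (j + j)) := by
    intro j
    refine (le_abs_self _).trans ?_
    rw [abs_integral_iteratedDeriv_mul h hs, ← Real.norm_eq_abs]
    refine (intervalIntegral.norm_integral_le_of_norm_le_const (C := ε * C (j + j))
      fun x _ => ?_).trans_eq ?_
    · rw [norm_mul]
      exact mul_le_mul (hε x) (hC _ x) (norm_nonneg _) hε0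
    · rw [abs_of_nonneg (by linarith)]; ring
  by_cases hx : x ∈ Set.Ioo a b
  · have hd : ∀ y, HasDerivAt (fun y => iteratedDeriv j ψ y ^ 2)
        (2 * iteratedDeriv j ψ y * iteratedDeriv (j + 1) ψ y) y := by
      intro y
      simpa using! (hasDerivAt_iteratedDeriv_of_contDiff h j y).pow 2
    have e := intervalIntegral.integral_eq_sub_of_hasDerivAt (a := a) (b := x)
      (fun y _ => hd y) (Continuous.intervalIntegrable
        ((continuous_const.mul (hc j)).mul (hc (j + 1))) _ _)
    rw [hz a (by simp) j] at e
    have e' : iteratedDeriv j ψ x ^ 2 =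
        ∫ y in a..x, 2 * iteratedDeriv j ψ y * iteratedDeriv (j + 1) ψ y := by rw [e]; ring
    set g : ℝ → ℝ := fun y => iteratedDeriv j ψ y * iteratedDeriv j ψ y +
      iteratedDeriv (j + 1) ψ y * iteratedDeriv (j + 1) ψ y with hg
    have hgc : Continuous g := ((hc j).mul (hc j)).add ((hc _).mul (hc _))
    have hg0 : ∀ y, 0 ≤ g y := fun y => add_nonneg (mul_self_nonneg _) (mul_self_nonneg _)
    calc iteratedDeriv j ψ x ^ 2 ≤ ∫ y in a..x, g y := by
          rw [e']
          refine intervalIntegral.integral_mono_on hx.1.le (Continuous.intervalIntegrable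
            ((continuous_const.mul (hc j)).mul (hc (j + 1))) _ _) (hgc.intervalIntegrable _ _)
            fun y _ => ?_
          simp only [hg]
          nlinarith [sq_nonneg (iteratedDeriv j ψ y - iteratedDeriv (j + 1) ψ y)]
      _ ≤ ∫ y in a..b, g y :=
          intervalIntegral.integral_mono_interval le_rfl hx.1.le hx.2.le
            (Eventually.of_forall hg0) (hgc.intervalIntegrable _ _)
      _ ≤ ε * ((b - a) * C (j + j)) + ε * ((b - a) * C (j + 1 + (j + 1))) := by
          have h1 := intervalIntegral.integral_add (((hc j).mul (hc j)).intervalIntegrable a b)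
            (((hc (j + 1)).mul (hc (j + 1))).intervalIntegrable (μ := MeasureTheory.volume) a b)
          exact h1.trans_le (add_le_add (hint j) (hint (j + 1)))
      _ = _ := by ring
  · rw [hz x hx j]
    have := hC0 (j + j)
    have := hC0 (j + 1 + (j + 1))
    have : 0 ≤ b - a := by linarith
    simp only [ne_eq, OfNat.ofNat_ne_zero, not_false_eq_true, zero_pow]
    positivity

theorem iteratedDeriv_clm_comp {E F : Type*} [NormedAddCommGroup E] [NormedSpace ℝ E]
    [NormedAddCommGroup F] [NormedSpace ℝ F] (L : E →L[ℝ] F) {φ : ℝ → E} (h : ContDiff ℝ ∞ φ)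
    (j : ℕ) : iteratedDeriv j (fun t => L (φ t)) = fun t => L (iteratedDeriv j φ t) := by
  induction j with
  | zero => simp
  | succ j ih =>
    ext t
    rw [iteratedDeriv_succ, ih]
    exact (L.hasFDerivAt.comp_hasDerivAt t (hasDerivAt_iteratedDeriv_of_contDiff h j t)).deriv

theorem norm_iteratedDeriv_le_sqrt {φ : ℝ → ℂ} (hab : a ≤ b) (h : ContDiff ℝ ∞ φ)
    (hs : tsupport φ ⊆ Set.Ioo a b) {ε : ℝ} (hε : ∀ x, ‖φ x‖ ≤ ε) {C : ℕ → ℝ}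
    (hC : ∀ j x, ‖iteratedDeriv j φ x‖ ≤ C j) (j : ℕ) (x : ℝ) :
    ‖iteratedDeriv j φ x‖ ≤
      2 * √((b - a) * (C (j + j) + C (j + 1 + (j + 1)))) * √ε := by
  have key : ∀ L : ℂ →L[ℝ] ℝ, (∀ z, |L z| ≤ ‖z‖) → |L (iteratedDeriv j φ x)| ≤
      √((b - a) * (C (j + j) + C (j + 1 + (j + 1)))) * √ε := by
    intro L hL
    have h1 := sq_iteratedDeriv_le (ψ := fun t => L (φ t)) hab (L.contDiff.comp h)
      ((tsupport_comp_subset (map_zero L) φ).trans hs) (fun y => (hL _).trans (hε y)) (C := C)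
      (fun i y => by rw [iteratedDeriv_clm_comp L h]; exact (hL _).trans (hC i y)) j x
    rw [iteratedDeriv_clm_comp L h] at h1
    have hC0 : ∀ j, 0 ≤ C j := fun j => (norm_nonneg _).trans (hC j 0)
    rw [← Real.sqrt_mul (mul_nonneg (by linarith) (add_nonneg (hC0 _) (hC0 _))), mul_comm _ ε]
    exact Real.abs_le_sqrt h1
  have h1 := key Complex.reCLM Complex.abs_re_le_norm
  have h2 := key Complex.imCLM Complex.abs_im_le_norm
  have h3 := Complex.norm_le_abs_re_add_abs_im (iteratedDeriv j φ x)
  simp only [Complex.reCLM_apply, Complex.imCLM_apply] at h1 h2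
  linarith

end Interpolation

/-- Locally, the coefficients of a smooth curve and all their derivatives decay at a common
exponential rate. -/
theorem ScalarSmooth.exists_coef_family {γ : ℝ → OS1} (hγ : ScalarSmooth γ) (t₀ : ℝ) :
    ∃ a : ℤ → ℝ → ℂ, ∃ q : ℝ, 0 < q ∧ q < 1 ∧ (∀ k, ContDiff ℝ ∞ (a k)) ∧
      (∀ j, ∃ C, ∀ k t, ‖iteratedDeriv j (a k) t‖ ≤ C * q ^ k.natAbs) ∧
      ∀ t, |t - t₀| ≤ 1 → ∀ k, a k t = coef k (γ t) := by
  -- The interpolation inequality needs compact support in time; the cutoff equals `1` on the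
  -- interval of interest.
  let χ : ContDiffBump t₀ := ⟨1, 2, one_pos, one_lt_two⟩
  let c : ℝ → OS1 := fun t => ((χ t : ℝ) : ℂ) • γ t
  have hχ : ContDiff ℝ ∞ fun t => ((χ t : ℝ) : ℂ) := Complex.ofRealCLM.contDiff.comp χ.contDiff
  have hc : ScalarSmooth c := fun ℓ hℓ => by
    have : (fun t => ℓ (c t)) = fun t => ((χ t : ℝ) : ℂ) * ℓ (γ t) := funext fun t => by simp [c]
    rw [this]
    exact hχ.mul (hγ ℓ hℓ)
  let φ : ℤ → ℝ → ℂ := fun k t => coef k (c t)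
  have hφ : ∀ k, ContDiff ℝ ∞ (φ k) := fun k => hc _ (isDual_coef k)
  have hφe : ∀ k, φ k = fun t => ((χ t : ℝ) : ℂ) * coef k (γ t) := fun k => funext fun t => by
    simp [φ, c]
  have hsupp : ∀ k, tsupport (φ k) ⊆ Set.Ioo (t₀ - 3) (t₀ + 3) := by
    intro k
    have h1 : tsupport (φ k) ⊆ Metric.closedBall t₀ 2 := by
      refine closure_minimal (fun t ht => ?_) Metric.isClosed_closedBall
      by_contra hn
      refine ht ?_
      rw [hφe]
      have : χ t = 0 := χ.zero_of_le_dist (by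
        simp only [Metric.mem_closedBall, not_le] at hn; exact hn.le)
      simp [this]
    refine h1.trans fun t ht => ?_
    rw [Metric.mem_closedBall, Real.dist_eq, abs_le] at ht
    constructor <;> linarith [ht.1, ht.2]
  have hvan : ∀ t, t ∉ Set.Icc (t₀ - 3) (t₀ + 3) → ∀ k j, iteratedDeriv j (φ k) t = 0 :=
    fun t ht k j => iteratedDeriv_eq_zero_of_notMem_tsupport
      (fun h => ht (Set.Ioo_subset_Icc_self (hsupp k h))) j
  have hglob : ∀ w, Subexponential w → ∀ j, ∃ C, ∀ t k,
      ‖w k‖ * ‖iteratedDeriv j (φ k) t‖ ≤ C := by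
    intro w hw j
    obtain ⟨C, hC⟩ := hc.exists_weighted_bound hw j (t₀ - 3) (t₀ + 3)
    refine ⟨max C 0, fun t k => ?_⟩
    by_cases ht : t ∈ Set.Icc (t₀ - 3) (t₀ + 3)
    · exact (hC t ht k).trans (le_max_left _ _)
    · rw [hvan t ht, norm_zero, mul_zero]; exact le_max_right _ _
  have hone : Subexponential fun _ => 1 := fun R hR => ⟨1, fun k => by
    simpa using one_le_pow₀ hR.le⟩
  have hb : ∀ j, ∃ C, ∀ t k, ‖iteratedDeriv j (φ k) t‖ ≤ C := fun j => by
    simpa using hglob _ hone j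
  choose C hC using hb
  have hbdd : ∀ k, BddAbove (Set.range fun t => ‖φ k t‖) := fun k => by
    refine ⟨C 0, ?_⟩
    rintro _ ⟨t, rfl⟩
    simpa using hC 0 t k
  -- Exponential decay is extracted only for the coefficients themselves. Interpolation with the
  -- crude bounds `C` then gives every time derivative the rate `√r`, which does not depend on the
  -- order.
  obtain ⟨r, hr0, hr1, D, hD0, hD⟩ := exists_exponential_bound (M := fun k => ⨆ t, ‖φ k t‖)
    fun w hw => by
      obtain ⟨C, hC⟩ := hglob w hw 0
      refine ⟨C, fun k => ?_⟩
      rw [Real.mul_iSup_of_nonneg (norm_nonneg _)]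
      exact ciSup_le fun t => by simpa using hC t k
  refine ⟨φ, √r, Real.sqrt_pos.2 hr0, by rw [Real.sqrt_lt' one_pos]; simpa using hr1, hφ,
    fun j => ⟨2 * √((t₀ + 3 - (t₀ - 3)) * (C (j + j) + C (j + 1 + (j + 1)))) * √D,
      fun k t => ?_⟩, fun t ht k => ?_⟩
  · have h := norm_iteratedDeriv_le_sqrt (by linarith : t₀ - 3 ≤ t₀ + 3) (hφ k) (hsupp k)
      (ε := D * r ^ k.natAbs) (fun x => (le_ciSup (hbdd k) x).trans (hD k)) (C := C)
      (fun i y => hC i y k) j t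
    refine h.trans_eq ?_
    rw [Real.sqrt_mul hD0, ← mul_assoc]
    congr 1
    refine (Real.sqrt_eq_iff_mul_self_eq (by positivity) (by positivity)).2 ?_
    rw [← mul_pow, Real.mul_self_sqrt hr0.le]
  · have : χ t = 1 := χ.one_of_mem_closedBall (by
      rw [Metric.mem_closedBall, Real.dist_eq]; exact ht)
    rw [hφe]; simp [this]

/-! ## Smooth families of holomorphic functions -/

/-- A sequence of families of holomorphic functions on `A`, each the time derivative of its
predecessor. -/
structure HolFamily (J : Set ℝ) (A : Set ℂ) (Γ : ℕ → ℝ → ℂ → ℂ) : Prop where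
  hol : ∀ j, ∀ t ∈ J, DifferentiableOn ℂ (Γ j t) A
  deriv : ∀ j, ∀ t ∈ J, ∀ z ∈ A, HasDerivAt (fun s => Γ j s z) (Γ (j + 1) t z) t
  cont : ∀ j, ContinuousOn (fun p : ℝ × ℂ => Γ j p.1 p.2) (J ×ˢ A)

section HolFamily

variable {J : Set ℝ} {A : Set ℂ} {Γ : ℕ → ℝ → ℂ → ℂ}

theorem HolFamily.shift (h : HolFamily J A Γ) : HolFamily J A fun j => Γ (j + 1) :=
  ⟨fun j => h.hol (j + 1), fun j => h.deriv (j + 1), fun j => h.cont (j + 1)⟩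

theorem HolFamily.tendstoLocallyUniformlyOn_nhds (hJ : IsOpen J) (hA : IsOpen A)
    (h : HolFamily J A Γ) (j : ℕ) {t : ℝ} (ht : t ∈ J) :
    TendstoLocallyUniformlyOn (fun s => Γ j s) (Γ j t) (𝓝 t) A := by
  rw [Metric.tendstoLocallyUniformlyOn_iff]
  intro ε hε z hz
  have hc := (h.cont j).continuousAt ((hJ.prod hA).mem_nhds (Set.mk_mem_prod ht hz))
  have he := Metric.tendsto_nhds.1 hc (ε / 2) (by positivity)
  rw [nhds_prod_eq, eventually_prod_iff] at he
  obtain ⟨P, hP, Q, hQ, hPQ⟩ := he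
  refine ⟨{y | Q y}, mem_nhdsWithin_of_mem_nhds hQ, ?_⟩
  filter_upwards [hP] with s hs y hy
  have h1 := hPQ hs hy
  have h2 := hPQ hP.self_of_nhds hy
  rw [dist_comm] at h1
  calc dist (Γ j t y) (Γ j s y) ≤ dist (Γ j t y) (Γ j t z) + dist (Γ j t z) (Γ j s y) :=
        dist_triangle _ _ _
    _ < ε := by linarith

/-- The mean value inequality is applied to `τ ↦ G τ y - τ G' t y` between `t` and `t + s`; joint
continuity of `G'` makes its derivative small uniformly for `y` near `z`. -/
theorem tendstoLocallyUniformlyOn_slope (hJ : IsOpen J) (hA : IsOpen A) {G G' : ℝ → ℂ → ℂ}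
    (hd : ∀ t ∈ J, ∀ z ∈ A, HasDerivAt (fun s => G s z) (G' t z) t)
    (hc : ContinuousOn (fun p : ℝ × ℂ => G' p.1 p.2) (J ×ˢ A)) {t : ℝ} (ht : t ∈ J) :
    TendstoLocallyUniformlyOn (fun (s : ℝ) z => (s : ℂ)⁻¹ * (G (t + s) z - G t z))
      (G' t) (𝓝[≠] 0) A := by
  rw [Metric.tendstoLocallyUniformlyOn_iff]
  intro ε hε z hz
  replace hc := hc.continuousAt ((hJ.prod hA).mem_nhds (Set.mk_mem_prod ht hz))
  have he := Metric.tendsto_nhds.1 hc (ε / 3) (by positivity)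
  rw [nhds_prod_eq, eventually_prod_iff] at he
  obtain ⟨P, hP, Q, hQ, hPQ⟩ := he
  obtain ⟨δ, hδ, hball⟩ := Metric.mem_nhds_iff.1 (inter_mem hP (hJ.mem_nhds ht))
  refine ⟨{y | Q y} ∩ A, inter_mem (mem_nhdsWithin_of_mem_nhds hQ) self_mem_nhdsWithin, ?_⟩
  have hs : ∀ᶠ s : ℝ in 𝓝[≠] 0, s ≠ 0 ∧ |s| < δ :=
    (eventually_mem_nhdsWithin).and (eventually_nhdsWithin_of_eventually_nhds (by
      filter_upwards [Metric.ball_mem_nhds (0 : ℝ) hδ] with s hs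
      simpa using hs))
  filter_upwards [hs] with s hs y hy
  have hmem : ∀ τ ∈ Set.uIcc t (t + s), τ ∈ Metric.ball t δ := by
    intro τ hτ
    rw [Metric.mem_ball, Real.dist_eq]
    have := Set.abs_sub_left_of_mem_uIcc hτ
    rw [add_sub_cancel_left] at this
    exact this.trans_lt hs.2
  have hmv := Convex.norm_image_sub_le_of_norm_hasDerivWithin_le
    (f := fun τ => G τ y - (τ : ℂ) * G' t y)
    (f' := fun τ => G' τ y - G' t y) (s := Set.uIcc t (t + s)) (C := 2 * ε / 3)
    (fun τ hτ => by
      have h1 := hd τ (hball (hmem τ hτ)).2 y hy.2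
      have h2 := (Complex.ofRealCLM.hasDerivAt (x := τ)).mul_const (G' t y)
      simpa using! (h1.sub h2).hasDerivWithinAt)
    (fun τ hτ => by
      have h1 := hPQ (hball (hmem τ hτ)).1 hy.1
      have h2 := hPQ hP.self_of_nhds hy.1
      rw [← dist_eq_norm]
      rw [dist_comm] at h2
      linarith [dist_triangle (G' τ y) (G' t z) (G' t y)])
    (convex_uIcc _ _) (Set.left_mem_uIcc) (Set.right_mem_uIcc)
  have e : G' t y - (s : ℂ)⁻¹ * (G (t + s) y - G t y) =
      -((s : ℂ)⁻¹ * (G (t + s) y - ((t + s : ℝ) : ℂ) * G' t y -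
        (G t y - (t : ℂ) * G' t y))) := by
    have : (s : ℂ) ≠ 0 := Complex.ofReal_ne_zero.2 hs.1
    push_cast
    field_simp
    ring
  rw [dist_eq_norm, e, norm_neg, norm_mul, norm_inv, Complex.norm_real]
  rw [add_sub_cancel_left] at hmv
  have hs0 : 0 < ‖s‖ := norm_pos_iff.2 hs.1
  calc _ ≤ ‖s‖⁻¹ * (2 * ε / 3 * ‖s‖) := by gcongr
    _ = 2 * ε / 3 := by field_simp
    _ < ε := by linarith

theorem HolFamily.tendstoLocallyUniformlyOn_slope (hJ : IsOpen J) (hA : IsOpen A)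
    (h : HolFamily J A Γ) (j : ℕ) {t : ℝ} (ht : t ∈ J) :
    TendstoLocallyUniformlyOn (fun (s : ℝ) z => (s : ℂ)⁻¹ * (Γ j (t + s) z - Γ j t z))
      (Γ (j + 1) t) (𝓝[≠] 0) A :=
  CircleDef.tendstoLocallyUniformlyOn_slope hJ hA (h.deriv j) (h.cont (j + 1)) ht

theorem eventually_add_mem (hJ : IsOpen J) {t : ℝ} (ht : t ∈ J) : ∀ᶠ s : ℝ in 𝓝[≠] 0, t + s ∈ J := by
  have : Tendsto (fun s : ℝ => t + s) (𝓝 0) (𝓝 t) := by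
    simpa using (continuous_const.add continuous_id).tendsto (0 : ℝ) (f := fun s : ℝ => t + s)
  exact eventually_nhdsWithin_of_eventually_nhds (this.eventually (hJ.mem_nhds ht))

/-- The family of complex derivatives. -/
theorem HolFamily.derivZ (hJ : IsOpen J) (hA : IsOpen A) (h : HolFamily J A Γ) :
    HolFamily J A fun j t => _root_.deriv (Γ j t) where
  hol j t ht := (h.hol j t ht).deriv hA
  deriv j t ht z hz := by
    rw [hasDerivAt_iff_tendsto_slope_zero]
    -- By Weierstrass, complex derivatives pass to locally uniform limits of holomorphic functions;
    -- applied to time difference quotients this interchanges the two derivatives.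
    have h1 := (h.tendstoLocallyUniformlyOn_slope hJ hA j ht).deriv (by
      filter_upwards [eventually_add_mem hJ ht] with s hs
      exact ((h.hol j _ hs).sub (h.hol j t ht)).const_mul _) hA
    have h2 := h1.tendsto_at hz
    refine h2.congr' ?_
    filter_upwards [eventually_add_mem hJ ht] with s hs
    have d1 := ((h.hol j _ hs).differentiableAt (hA.mem_nhds hz)).hasDerivAt
    have d2 := ((h.hol j t ht).differentiableAt (hA.mem_nhds hz)).hasDerivAt
    simp only [Function.comp]
    rw [Complex.real_smul, Complex.ofReal_inv]
    exact ((d1.sub d2).const_mul (s : ℂ)⁻¹).deriv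
  cont j := by
    rintro ⟨t, z⟩ ⟨ht, hz⟩
    refine ContinuousAt.continuousWithinAt ?_
    have hl : TendstoLocallyUniformlyOn (fun s => _root_.deriv (Γ j s)) (_root_.deriv (Γ j t))
        (𝓝 t) A := (h.tendstoLocallyUniformlyOn_nhds hJ hA j ht).deriv (by
      filter_upwards [hJ.mem_nhds ht] with s hs using h.hol j s hs) hA
    have hcz : ContinuousAt (_root_.deriv (Γ j t)) z :=
      ((h.hol j t ht).deriv hA).continuousOn.continuousAt (hA.mem_nhds hz)
    rw [ContinuousAt, Metric.tendsto_nhds]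
    intro ε hε
    obtain ⟨u, hu, hT⟩ := Metric.tendstoLocallyUniformlyOn_iff.1 hl (ε / 2) (by positivity) z hz
    rw [hA.nhdsWithin_eq hz] at hu
    rw [nhds_prod_eq, eventually_prod_iff]
    refine ⟨_, hT, fun y => y ∈ u ∧ dist (_root_.deriv (Γ j t) y) (_root_.deriv (Γ j t) z) < ε / 2,
      (show ∀ᶠ y in 𝓝 z, y ∈ u from hu).and (Metric.tendsto_nhds.1 hcz _ (by positivity)),
      fun {s} hs {y} hy => ?_⟩
    have := hs y hy.1
    rw [dist_comm] at this
    change dist (_root_.deriv (Γ j s) y) _ < ε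
    linarith [dist_triangle (_root_.deriv (Γ j s) y) (_root_.deriv (Γ j t) y)
      (_root_.deriv (Γ j t) z), hy.2]

theorem HolFamily.hasFDerivAt (hJ : IsOpen J) (hA : IsOpen A) (h : HolFamily J A Γ) {p : ℝ × ℂ}
    (hp : p ∈ J ×ˢ A) : HasFDerivAt (fun p : ℝ × ℂ => Γ 0 p.1 p.2)
      ((ContinuousLinearMap.toSpanSingletonLIE ℝ ℂ (Γ 1 p.1 p.2)).coprod
        (ContinuousLinearMap.mul ℝ ℂ (_root_.deriv (Γ 0 p.1) p.2))) p := by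
  have hz := h.derivZ hJ hA
  have hn : J ×ˢ A ∈ 𝓝 p := (hJ.prod hA).mem_nhds hp
  refine (hasStrictFDerivAt_uncurry_coprod (f := fun t z => Γ 0 t z)
    (f₁ := fun t z => ContinuousLinearMap.toSpanSingletonLIE ℝ ℂ (Γ 1 t z))
    (f₂ := fun t z => ContinuousLinearMap.mul ℝ ℂ (_root_.deriv (Γ 0 t) z)) ?_ ?_ ?_ ?_).hasFDerivAt
  · filter_upwards [hn] with v hv
    exact (h.deriv 0 v.1 hv.1 v.2 hv.2).hasFDerivAt
  · filter_upwards [hn] with v hv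
    have h1 := ((h.hol 0 v.1 hv.1).differentiableAt (hA.mem_nhds hv.2)).hasDerivAt
    refine (h1.hasFDerivAt.restrictScalars ℝ).congr_fderiv ?_
    ext
    simp [Function.HasUncurry.uncurry, mul_comm]
  · exact (ContinuousLinearMap.toSpanSingletonLIE ℝ ℂ).continuous.continuousAt.comp
      ((h.cont 1).continuousAt hn)
  · exact (ContinuousLinearMap.mul ℝ ℂ).continuous.continuousAt.comp ((hz.cont 0).continuousAt hn)

/-- Smooth families are jointly smooth. -/
theorem HolFamily.contDiffOn (hJ : IsOpen J) (hA : IsOpen A) (h : HolFamily J A Γ) :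
    ContDiffOn ℝ ∞ (fun p : ℝ × ℂ => Γ 0 p.1 p.2) (J ×ˢ A) := by
  have ho := hJ.prod hA
  -- The induction must run over all families at once, since the two partial derivatives belong to
  -- the shifted family and to the family of complex derivatives.
  have key : ∀ n : ℕ, ∀ Γ : ℕ → ℝ → ℂ → ℂ, HolFamily J A Γ →
      ContDiffOn ℝ n (fun p : ℝ × ℂ => Γ 0 p.1 p.2) (J ×ˢ A) := by
    intro n
    induction n with
    | zero => intro Γ h; exact contDiffOn_zero.2 (h.cont 0)
    | succ n ih =>
      intro Γ h
      rw [Nat.cast_succ, contDiffOn_succ_iff_fderiv_of_isOpen ho]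
      refine ⟨fun p hp => (h.hasFDerivAt hJ hA hp).differentiableAt.differentiableWithinAt,
        fun h' => by simp at h', ?_⟩
      refine ContDiffOn.congr ?_ fun p hp => (h.hasFDerivAt hJ hA hp).fderiv
      rw [contDiffOn_clm_apply]
      intro y
      simp only [ContinuousLinearMap.coprod_apply, ContinuousLinearMap.mul_apply',
        ContinuousLinearMap.toSpanSingletonLIE_apply, ContinuousLinearMap.toSpanSingleton_apply]
      exact ((ih _ h.shift).const_smul y.1).add ((ih _ (h.derivZ hJ hA)).mul contDiffOn_const)
  exact contDiffOn_infty.2 fun n => key n Γ h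

/-- A jointly smooth family of holomorphic functions on `A`. -/
structure SmoothFamily (J : Set ℝ) (A : Set ℂ) (G : ℝ → ℂ → ℂ) : Prop where
  hol : ∀ t ∈ J, DifferentiableOn ℂ (G t) A
  smooth : ContDiffOn ℝ ∞ (fun p : ℝ × ℂ => G p.1 p.2) (J ×ˢ A)

theorem HolFamily.smoothFamily (hJ : IsOpen J) (hA : IsOpen A) (h : HolFamily J A Γ) :
    SmoothFamily J A (Γ 0) :=
  ⟨h.hol 0, h.contDiffOn hJ hA⟩

theorem SmoothFamily.mono {G : ℝ → ℂ → ℂ} (h : SmoothFamily J A G) {J' : Set ℝ} {A' : Set ℂ}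
    (hJ : J' ⊆ J) (hA : A' ⊆ A) : SmoothFamily J' A' G :=
  ⟨fun t ht => (h.hol t (hJ ht)).mono hA, h.smooth.mono (Set.prod_mono hJ hA)⟩

theorem SmoothFamily.reparam {G : ℝ → ℂ → ℂ} (h : SmoothFamily J A G) {ρ : ℝ → ℝ}
    (hρ : ContDiff ℝ ∞ ρ) (hJ : ∀ t, ρ t ∈ J) : SmoothFamily Set.univ A fun t => G (ρ t) :=
  ⟨fun t _ => h.hol _ (hJ t), h.smooth.comp (f := fun p : ℝ × ℂ => (ρ p.1, p.2))
    (by fun_prop) fun p hp => ⟨hJ p.1, hp.2⟩⟩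

theorem hasDerivAt_fderiv_time {G : ℝ × ℂ → ℂ} {p : ℝ × ℂ} (h : DifferentiableAt ℝ G p) :
    HasDerivAt (fun s => G (s, p.2)) (fderiv ℝ G p (1, 0)) p.1 := by
  have h1 : HasDerivAt (fun s : ℝ => (s, p.2)) ((1 : ℝ), (0 : ℂ)) p.1 :=
    (hasDerivAt_id _).prodMk (hasDerivAt_const _ _)
  exact h.hasFDerivAt.comp_hasDerivAt p.1 h1

/-- The time derivative of a family. -/
def timeDeriv (G : ℝ → ℂ → ℂ) (t : ℝ) (z : ℂ) : ℂ :=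
  fderiv ℝ (fun p : ℝ × ℂ => G p.1 p.2) (t, z) (1, 0)

theorem SmoothFamily.hasDerivAt {G : ℝ → ℂ → ℂ} (hJ : IsOpen J) (hA : IsOpen A)
    (h : SmoothFamily J A G) {t : ℝ} (ht : t ∈ J) {z : ℂ} (hz : z ∈ A) :
    HasDerivAt (fun s => G s z) (timeDeriv G t z) t :=
  hasDerivAt_fderiv_time (G := fun p : ℝ × ℂ => G p.1 p.2) (p := (t, z))
    ((h.smooth.contDiffAt ((hJ.prod hA).mem_nhds (Set.mk_mem_prod ht hz))).differentiableAt
      (by simp))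

/-- The time derivative is holomorphic as a locally uniform limit of holomorphic difference
quotients. -/
theorem SmoothFamily.timeDeriv {G : ℝ → ℂ → ℂ} (hJ : IsOpen J) (hA : IsOpen A)
    (h : SmoothFamily J A G) : SmoothFamily J A (timeDeriv G) := by
  have hs : ContDiffOn ℝ ∞ (fun p : ℝ × ℂ => CircleDef.timeDeriv G p.1 p.2) (J ×ˢ A) :=
    (h.smooth.fderiv_of_isOpen (hJ.prod hA) (by simp)).clm_apply contDiffOn_const
  refine ⟨fun t ht => ?_, hs⟩
  refine (tendstoLocallyUniformlyOn_slope hJ hA (fun t ht z hz => h.hasDerivAt hJ hA ht hz)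
    hs.continuousOn ht).differentiableOn ?_ hA
  filter_upwards [eventually_add_mem hJ ht] with s hs
  exact ((h.hol _ hs).sub (h.hol t ht)).const_mul _

theorem SmoothFamily.holFamily {G : ℝ → ℂ → ℂ} (hJ : IsOpen J) (hA : IsOpen A)
    (h : SmoothFamily J A G) : HolFamily J A fun j => CircleDef.timeDeriv^[j] G := by
  have key : ∀ j, SmoothFamily J A (CircleDef.timeDeriv^[j] G) := by
    intro j
    induction j with
    | zero => exact h
    | succ j ih => rw [Function.iterate_succ_apply']; exact ih.timeDeriv hJ hA
  refine ⟨fun j => (key j).hol, fun j t ht z hz => ?_, fun j => (key j).smooth.continuousOn⟩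
  rw [Function.iterate_succ_apply']
  exact (key j).hasDerivAt hJ hA ht hz

end HolFamily

/-! ## Smooth curves in the space of analytic functions -/

/-- The element of `𝒪(U_n)` given by a holomorphic function on `annulus n`. -/
def Hol.mk {n : ℕ} {F : ℂ → ℂ} (hF : DifferentiableOn ℂ F (annulus n)) : Hol n :=
  ⟨⟨fun z => F z, hF.continuousOn.domRestrict⟩, F, hF, fun _ => rfl⟩

/-- The restriction of a holomorphic function on an annulus to the circle. -/
def OS1.ofHol {n : ℕ} {F : ℂ → ℂ} (hF : DifferentiableOn ℂ F (annulus n)) : OS1 :=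
  restrict n (Hol.mk hF)

theorem OS1.isExtension_ofHol {n : ℕ} {F : ℂ → ℂ} (hF : DifferentiableOn ℂ F (annulus n)) :
    IsExtension n F (OS1.ofHol hF) :=
  ⟨hF, fun _ => rfl⟩

theorem OS1.ofHol_apply {n : ℕ} {F : ℂ → ℂ} (hF : DifferentiableOn ℂ F (annulus n)) (z : Circle) :
    OS1.ofHol hF z = F z := rfl

/-- The difference quotients converge locally uniformly on one annulus, hence in one space `Hol n`,
and restriction to the circle is continuous for the limit topology. -/
theorem tendsto_slope_ofHol {n : ℕ} {Γ : ℕ → ℝ → ℂ → ℂ}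
    (h : HolFamily Set.univ (annulus n) Γ) (j : ℕ) (t : ℝ) :
    Tendsto (fun s : ℝ => s⁻¹ • (OS1.ofHol (h.hol j (t + s) trivial) -
      OS1.ofHol (h.hol j t trivial))) (𝓝[≠] 0) (𝓝 (OS1.ofHol (h.hol (j + 1) t trivial))) := by
  have e : (fun s : ℝ => s⁻¹ • (OS1.ofHol (h.hol j (t + s) trivial) -
      OS1.ofHol (h.hol j t trivial))) = fun s : ℝ => restrict n ((s : ℂ)⁻¹ •
        (Hol.mk (h.hol j (t + s) trivial) - Hol.mk (h.hol j t trivial))) := by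
    ext s
    refine OS1.ext fun z => ?_
    rw [OS1.real_smul_apply, Complex.ofReal_inv]
    rfl
  rw [e]
  refine ((continuous_restrict n).tendsto _).comp ?_
  rw [tendsto_subtype_rng]
  have : LocallyCompactSpace (annulus n) := (isOpen_annulus n).locallyCompactSpace
  rw [ContinuousMap.tendsto_iff_tendstoLocallyUniformly]
  exact tendstoLocallyUniformlyOn_iff_tendstoLocallyUniformly_comp_coe.1
    (h.tendstoLocallyUniformlyOn_slope isOpen_univ (isOpen_annulus n) j trivial)

theorem HolFamily.isSmoothCurve {n : ℕ} {Γ : ℕ → ℝ → ℂ → ℂ}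
    (h : HolFamily Set.univ (annulus n) Γ) {c : ℝ → OS1} (hc : ∀ t (z : Circle), c t z = Γ 0 t z) :
    IsSmoothCurve c :=
  ⟨fun j t => OS1.ofHol (h.hol j t trivial), funext fun t => OS1.ext fun z => (hc t z).symm,
    fun j t => tendsto_slope_ofHol h j t⟩

theorem SmoothFamily.isSmoothCurve {n : ℕ} {G : ℝ → ℂ → ℂ}
    (h : SmoothFamily Set.univ (annulus n) G) {c : ℝ → OS1} (hc : ∀ t (z : Circle), c t z = G t z) :
    IsSmoothCurve c :=
  (h.holFamily isOpen_univ (isOpen_annulus n)).isSmoothCurve hc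

theorem IsSmoothCurve.mem_curves {c : ℝ → OS1} (hc : IsSmoothCurve c) : c ∈ Curves OS1 :=
  fun _ hf => hf c hc

theorem SmoothFamily.mem_curves {n : ℕ} {G : ℝ → ℂ → ℂ}
    (h : SmoothFamily Set.univ (annulus n) G) {c : ℝ → OS1} (hc : ∀ t (z : Circle), c t z = G t z) :
    c ∈ Curves OS1 :=
  (h.isSmoothCurve hc).mem_curves

/-- The Laurent series of a family of coefficients with exponential decay. -/
theorem exists_holFamily_of_coef {a : ℤ → ℝ → ℂ} {q : ℝ} (hq0 : 0 < q) (hq1 : q < 1)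
    (ha : ∀ k, ContDiff ℝ ∞ (a k))
    (hb : ∀ j, ∃ C, ∀ k t, ‖iteratedDeriv j (a k) t‖ ≤ C * q ^ k.natAbs) :
    ∃ n, HolFamily Set.univ (annulus n) fun j t z => ∑' k : ℤ, iteratedDeriv j (a k) t * z ^ k := by
  choose C hC using hb
  have hC0 : ∀ j, 0 ≤ C j := fun j => by simpa using (norm_nonneg _).trans (hC j 0 0)
  -- Half of the exponential rate pays for `|z ^ k| ≤ r⁻¹ ^ |k|` on the annulus; the other half, `q
  -- r⁻¹ = r`, remains for summability.
  set r := √q with hr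
  have hr0 : 0 < r := Real.sqrt_pos.2 hq0
  have hr1 : r < 1 := by rw [hr, Real.sqrt_lt' one_pos]; simpa using hq1
  have hrr : r * r = q := Real.mul_self_sqrt hq0.le
  obtain ⟨n, hn⟩ := exists_nat_one_div_lt (sub_pos.2 hr1)
  have hzn : ∀ z ∈ annulus n, 0 < ‖z‖ ∧ ‖z‖ ≤ r⁻¹ ∧ ‖z‖⁻¹ ≤ r⁻¹ := by
    intro z hz
    have h1 : r < ‖z‖ := by linarith [hz.1]
    refine ⟨hr0.trans h1, ?_, inv_anti₀ hr0 h1.le⟩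
    have h2 : ‖z‖ ≤ 1 + (1 - r) := by linarith [hz.2]
    refine h2.trans ?_
    rw [← sub_nonneg]
    have : r⁻¹ - (1 + (1 - r)) = (1 - r) ^ 2 * r⁻¹ := by field_simp; ring
    rw [this]; positivity
  have hz0 : ∀ z ∈ annulus n, z ≠ 0 := fun z hz => norm_pos_iff.1 (hzn z hz).1
  have hpow : ∀ z ∈ annulus n, ∀ k : ℤ, ‖z ^ k‖ ≤ r⁻¹ ^ k.natAbs := by
    intro z hz k
    obtain ⟨h0, h1, h2⟩ := hzn z hz
    rw [norm_zpow]
    rcases Int.natAbs_eq k with hk | hk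
    · conv_lhs => rw [hk]
      rw [zpow_natCast]
      exact pow_le_pow_left₀ h0.le h1 _
    · conv_lhs => rw [hk]
      rw [zpow_neg, zpow_natCast, ← inv_pow]
      exact pow_le_pow_left₀ (by positivity) h2 _
  have hterm : ∀ j k t, ∀ z ∈ annulus n,
      ‖iteratedDeriv j (a k) t * z ^ k‖ ≤ C j * r ^ k.natAbs := by
    intro j k t z hz
    rw [norm_mul]
    calc _ ≤ C j * q ^ k.natAbs * r⁻¹ ^ k.natAbs := by
          have := hC0 j
          gcongr
          exacts [hC j k t, hpow z hz k]
      _ = C j * r ^ k.natAbs := by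
          rw [mul_assoc, ← mul_pow, ← hrr, mul_inv_cancel_right₀ hr0.ne']
  have hsum : ∀ j, Summable fun k : ℤ => C j * r ^ k.natAbs := fun j =>
    (summable_pow_natAbs hr0.le hr1).mul_left _
  refine ⟨n, fun j t _ => ?_, fun j t _ z hz => ?_, fun j => ?_⟩
  · exact Complex.differentiableOn_tsum_of_summable_norm (hsum j) (fun k => DifferentiableOn.const_mul
      (fun z hz => (differentiableAt_zpow.2 (Or.inl (hz0 z hz))).differentiableWithinAt) _)
      (isOpen_annulus n) fun k z hz => hterm j k t z hz
  · exact hasDerivAt_tsum (hsum (j + 1)) (fun k y =>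
      (hasDerivAt_iteratedDeriv_of_contDiff (ha k) j y).mul_const (z ^ k))
      (fun k y => hterm (j + 1) k y z hz)
      (Summable.of_norm_bounded (hsum j) fun k => hterm j k t z hz) t
  · refine continuousOn_tsum (fun k => ContinuousOn.mul ?_ ?_) (hsum j)
      fun k p hp => hterm j k p.1 p.2 hp.2
    · exact (((ha k).continuous_iteratedDeriv j (mod_cast le_top)).comp
        continuous_fst).continuousOn
    · exact continuousOn_snd.zpow₀ k fun p hp => Or.inl (hz0 p.2 hp.2)

/-- Locally in time, scalarwise smooth curves are given by smooth families of holomorphic functions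
on a fixed annulus. -/
theorem ScalarSmooth.exists_smoothFamily {γ : ℝ → OS1} (hγ : ScalarSmooth γ) (t₀ : ℝ) :
    ∃ n G, SmoothFamily Set.univ (annulus n) G ∧
      ∀ t, |t - t₀| ≤ 1 → ∀ z : Circle, γ t z = G t z := by
  obtain ⟨a, q, hq0, hq1, ha, hb, hc⟩ := hγ.exists_coef_family t₀
  obtain ⟨n, hn⟩ := exists_holFamily_of_coef hq0 hq1 ha hb
  refine ⟨n, _, hn.smoothFamily isOpen_univ (isOpen_annulus n), fun t ht z => ?_⟩
  rw [← (hasSum_coef (γ t) z).tsum_eq]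
  exact tsum_congr fun k => by rw [iteratedDeriv_zero, hc t ht k]

theorem mem_curves_of_local {X : Type*} [FrolicherSpace X] {γ : ℝ → X}
    (h : ∀ t₀, ∃ c ∈ Curves X, c =ᶠ[𝓝 t₀] γ) : γ ∈ Curves X := by
  refine (FrolicherSpace.mem_curves_iff _).2 fun f hf => contDiff_iff_contDiffAt.2 fun t₀ => ?_
  obtain ⟨c, hc, he⟩ := h t₀
  refine ((FrolicherSpace.mem_curves_iff _).1 hc f hf).contDiffAt.congr_of_eventuallyEq ?_
  filter_upwards [he] with t ht
  simp [ht]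

theorem eventually_abs_sub_le (t₀ : ℝ) : ∀ᶠ t in 𝓝 t₀, |t - t₀| ≤ 1 := by
  filter_upwards [Metric.closedBall_mem_nhds t₀ one_pos] with t ht
  rwa [Metric.mem_closedBall, Real.dist_eq] at ht

theorem ScalarSmooth.mem_curves {γ : ℝ → OS1} (hγ : ScalarSmooth γ) : γ ∈ Curves OS1 := by
  refine mem_curves_of_local fun t₀ => ?_
  obtain ⟨n, G, hG, h⟩ := hγ.exists_smoothFamily t₀
  refine ⟨fun t => OS1.ofHol (hG.hol t trivial), hG.mem_curves fun _ _ => rfl, ?_⟩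
  filter_upwards [eventually_abs_sub_le t₀] with t ht
  exact OS1.ext fun z => (h t ht z).symm

/-- The Frölicher structure was generated by curves and might have acquired more; this criterion
settles which curves are smooth and replaces topological arguments from here on. -/
theorem mem_curves_OS1_iff {γ : ℝ → OS1} : γ ∈ Curves OS1 ↔ ScalarSmooth γ :=
  ⟨scalarSmooth_of_mem_curves, ScalarSmooth.mem_curves⟩

/-! ## Holomorphic functions close to the identity -/

/-- The annulus `1 - a < |z| < 1 + a`. -/
def Ann (a : ℝ) : Set ℂ := {z | 1 - a < ‖z‖ ∧ ‖z‖ < 1 + a}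

theorem isOpen_Ann (a : ℝ) : IsOpen (Ann a) :=
  (isOpen_lt continuous_const continuous_norm).inter (isOpen_lt continuous_norm continuous_const)

theorem Ann_mono {a b : ℝ} (h : a ≤ b) : Ann a ⊆ Ann b := fun _ hz =>
  ⟨by linarith [hz.1], by linarith [hz.2]⟩

theorem coe_mem_Ann {a : ℝ} (ha : 0 < a) (z : Circle) : (z : ℂ) ∈ Ann a := by
  constructor <;> rw [Circle.norm_coe] <;> linarith

theorem exists_annulus_subset {a : ℝ} (ha : 0 < a) : ∃ n, annulus n ⊆ Ann a := by
  obtain ⟨n, hn⟩ := exists_nat_one_div_lt ha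
  exact ⟨n, Ann_mono hn.le⟩

theorem mem_Ann_of_near {a ε : ℝ} {z w : ℂ} (hz : z ∈ Ann a) (h : ‖w - z‖ ≤ ε) :
    w ∈ Ann (a + ε) := by
  have h1 := norm_sub_norm_le w z
  have h2 := norm_sub_norm_le z w
  rw [norm_sub_rev] at h2
  exact ⟨by linarith [hz.1], by linarith [hz.2]⟩

/-- The closed annulus. -/
def closedAnn (a : ℝ) : Set ℂ := {z | 1 - a ≤ ‖z‖ ∧ ‖z‖ ≤ 1 + a}

theorem isCompact_closedAnn (a : ℝ) : IsCompact (closedAnn a) := by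
  refine (isCompact_closedBall (0 : ℂ) (1 + a)).of_isClosed_subset
    ((isClosed_le continuous_const continuous_norm).inter
      (isClosed_le continuous_norm continuous_const)) fun z hz => ?_
  simpa using hz.2

theorem Ann_subset_closedAnn (a : ℝ) : Ann a ⊆ closedAnn a := fun _ hz => ⟨hz.1.le, hz.2.le⟩

theorem closedAnn_subset_Ann {a b : ℝ} (h : a < b) : closedAnn a ⊆ Ann b := fun _ hz =>
  ⟨by linarith [hz.1], by linarith [hz.2]⟩

/-- `F` is holomorphic on the annulus of half-width `a` and differs from the identity by at most
`ε`, which is small compared to `a`. -/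
structure NearId (a ε : ℝ) (F : ℂ → ℂ) : Prop where
  pos : 0 < a
  le_one : a ≤ 1
  nonneg : 0 ≤ ε
  small : 64 * ε ≤ a
  hol : DifferentiableOn ℂ F (Ann a)
  near : ∀ z ∈ Ann a, ‖F z - z‖ ≤ ε

namespace NearId

variable {a ε : ℝ} {F : ℂ → ℂ}

/-- `F - id` is a contraction on the half annulus. -/
theorem lipschitz (h : NearId a ε F) {z w : ℂ} (hz : z ∈ Ann (a / 2)) (hw : w ∈ Ann (a / 2)) :
    ‖(F z - z) - (F w - w)‖ ≤ ‖z - w‖ / 16 := by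
  have ha := h.pos
  have hball : Metric.ball w (a / 2) ⊆ Ann a := fun y hy => by
    have := mem_Ann_of_near hw (mem_ball_iff_norm.1 hy).le
    rwa [add_halves] at this
  have hbd : ∀ y ∈ Ann a, ‖(F y - y) - (F w - w)‖ ≤ 2 * ε := fun y hy =>
    (norm_sub_le _ _).trans (by
      linarith [h.near y hy, h.near w (Ann_mono (by linarith) hw)])
  have hs := h.small
  by_cases hzw : z ∈ Metric.ball w (a / 2)
  · have := Complex.dist_le_div_mul_dist_of_mapsTo_ball (f := fun y => F y - y) (c := w)
      (R₁ := a / 2) (R₂ := 2 * ε) ((h.hol.sub differentiableOn_id).mono hball)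
      (fun y hy => by
        rw [mem_closedBall_iff_norm]
        exact hbd y (hball hy)) hzw
    rw [dist_eq_norm, dist_eq_norm] at this
    refine this.trans ?_
    have h1 : 2 * ε / (a / 2) ≤ 1 / 16 := by
      rw [div_le_div_iff₀ (by positivity) (by positivity)]; linarith
    calc _ ≤ 1 / 16 * ‖z - w‖ := by gcongr
      _ = _ := by ring
  · rw [mem_ball_iff_norm, not_lt] at hzw
    have := hbd z (Ann_mono (by linarith) hz)
    linarith

theorem injOn (h : NearId a ε F) : Set.InjOn F (Ann (a / 2)) := by
  intro z hz w hw e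
  have := h.lipschitz hz hw
  rw [e, show F w - z - (F w - w) = -(z - w) by ring, norm_neg] at this
  have h0 : ‖z - w‖ ≤ 0 := by linarith
  exact sub_eq_zero.1 (norm_le_zero_iff.1 h0)

theorem mapsTo (h : NearId a ε F) {b : ℝ} (hb : b ≤ a) : Set.MapsTo F (Ann b) (Ann (b + ε)) :=
  fun z hz => mem_Ann_of_near hz (h.near z (Ann_mono hb hz))

theorem ne_zero (h : NearId a ε F) {z : ℂ} (hz : z ∈ Ann (a / 2)) : F z ≠ 0 := by
  have h1 := (h.mapsTo (by linarith [h.pos]) hz).1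
  intro e
  rw [e, norm_zero] at h1
  linarith [h.pos, h.small, h.le_one]

theorem norm_circle (h : NearId a ε F) (z : Circle) : ‖F z / z - 1‖ < 1 := by
  have hz := Circle.coe_ne_zero z
  have : F z / z - 1 = (F z - z) / z := by field_simp
  rw [this, norm_div, Circle.norm_coe, div_one]
  linarith [h.near z (coe_mem_Ann h.pos z), h.small, h.le_one]

/-- Since `F z / z` stays within distance less than `1` of `1`, it has a continuous principal
logarithm. Adding that logarithm to `iθ` gives the lift of winding number one. -/
theorem isDeformation (h : NearId a ε F) {f : OS1} (hf : ∀ z : Circle, f z = F z) :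
    Function.Injective (f : Circle → ℂ) ∧ (∀ z, f z ≠ 0) ∧ HasWindingNumber f 1 := by
  have ha := h.pos
  have hc : ∀ z : Circle, (z : ℂ) ∈ Ann (a / 2) := coe_mem_Ann (by linarith)
  refine ⟨fun z w e => ?_, fun z => ?_, ?_⟩
  · rw [hf, hf] at e
    exact Circle.ext (h.injOn (hc z) (hc w) e)
  · rw [hf]; exact h.ne_zero (hc z)
  · have hs : ∀ z : Circle, F z / z ∈ Complex.slitPlane := fun z => by
      simpa using Complex.mem_slitPlane_of_norm_lt_one (h.norm_circle z)
    have hcont : Continuous fun z : Circle => F z / z := by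
      simp_rw [← hf]
      exact f.continuous.div continuous_subtype_val Circle.coe_ne_zero
    refine ⟨fun θ => θ * Complex.I + Complex.log (F (Circle.exp θ) / Circle.exp θ), ?_, ?_, ?_⟩
    · refine (by fun_prop : Continuous fun θ : ℝ => (θ : ℂ) * Complex.I).add ?_
      exact (hcont.comp Circle.exp.continuous).clog fun θ => hs _
    · intro θ
      rw [Complex.exp_add, Complex.exp_log (div_ne_zero (h.ne_zero (hc _)) (Circle.coe_ne_zero _)),
        ← Circle.coe_exp, hf, mul_div_cancel₀ _ (Circle.coe_ne_zero _)]
    · intro θ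
      have := Circle.exp_add_two_pi θ
      simp only [this]
      push_cast
      ring

end NearId

/-- The deformation `φ` if `φ` is one, and the identity otherwise. -/
def DefC.ofOS1 (f : OS1) : DefC :=
  open Classical in
  if h : Function.Injective (f : Circle → ℂ) ∧ (∀ z, f z ≠ 0) ∧ HasWindingNumber f 1 then ⟨f, h⟩
  else DefC.id

theorem NearId.coe_ofOS1 {a ε : ℝ} {F : ℂ → ℂ} (h : NearId a ε F) {f : OS1}
    (hf : ∀ z : Circle, f z = F z) : (DefC.ofOS1 f).1 = f := by
  exact congrArg Subtype.val (dif_pos (h.isDeformation hf))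

theorem DefC.ofOS1_coe (φ : DefC) : DefC.ofOS1 φ.1 = φ :=
  dif_pos φ.2

theorem DefC.ext {φ ψ : DefC} (h : ∀ z : Circle, φ z = ψ z) : φ = ψ :=
  Subtype.ext (OS1.ext h)

theorem DefC.id_apply (z : Circle) : DefC.id z = z := rfl

/-- A smooth cutoff of the identity of `ℝ` with small values. -/
theorem exists_cutoff {δ : ℝ} (hδ : 0 < δ) :
    ∃ ρ : ℝ → ℝ, ContDiff ℝ ∞ ρ ∧ (∀ᶠ t in 𝓝 0, ρ t = t) ∧ ∀ t, |ρ t| < δ := by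
  let b : ContDiffBump (0 : ℝ) := ⟨δ / 2, δ, by positivity, by linarith⟩
  refine ⟨fun t => b t * t, b.contDiff.mul contDiff_id, ?_, fun t => ?_⟩
  · filter_upwards [b.eventuallyEq_one] with t ht
    rw [ht]; simp
  · by_cases ht : |t| < δ
    · rw [abs_mul, abs_of_nonneg b.nonneg]
      exact (mul_le_of_le_one_left (abs_nonneg t) b.le_one).trans_lt ht
    · have : b t = 0 := b.zero_of_le_dist (by simpa [Real.dist_eq] using not_lt.1 ht)
      simpa [this] using hδ

theorem cutoff_zero {ρ : ℝ → ℝ} (h : ∀ᶠ t in 𝓝 0, ρ t = t) : ρ 0 = 0 := h.self_of_nhds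

/-- Hadamard's lemma. -/
theorem exists_hadamard {φ : ℝ → ℂ} (hφ : ContDiff ℝ ∞ φ) :
    ∃ ψ : ℝ → ℂ, ContDiff ℝ ∞ ψ ∧ ∀ t, φ t = φ 0 + t * ψ t := by
  -- The quotient is `∫₀¹ φ'(s t) ds`, and `d m` is its `m`-th derivative, obtained by
  -- differentiating under the integral.
  let d : ℕ → ℝ → ℂ := fun m t => ∫ s in (0 : ℝ)..1, (s : ℂ) ^ m * iteratedDeriv (m + 1) φ (s * t)
  have hc : ∀ m, Continuous (iteratedDeriv m φ) := fun m =>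
    hφ.continuous_iteratedDeriv m (mod_cast le_top)
  have hd : ∀ m t, HasDerivAt (d m) (d (m + 1) t) t := by
    intro m t
    obtain ⟨C, hC⟩ := ((isCompact_Icc (a := (0 : ℝ)) (b := 1)).prod
      (isCompact_closedBall t 1)).exists_bound_of_continuousOn
      (f := fun p : ℝ × ℝ => (p.1 : ℂ) ^ (m + 1) * iteratedDeriv (m + 2) φ (p.1 * p.2))
      (by have := hc (m + 2); fun_prop)
    refine (intervalIntegral.hasDerivAt_integral_of_dominated_loc_of_deriv_le
      (F := fun t s => (s : ℂ) ^ m * iteratedDeriv (m + 1) φ (s * t))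
      (F' := fun t s => (s : ℂ) ^ (m + 1) * iteratedDeriv (m + 2) φ (s * t))
      (bound := fun _ => C) (Metric.closedBall_mem_nhds t one_pos) ?_ ?_ ?_ ?_ ?_ ?_).2
    · refine Eventually.of_forall fun y => Continuous.aestronglyMeasurable ?_
      have := hc (m + 1); fun_prop
    · refine Continuous.intervalIntegrable ?_ _ _
      have := hc (m + 1); fun_prop
    · refine Continuous.aestronglyMeasurable ?_
      have := hc (m + 2); fun_prop
    · refine Eventually.of_forall fun s hs y hy => ?_
      rw [Set.uIoc_of_le zero_le_one] at hs
      exact hC (s, y) ⟨⟨hs.1.le, hs.2⟩, hy⟩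
    · exact intervalIntegrable_const
    · refine Eventually.of_forall fun s hs y hy => ?_
      have h1 := hasDerivAt_iteratedDeriv_of_contDiff hφ (m + 1) (s * y)
      have h2 := (h1.scomp y ((hasDerivAt_id y).const_mul s)).const_mul ((s : ℂ) ^ m)
      refine h2.congr_deriv ?_
      simp only [mul_one, Complex.real_smul]
      ring
  refine ⟨d 0, contDiff_of_hasDerivAt_seq hd, fun t => ?_⟩
  have h1 : ∀ s ∈ Set.uIcc (0 : ℝ) 1, HasDerivAt (fun s : ℝ => φ (s * t))
      ((t : ℂ) * ((s : ℂ) ^ 0 * iteratedDeriv (0 + 1) φ (s * t))) s := by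
    intro s _
    have h1 := hasDerivAt_iteratedDeriv_of_contDiff hφ 0 (s * t)
    rw [iteratedDeriv_zero] at h1
    have h2 := h1.scomp s ((hasDerivAt_id s).mul_const t)
    refine h2.congr_deriv ?_
    simp
  have h2 := intervalIntegral.integral_eq_sub_of_hasDerivAt h1 (by
    refine Continuous.intervalIntegrable ?_ _ _
    have := hc (0 + 1); fun_prop)
  rw [intervalIntegral.integral_const_mul] at h2
  simp only [one_mul, zero_mul] at h2
  change φ t = φ 0 + t * ∫ s in (0 : ℝ)..1, (s : ℂ) ^ 0 * iteratedDeriv (0 + 1) φ (s * t)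
  rw [h2]; ring

/-- Hadamard's lemma for smooth curves in `𝒪(S¹)`. -/
theorem exists_hadamard_curve {γ : ℝ → OS1} (hγ : γ ∈ Curves OS1) :
    ∃ g ∈ Curves OS1, ∀ t, γ t = γ 0 + t • g t := by
  have hs := scalarSmooth_of_mem_curves hγ
  obtain ⟨n, G, hG, hγG⟩ := hs.exists_smoothFamily 0
  have hH := hG.holFamily isOpen_univ (isOpen_annulus n)
  set v : OS1 := OS1.ofHol (hH.hol 1 0 trivial) with hv
  let g : ℝ → OS1 := fun t => if t = 0 then v else t⁻¹ • (γ t - γ 0)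
  have hg : ∀ t, γ t = γ 0 + t • g t := by
    intro t
    by_cases ht : t = 0
    · simp [ht]
    · simp [g, ht]
  -- Each functional reduces the claim to the scalar Hadamard lemma. At `t = 0` the two values agree
  -- because both are limits of the same difference quotients.
  refine ⟨g, mem_curves_OS1_iff.2 fun ℓ hℓ => ?_, hg⟩
  obtain ⟨ψ, hψ, hψt⟩ := exists_hadamard (hs ℓ hℓ)
  have hψ0 : ℓ v = ψ 0 := by
    have h1 := (hℓ.continuous.tendsto _).comp (tendsto_slope_ofHol hH 0 0)
    have h2 : Tendsto ψ (𝓝[≠] 0) (𝓝 (ψ 0)) := hψ.continuous.continuousAt.tendsto.mono_left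
      nhdsWithin_le_nhds
    refine tendsto_nhds_unique h1 (h2.congr' ?_)
    filter_upwards [eventually_mem_nhdsWithin, eventually_nhdsWithin_of_eventually_nhds
      (eventually_abs_sub_le 0)] with t ht0 ht
    have e1 : OS1.ofHol (hH.hol 0 (0 + t) trivial) = γ t := OS1.ext fun z => by
      rw [hγG t ht z, OS1.ofHol_apply, zero_add]; rfl
    have e2 : OS1.ofHol (hH.hol 0 0 trivial) = γ 0 := OS1.ext fun z => by
      rw [hγG 0 (by simp) z, OS1.ofHol_apply]; rfl
    have ht' : (t : ℂ) ≠ 0 := Complex.ofReal_ne_zero.2 ht0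
    have e3 : t⁻¹ • (γ t - γ 0) = ((t⁻¹ : ℝ) : ℂ) • (γ t - γ 0) := OS1.ext fun z => by
      rw [OS1.real_smul_apply, OS1.smul_apply]
    simp only [Function.comp]
    rw [e1, e2, e3, map_smul, map_sub, hψt t, smul_eq_mul, Complex.ofReal_inv]
    field_simp
    ring
  have : (fun t => ℓ (g t)) = ψ := by
    funext t
    by_cases ht : t = 0
    · simp [g, ht, hψ0]
    · have ht' : (t : ℂ) ≠ 0 := Complex.ofReal_ne_zero.2 ht
      have e3 : t • g t = (t : ℂ) • g t := OS1.ext fun z => by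
        rw [OS1.real_smul_apply, OS1.smul_apply]
      have := congrArg ℓ (hg t)
      rw [map_add, e3, map_smul, hψt t, smul_eq_mul] at this
      exact (mul_left_cancel₀ ht' (add_left_cancel this)).symm
  rw [this]
  exact hψ

/-! ## The tangent space of the complex deformations -/

theorem comp_coe_mem_functions {f : OS1 → ℝ} (hf : f ∈ Functions OS1) :
    (fun φ : DefC => f φ.1) ∈ Functions DefC := fun _ hγ =>
  (FrolicherSpace.mem_curves_iff _).1 hγ f hf

theorem mem_curves_DefC_iff {γ : ℝ → DefC} :
    γ ∈ Curves DefC ↔ (fun t => (γ t).1) ∈ Curves OS1 :=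
  ⟨fun h => (FrolicherSpace.mem_curves_iff _).2 fun _ hf =>
    (FrolicherSpace.mem_curves_iff _).1 h _ (comp_coe_mem_functions hf),
    FrolicherSpace.mem_curves_induced⟩

theorem curves_comp {X : Type*} [FrolicherSpace X] {γ : ℝ → X} (hγ : γ ∈ Curves X) {ρ : ℝ → ℝ}
    (hρ : ContDiff ℝ ∞ ρ) : (fun t => γ (ρ t)) ∈ Curves X :=
  (FrolicherSpace.mem_curves_iff _).2 fun f hf =>
    ((FrolicherSpace.mem_curves_iff _).1 hγ f hf).comp hρ

theorem curves_const {X : Type*} [FrolicherSpace X] (x : X) : (fun _ : ℝ => x) ∈ Curves X :=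
  (FrolicherSpace.mem_curves_iff _).2 fun _ _ => contDiff_const

theorem map_real_smul (ℓ : OS1 →ₗ[ℂ] ℂ) (r : ℝ) (f : OS1) : ℓ (r • f) = r * ℓ f := by
  have : r • f = (r : ℂ) • f := OS1.ext fun z => by
    rw [OS1.real_smul_apply, OS1.smul_apply]
  rw [this, map_smul, smul_eq_mul]

theorem curves_smul {r : ℝ → ℝ} (hr : ContDiff ℝ ∞ r) {a : ℝ → OS1} (ha : a ∈ Curves OS1) :
    (fun t => r t • a t) ∈ Curves OS1 := mem_curves_OS1_iff.2 fun ℓ hℓ => by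
  simp_rw [map_real_smul]
  exact (Complex.ofRealCLM.contDiff.comp hr).mul (scalarSmooth_of_mem_curves ha ℓ hℓ)

theorem curves_add {a b : ℝ → OS1} (ha : a ∈ Curves OS1) (hb : b ∈ Curves OS1) :
    (fun t => a t + b t) ∈ Curves OS1 := mem_curves_OS1_iff.2 fun ℓ hℓ => by
  simp_rw [map_add]
  exact (scalarSmooth_of_mem_curves ha ℓ hℓ).add (scalarSmooth_of_mem_curves hb ℓ hℓ)

/-- Small multiples of `u`, added to the identity, as deformations. -/
def DefC.near (u : OS1) : DefC := DefC.ofOS1 (DefC.id.1 + u)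

theorem DefC.near_zero : DefC.near 0 = DefC.id := by
  rw [DefC.near, add_zero, DefC.ofOS1_coe]

/-- For `s` near `s₀` the functions `a s` are bounded on a common annulus, so `id + t a(s)` is a
deformation for all `|t|` below a bound independent of `s`. -/
theorem exists_near_bound {a : ℝ → OS1} (ha : a ∈ Curves OS1) (s₀ : ℝ) : ∃ δ : ℝ, 0 < δ ∧ ∀ s t : ℝ,
    |s - s₀| ≤ 1 → |t| < δ → (DefC.near (t • a s)).1 = DefC.id.1 + t • a s := by
  obtain ⟨n, G, hG, haG⟩ := (scalarSmooth_of_mem_curves ha).exists_smoothFamily s₀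
  have hn : (0 : ℝ) < 1 / ((n : ℝ) + 1) := by positivity
  have hn1 : 1 / ((n : ℝ) + 1) ≤ 1 := by
    rw [div_le_one (by positivity)]; linarith [(Nat.cast_nonneg n : (0 : ℝ) ≤ n)]
  set b : ℝ := 1 / ((n : ℝ) + 1) / 2 with hb
  have hb0 : 0 < b := by positivity
  have hsub : closedAnn b ⊆ annulus n := closedAnn_subset_Ann (b := 1 / ((n : ℝ) + 1)) (by
    linarith)
  obtain ⟨C, hC⟩ := ((isCompact_closedBall s₀ 1).prod
    (isCompact_closedAnn b)).exists_bound_of_continuousOn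
    (hG.smooth.continuousOn.mono (Set.prod_mono (Set.subset_univ _) hsub))
  have hC' : 0 < max C 1 := lt_of_lt_of_le one_pos (le_max_right _ _)
  refine ⟨b / (64 * max C 1), by positivity, fun s t hs ht => ?_⟩
  have hN : NearId b (|t| * max C 1) fun z => z + t * G s z := by
    refine ⟨hb0, by linarith, by positivity, ?_, ?_, fun z hz => ?_⟩
    · rw [lt_div_iff₀ (by positivity)] at ht
      linarith
    · exact differentiableOn_id.add (((hG.hol s trivial).mono
        ((Ann_subset_closedAnn b).trans hsub)).const_mul _)
    · rw [add_sub_cancel_left, norm_mul, Complex.norm_real, Real.norm_eq_abs]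
      gcongr
      exact (hC (s, z) ⟨by simpa [Real.dist_eq] using hs, Ann_subset_closedAnn b hz⟩).trans
        (le_max_left _ _)
  exact hN.coe_ofOS1 fun z => by
    rw [OS1.add_apply, OS1.real_smul_apply, haG s hs]; rfl

theorem near_mem_curves {a : ℝ → OS1} (ha : a ∈ Curves OS1) {s₀ δ : ℝ} (hδ : ∀ s t : ℝ,
    |s - s₀| ≤ 1 → |t| < δ → (DefC.near (t • a s)).1 = DefC.id.1 + t • a s) {α β : ℝ → ℝ}
    (hα : ContDiff ℝ ∞ α) (hβ : ContDiff ℝ ∞ β) (hα1 : ∀ τ, |α τ - s₀| ≤ 1)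
    (hβδ : ∀ τ, |β τ| < δ) : (fun τ => DefC.near (β τ • a (α τ))) ∈ Curves DefC := by
  rw [mem_curves_DefC_iff]
  simp_rw [fun τ => hδ (α τ) (β τ) (hα1 τ) (hβδ τ)]
  exact curves_add (curves_const _) (curves_smul hβ (curves_comp ha hα))

/-- Smooth functions on `DefC` are smooth in two parameters, near the identity. -/
theorem exists_contDiff_near {a : ℝ → OS1} (ha : a ∈ Curves OS1) {f : DefC → ℝ}
    (hf : f ∈ Functions DefC) (s₀ : ℝ) : ∃ F : ℝ × ℝ → ℝ, ContDiff ℝ ∞ F ∧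
      ∀ᶠ s in 𝓝 s₀, ∀ᶠ t in 𝓝 0, f (DefC.near (t • a s)) = F (s, t) ∧
        f (DefC.near (t • a (s₀ + t))) = F (s₀ + t, t) := by
  obtain ⟨δ, hδ, h⟩ := exists_near_bound ha s₀
  obtain ⟨ρ, hρ, hρ0, hρδ⟩ := exists_cutoff hδ
  obtain ⟨χ, hχ, hχ0, hχ1⟩ := exists_cutoff one_pos
  -- Cutting off both parameters keeps the argument in the region of genuine deformations for all
  -- real parameters, so that Boman's theorem applies globally.
  refine ⟨fun p => f (DefC.near (ρ p.2 • a (s₀ + χ (p.1 - s₀)))), ?_, ?_⟩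
  · refine contDiff_of_comp_curves fun α β hα hβ => ?_
    exact (FrolicherSpace.mem_functions_iff f).1 hf _ (near_mem_curves ha h
      (α := fun τ => s₀ + χ (α τ - s₀)) (β := fun τ => ρ (β τ))
      (contDiff_const.add (hχ.comp (hα.sub contDiff_const))) (hρ.comp hβ)
      (fun τ => by simpa using (hχ1 _).le) fun τ => hρδ _)
  · have ht : Tendsto (fun s => s - s₀) (𝓝 s₀) (𝓝 0) := by
      simpa using (continuous_id.sub continuous_const).tendsto s₀ (f := fun s => s - s₀)
    filter_upwards [ht.eventually hχ0] with s hs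
    filter_upwards [hρ0, hχ0] with t h1 h2
    simp [hs, h1, h2]

/-- The curve `id + t v`, cut off for large `t`. -/
theorem exists_near_curve (v : OS1) : ∃ γ : RootedCurve DefC.id,
    ∀ᶠ t in 𝓝 0, γ.1 t = DefC.near (t • v) ∧ (γ.1 t).1 = DefC.id.1 + t • v := by
  obtain ⟨δ, hδ, h⟩ := exists_near_bound (curves_const v) 0
  obtain ⟨ρ, hρ, hρ0, hρδ⟩ := exists_cutoff hδ
  refine ⟨⟨fun t => DefC.near (ρ t • v), near_mem_curves (curves_const v) h (α := fun _ => 0)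
    contDiff_const hρ (by simp) hρδ, ?_⟩, ?_⟩
  · change DefC.near (ρ 0 • v) = _
    rw [cutoff_zero hρ0, zero_smul, DefC.near_zero]
  · filter_upwards [hρ0] with t ht
    have := h 0 (ρ t) (by simp) (hρδ t)
    rw [ht] at this
    change DefC.near (ρ t • v) = _ ∧ (DefC.near (ρ t • v)).1 = _
    rw [ht]
    exact ⟨rfl, this⟩

/-- The tangent vector at the identity with velocity `v`. -/
def tangentOf (v : OS1) : Tangent DefC.id := Tangent.mk (exists_near_curve v).choose

theorem act_tangentOf (f : Functions DefC) (v : OS1) :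
    Tangent.act f (tangentOf v) = deriv (fun t : ℝ => f.1 (DefC.near (t • v))) 0 := by
  refine EventuallyEq.deriv_eq ?_
  filter_upwards [(exists_near_curve v).choose_spec] with t ht
  exact congrArg f.1 ht.1

theorem hasDerivAt_snd {F : ℝ × ℝ → ℝ} (hF : ContDiff ℝ ∞ F) (s t : ℝ) :
    HasDerivAt (fun t => F (s, t)) (fderiv ℝ F (s, t) (0, 1)) t :=
  ((hF.differentiable (by simp)) (s, t)).hasFDerivAt.comp_hasDerivAt t
    ((hasDerivAt_const t s).prodMk (hasDerivAt_id t))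

/-- A function of two variables that is constant on `t = 0` has the same derivative along the
diagonal as along `s = 0`. -/
theorem deriv_diagonal {F : ℝ × ℝ → ℝ} (hF : ContDiff ℝ ∞ F) {k : ℝ}
    (h0 : ∀ᶠ s in 𝓝 0, F (s, 0) = k) :
    deriv (fun t => F (t, t)) 0 = deriv (fun t => F (0, t)) 0 := by
  have hd := ((hF.differentiable (by simp)) (0, 0)).hasFDerivAt
  have h1 := HasFDerivAt.comp_hasDerivAt (f := fun t : ℝ => (t, t)) (0 : ℝ) hd ((hasDerivAt_id (0 : ℝ)).prodMk (hasDerivAt_id (0 : ℝ)))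
  have h2 := HasFDerivAt.comp_hasDerivAt (f := fun t : ℝ => (t, (0 : ℝ))) (0 : ℝ) hd ((hasDerivAt_id (0 : ℝ)).prodMk (hasDerivAt_const 0 0))
  have h3 : HasDerivAt (fun s : ℝ => F (s, 0)) 0 0 :=
    (hasDerivAt_const (0 : ℝ) k).congr_of_eventuallyEq h0
  have h4 := h2.unique h3
  have h5 : ((1 : ℝ), (1 : ℝ)) = (1, 0) + (0, 1) := by simp
  rw [h5, map_add, h4, zero_add] at h1
  exact h1.deriv.trans (hasDerivAt_snd hF 0 0).deriv.symm

/-- The action is the `t`-derivative at `t = 0` of the jointly smooth function `f(id + t a(s))`. -/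
theorem act_tangentOf_contDiff (f : Functions DefC) {a : ℝ → OS1} (ha : a ∈ Curves OS1) :
    ContDiff ℝ ∞ fun s => Tangent.act f (tangentOf (a s)) := by
  rw [contDiff_iff_contDiffAt]
  intro s₀
  obtain ⟨F, hF, h⟩ := exists_contDiff_near ha f.2 s₀
  have h1 : ContDiff ℝ ∞ fun s : ℝ => fderiv ℝ F (s, 0) (0, 1) :=
    ((hF.fderiv_right (m := ∞) (by simp)).comp (contDiff_id.prodMk contDiff_const)).clm_apply
      contDiff_const
  refine h1.contDiffAt.congr_of_eventuallyEq ?_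
  filter_upwards [h] with s hs
  rw [act_tangentOf, ← (hasDerivAt_snd hF s 0).deriv]
  exact EventuallyEq.deriv_eq (hs.mono fun t ht => ht.1)

/-- The velocity of a rooted curve determines its tangent vector. -/
theorem mk_eq_tangentOf (γ : RootedCurve DefC.id) {g : ℝ → OS1} (hg : g ∈ Curves OS1)
    (hγ : ∀ᶠ t in 𝓝 0, (γ.1 t).1 = DefC.id.1 + t • g t) : Tangent.mk γ = tangentOf (g 0) := by
  refine Tangent.ext fun f => ?_
  rw [act_tangentOf]
  obtain ⟨F, hF, h⟩ := exists_contDiff_near hg f.2 0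
  have h0 := h.self_of_nhds
  -- Along `γ` the function `f` is the diagonal `F(t, t)`, and along `id + t g(0)` it is `F(0, t)`.
  have e1 : deriv (f.1 ∘ γ.1) 0 = deriv (fun t => F (t, t)) 0 := by
    refine EventuallyEq.deriv_eq ?_
    filter_upwards [h0, hγ] with t ht hγt
    have := ht.2
    rw [zero_add, DefC.near, ← hγt, DefC.ofOS1_coe] at this
    exact this
  refine e1.trans ((deriv_diagonal hF (k := f.1 DefC.id) ?_).trans ?_)
  · filter_upwards [h] with s hs
    have := hs.self_of_nhds.1
    rw [zero_smul, DefC.near_zero] at this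
    exact this.symm
  · exact (EventuallyEq.deriv_eq (h0.mono fun t ht => ht.1)).symm

theorem hasDerivAt_apply_of_hadamard {γ g : ℝ → OS1} (hg : g ∈ Curves OS1)
    (h : ∀ᶠ t in 𝓝 0, γ t = γ 0 + t • g t) (z : Circle) :
    HasDerivAt (fun t => γ t z) (g 0 z) 0 := by
  have hc : ContinuousAt (fun t => g t z) 0 :=
    (scalarSmooth_of_mem_curves hg (evalAt z) (isDual_evalAt z)).continuous.continuousAt
  rw [hasDerivAt_iff_tendsto_slope_zero]
  refine (hc.tendsto.mono_left nhdsWithin_le_nhds).congr' ?_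
  filter_upwards [eventually_mem_nhdsWithin, eventually_nhdsWithin_of_eventually_nhds h]
    with t ht0 ht
  have ht' : (t : ℂ) ≠ 0 := Complex.ofReal_ne_zero.2 ht0
  rw [zero_add, ht, OS1.add_apply, OS1.real_smul_apply, add_sub_cancel_left, Complex.real_smul,
    Complex.ofReal_inv, inv_mul_cancel_left₀ ht']

/-- A rooted curve with pointwise velocity `v` represents `tangentOf v`. -/
theorem mk_eq_tangentOf_of_hasDerivAt (γ : RootedCurve DefC.id) {v : OS1}
    (h : ∀ z : Circle, HasDerivAt (fun t => γ.1 t z) (v z) 0) : Tangent.mk γ = tangentOf v := by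
  obtain ⟨g, hg, hγ⟩ := exists_hadamard_curve (mem_curves_DefC_iff.1 γ.2.1)
  have : g 0 = v := OS1.ext fun z =>
    (hasDerivAt_apply_of_hadamard hg (Eventually.of_forall hγ) z).unique (h z)
  rw [← this]
  refine mk_eq_tangentOf γ hg (Eventually.of_forall fun t => ?_)
  have := hγ t
  rwa [γ.2.2] at this

theorem act_coe_tangentOf {f : OS1 →ₗ[ℝ] ℝ} (hf : (f : OS1 → ℝ) ∈ Functions OS1) (v : OS1) :
    Tangent.act ⟨_, comp_coe_mem_functions hf⟩ (tangentOf v) = f v := by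
  have h : HasDerivAt (fun t : ℝ => f DefC.id.1 + t * f v) (f v) 0 := by
    simpa using ((hasDerivAt_id (0 : ℝ)).mul_const (f v)).const_add (f DefC.id.1)
  refine (EventuallyEq.deriv_eq ?_).trans h.deriv
  filter_upwards [(exists_near_curve v).choose_spec] with t ht
  change f ((exists_near_curve v).choose.1 t).1 = _
  rw [ht.2, map_add, map_smul, smul_eq_mul]

/-- The real part of a functional. -/
def reFun (ℓ : OS1 →ₗ[ℂ] ℂ) : OS1 →ₗ[ℝ] ℝ where
  toFun f := (ℓ f).re
  map_add' f g := by simp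
  map_smul' r f := by simp

/-- The imaginary part of a functional. -/
def imFun (ℓ : OS1 →ₗ[ℂ] ℂ) : OS1 →ₗ[ℝ] ℝ where
  toFun f := (ℓ f).im
  map_add' f g := by simp
  map_smul' r f := by simp

/-- Point evaluations are smooth functions that recover the velocity; conversely Hadamard's lemma
supplies a velocity for every rooted curve. -/
theorem tangentOf_bijective : Function.Bijective tangentOf := by
  constructor
  · intro v w h
    refine OS1.ext fun z => Complex.ext ?_ ?_
    · have h1 := act_coe_tangentOf (f := reFun (evalAt z)) (re_mem_functions (isDual_evalAt z)) v
      rw [h, act_coe_tangentOf (re_mem_functions (isDual_evalAt z))] at h1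
      exact h1.symm
    · have h1 := act_coe_tangentOf (f := imFun (evalAt z)) (im_mem_functions (isDual_evalAt z)) v
      rw [h, act_coe_tangentOf (im_mem_functions (isDual_evalAt z))] at h1
      exact h1.symm
  · intro X
    induction X using Quotient.inductionOn with
    | h γ =>
      obtain ⟨g, hg, hγ⟩ := exists_hadamard_curve (mem_curves_DefC_iff.1 γ.2.1)
      refine ⟨g 0, (mk_eq_tangentOf γ hg (Eventually.of_forall fun t => ?_)).symm⟩
      have := hγ t
      rwa [γ.2.2] at this

/-- The tangent space at the identity is the space of analytic vector fields. -/
def tangentEquiv : OS1 ≃ Tangent DefC.id := Equiv.ofBijective _ tangentOf_bijective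

theorem tangentEquiv_apply (v : OS1) : tangentEquiv v = tangentOf v := rfl

theorem mem_curves_tangent {X : Type*} [FrolicherSpace X] {x : X} {c : ℝ → Tangent x}
    (h : ∀ f : Functions X, ContDiff ℝ ∞ fun t => Tangent.act f (c t)) : c ∈ Curves (Tangent x) := by
  refine FrolicherSpace.mem_curves_induced ((FrolicherSpace.mem_curves_ofFunctions _ _).2 ?_)
  rintro g ⟨f, rfl | rfl⟩
  · exact (contDiff_const : ContDiff ℝ ∞ fun _ : ℝ => f.1 x)
  · exact h f

/-- The fibre carries the structure generated by curves, so a function need only be tested on the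
generating ones. -/
theorem mem_functions_tangent {X : Type*} [FrolicherSpace X] {x : X} {k : Tangent x → ℝ}
    (h : ∀ c : ℝ → Tangent x, (∀ f : Functions X, ContDiff ℝ ∞ fun t => Tangent.act f (c t)) →
      ContDiff ℝ ∞ fun t => k (c t)) : k ∈ Functions (Tangent x) := by
  intro c hc
  exact h c fun f => (FrolicherSpace.mem_curves_ofFunctions _ _).1 hc _ ⟨f, Or.inr rfl⟩

theorem act_mem_functions {X : Type*} [FrolicherSpace X] {x : X} (f : Functions X) :
    Tangent.act (x := x) f ∈ Functions (Tangent x) :=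
  mem_functions_tangent fun _ hc => hc f

theorem frSmooth_tangentOf : FrSmooth tangentOf := fun _ ha =>
  mem_curves_tangent fun f => act_tangentOf_contDiff f ha

/-- The real and imaginary parts of a dual functional of the velocity are actions on smooth
functions of `DefC`, hence smooth on the tangent space; such functionals detect smooth curves in
`OS1`. -/
theorem frSmooth_tangentEquiv_symm : FrSmooth tangentEquiv.symm := by
  have key : ∀ f : OS1 →ₗ[ℝ] ℝ, (f : OS1 → ℝ) ∈ Functions OS1 →
      (fun X => f (tangentEquiv.symm X)) ∈ Functions (Tangent DefC.id) := by
    refine fun f hf => mem_functions_tangent fun c hc => ?_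
    have h := hc ⟨_, comp_coe_mem_functions hf⟩
    refine cast (congrArg (ContDiff ℝ ∞) (funext fun t => ?_)) h
    obtain ⟨v, hv⟩ := tangentEquiv.surjective (c t)
    rw [← hv, Equiv.symm_apply_apply, tangentEquiv_apply, act_coe_tangentOf hf]
  intro c hc
  refine mem_curves_OS1_iff.2 fun ℓ hℓ => contDiff_of_re_im ?_ ?_
  · exact (FrolicherSpace.mem_curves_iff _).1 hc _ (key (reFun ℓ) (re_mem_functions hℓ))
  · exact (FrolicherSpace.mem_curves_iff _).1 hc _ (key (imFun ℓ) (im_mem_functions hℓ))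

theorem act_tangentOf_smul (f : Functions DefC) (r : ℝ) (v : OS1) :
    Tangent.act f (tangentOf (r • v)) = r * Tangent.act f (tangentOf v) := by
  rw [act_tangentOf, act_tangentOf]
  have := deriv_comp_mul_left r (fun t : ℝ => f.1 (DefC.near (t • v))) 0
  simpa [smul_smul, mul_comm r] using this

theorem tangentOf_smul (r : ℝ) (v : OS1) : tangentOf (r • v) = (tangentOf v).scale r :=
  Tangent.ext fun f => by rw [act_tangentOf_smul, Tangent.act_scale]

/-- On the plane spanned by `v` and `w` the action is smooth by Boman's theorem and homogeneous of
degree one, so it equals its own differential at `0`, which is linear. -/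
theorem act_tangentOf_add (f : Functions DefC) (v w : OS1) :
    Tangent.act f (tangentOf (v + w)) =
      Tangent.act f (tangentOf v) + Tangent.act f (tangentOf w) := by
  let Φ : ℝ × ℝ → ℝ := fun p => Tangent.act f (tangentOf (p.1 • v + p.2 • w))
  have hΦ : ContDiff ℝ ∞ Φ := contDiff_of_comp_curves fun α β hα hβ =>
    act_tangentOf_contDiff f (curves_add (curves_smul hα (curves_const v))
      (curves_smul hβ (curves_const w)))
  have hh : ∀ (r : ℝ) p, Φ (r • p) = r * Φ p := fun r p => by
    rw [← act_tangentOf_smul]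
    simp only [Φ, Prod.smul_fst, Prod.smul_snd, smul_add, smul_smul, smul_eq_mul]
  have hlin : ∀ p, Φ p = fderiv ℝ Φ 0 p := by
    intro p
    have h1 : HasDerivAt (fun r : ℝ => Φ (r • p)) (fderiv ℝ Φ 0 p) 0 := by
      have h2 : HasDerivAt (fun r : ℝ => r • p) p 0 := by
        simpa using (hasDerivAt_id (0 : ℝ)).smul_const p
      have h3 : HasFDerivAt Φ (fderiv ℝ Φ 0) ((0 : ℝ) • p) := by
        rw [zero_smul]
        exact (hΦ.differentiable (by simp) 0).hasFDerivAt
      exact h3.comp_hasDerivAt 0 h2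
    have h4 : HasDerivAt (fun r : ℝ => Φ (r • p)) (Φ p) 0 := by
      simp_rw [hh]
      simpa using (hasDerivAt_id (0 : ℝ)).mul_const (Φ p)
    exact h4.unique h1
  have e : ((1 : ℝ), (1 : ℝ)) = (1, 0) + (0, 1) := by simp
  have h1 := hlin (1, 1)
  rw [e, map_add, ← hlin, ← hlin, ← e] at h1
  simpa [Φ] using h1

theorem tangentOf_zero : tangentOf 0 = Tangent.zero DefC.id := by
  have h := tangentOf_smul 0 0
  rw [smul_zero] at h
  rw [h]
  exact Tangent.ext fun f => by rw [Tangent.act_scale, Tangent.act_zero, zero_mul]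

/-- A curve of tangent vectors rooted at zero represents its velocity. -/
theorem xi_tangentOf {g : ℝ → OS1} (hg : g ∈ Curves OS1)
    (c : RootedCurve (Tangent.zero DefC.id)) (hc : ∀ t, c.1 t = tangentOf (t • g t)) :
    Tangent.xi DefC.id (tangentOf (g 0)) = Tangent.mk c := by
  refine Tangent.ext fun k => ?_
  let F : ℝ × ℝ → ℝ := fun p => k.1 (tangentOf (p.2 • g p.1))
  have hF : ContDiff ℝ ∞ F := contDiff_of_comp_curves fun α β hα hβ =>
    (FrolicherSpace.mem_functions_iff _).1 k.2 _
      (frSmooth_tangentOf _ (curves_smul hβ (curves_comp hg hα)))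
  have e1 : k.1 ∘ c.1 = fun t => F (t, t) := funext fun t => congrArg k.1 (hc t)
  have e2 : k.1 ∘ (tangentOf (g 0)).ray.1 = fun t => F (0, t) :=
    funext fun t => congrArg k.1 (tangentOf_smul t (g 0)).symm
  change deriv (k.1 ∘ (tangentOf (g 0)).ray.1) 0 = deriv (k.1 ∘ c.1) 0
  rw [e1, e2]
  refine (deriv_diagonal hF (k := k.1 (tangentOf 0)) (Eventually.of_forall fun s => ?_)).symm
  simp [F]

/-- A curve of tangent vectors rooted at zero represents its velocity. -/
theorem xi_eq_mk_of_hasDerivAt (c : RootedCurve (Tangent.zero DefC.id)) {a : ℝ → OS1}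
    (hca : ∀ t, c.1 t = tangentOf (a t)) {v : OS1}
    (h : ∀ z : Circle, HasDerivAt (fun t => a t z) (v z) 0) :
    Tangent.xi DefC.id (tangentOf v) = Tangent.mk c := by
  have ha : a ∈ Curves OS1 := by
    have e : a = tangentEquiv.symm ∘ c.1 := funext fun t => by
      rw [Function.comp, hca, ← tangentEquiv_apply, Equiv.symm_apply_apply]
    rw [e]
    exact frSmooth_tangentEquiv_symm _ c.2.1
  have ha0 : a 0 = 0 := tangentOf_bijective.1 (by rw [← hca, c.2.2, tangentOf_zero])
  obtain ⟨g, hg, hag⟩ := exists_hadamard_curve ha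
  have : g 0 = v := OS1.ext fun z =>
    (hasDerivAt_apply_of_hadamard hg (Eventually.of_forall hag) z).unique (h z)
  rw [← this]
  refine xi_tangentOf hg c fun t => ?_
  rw [hca, hag t, ha0, zero_add]

/-- The action on `f` is itself a smooth function on the tangent space, and along `t ↦ t v` its
derivative returns the action of `v`. For surjectivity a curve of tangent vectors is carried to
`OS1`, where Hadamard's lemma applies. -/
theorem xi_bijective : Function.Bijective (Tangent.xi DefC.id) := by
  constructor
  · intro v w h
    refine Tangent.ext fun f => ?_
    have key : ∀ u : Tangent DefC.id,
        Tangent.act ⟨_, act_mem_functions f⟩ (Tangent.xi DefC.id u) = Tangent.act f u := by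
      intro u
      have h1 : HasDerivAt (fun t : ℝ => t * Tangent.act f u) (Tangent.act f u) 0 := by
        simpa using (hasDerivAt_id (0 : ℝ)).mul_const (Tangent.act f u)
      refine Eq.trans ?_ h1.deriv
      exact congrArg (fun k : ℝ → ℝ => deriv k 0) (funext fun t => Tangent.act_scale t u f)
    rw [← key v, h, key w]
  · intro X
    induction X using Quotient.inductionOn with
    | h c =>
      have ha := frSmooth_tangentEquiv_symm _ c.2.1
      obtain ⟨g, hg, hag⟩ := exists_hadamard_curve ha
      refine ⟨tangentOf (g 0), xi_tangentOf hg c fun t => ?_⟩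
      have h0 : tangentEquiv.symm (c.1 0) = 0 := by
        rw [c.2.2, ← tangentOf_zero, ← tangentEquiv_apply, Equiv.symm_apply_apply]
      have := hag t
      simp only [Function.comp, h0, zero_add] at this
      rw [← this, ← tangentEquiv_apply, Equiv.apply_symm_apply]

/-! ## The region between the unit circle and a deformation close to the identity -/

theorem IsPreconnected.norm_lt_one {S : Set ℂ} (hS : IsPreconnected S)
    (h1 : ∀ z ∈ S, ‖z‖ ≠ 1) {x : ℂ} (hx : x ∈ S) (hx1 : ‖x‖ < 1) : ∀ z ∈ S, ‖z‖ < 1 := by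
  intro z hz
  by_contra! h
  obtain ⟨y, hy, hy1⟩ := hS.intermediate_value hx hz continuous_norm.continuousOn ⟨hx1.le, h⟩
  exact h1 y hy hy1

theorem IsPreconnected.one_lt_norm {S : Set ℂ} (hS : IsPreconnected S)
    (h1 : ∀ z ∈ S, ‖z‖ ≠ 1) {x : ℂ} (hx : x ∈ S) (hx1 : 1 < ‖x‖) : ∀ z ∈ S, 1 < ‖z‖ := by
  intro z hz
  by_contra! h
  obtain ⟨y, hy, hy1⟩ := hS.intermediate_value hz hx continuous_norm.continuousOn ⟨h, hx1.le⟩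
  exact h1 y hy hy1

/-- The radial extension of `F` from the circle to the plane. -/
def radialExt (F : ℂ → ℂ) (z : ℂ) : ℂ := ‖z‖ * F (z / ‖z‖)

theorem radialExt_zero (F : ℂ → ℂ) : radialExt F 0 = 0 := by simp [radialExt]

theorem radialExt_of_norm_eq_one (F : ℂ → ℂ) {z : ℂ} (hz : ‖z‖ = 1) : radialExt F z = F z := by
  simp [radialExt, hz]

theorem radialExt_ofReal (F : ℂ → ℂ) {c : ℝ} (hc : 0 < c) : radialExt F c = c * F 1 := by
  have : (c : ℂ) ≠ 0 := Complex.ofReal_ne_zero.2 hc.ne'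
  simp [radialExt, abs_of_pos hc, this]

namespace NearId

variable {a ε : ℝ} {F : ℂ → ℂ}

theorem norm_radialExt_sub_le (h : NearId a ε F) (z : ℂ) : ‖radialExt F z - z‖ ≤ ‖z‖ / 64 := by
  rcases eq_or_ne z 0 with rfl | hz
  · simp [radialExt]
  have hz' : (‖z‖ : ℂ) ≠ 0 := by simpa using hz
  have hn : ‖z / ‖z‖‖ = 1 := by simp [hz]
  have e : radialExt F z - z = ‖z‖ * (F (z / ‖z‖) - z / ‖z‖) := by
    rw [radialExt, mul_sub, mul_div_cancel₀ _ hz']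
  have hm : z / ‖z‖ ∈ Ann a := ⟨by rw [hn]; linarith [h.pos], by rw [hn]; linarith [h.pos]⟩
  rw [e, norm_mul, Complex.norm_real, norm_norm]
  have h1 := h.near _ hm
  have h2 : ε ≤ 1 / 64 := by linarith [h.small, h.le_one]
  calc _ ≤ ‖z‖ * (1 / 64) := by gcongr; exact h1.trans h2
    _ = _ := by ring

/-- The difference from the identity is `‖z‖ u(z / ‖z‖)` with `u = F - id`. The change of modulus
contributes at most `1/64` and the change of direction at most `2 · 1/16`, in total less than `1/2`.
-/
theorem radialExt_lipschitz (h : NearId a ε F) (z w : ℂ) :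
    ‖(radialExt F z - z) - (radialExt F w - w)‖ ≤ ‖z - w‖ / 2 := by
  rcases eq_or_ne z 0 with rfl | hz
  · rw [radialExt_zero, sub_self, zero_sub, norm_neg, zero_sub, norm_neg]
    linarith [h.norm_radialExt_sub_le w, norm_nonneg w]
  rcases eq_or_ne w 0 with rfl | hw
  · rw [radialExt_zero, sub_self, sub_zero, sub_zero]
    linarith [h.norm_radialExt_sub_le z, norm_nonneg z]
  have hz' : (‖z‖ : ℂ) ≠ 0 := by simpa using hz
  have hw' : (‖w‖ : ℂ) ≠ 0 := by simpa using hw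
  have hm : ∀ z : ℂ, z ≠ 0 → z / ‖z‖ ∈ Ann (a / 2) := by
    intro z hz
    have hn : ‖z / ‖z‖‖ = 1 := by simp [hz]
    exact ⟨by rw [hn]; linarith [h.pos], by rw [hn]; linarith [h.pos]⟩
  have e : (radialExt F z - z) - (radialExt F w - w) =
      ((‖z‖ : ℂ) - ‖w‖) * (F (z / ‖z‖) - z / ‖z‖) +
        ‖w‖ * ((F (z / ‖z‖) - z / ‖z‖) - (F (w / ‖w‖) - w / ‖w‖)) := by
    simp only [radialExt]
    field_simp
    ring
  have e2 : (‖w‖ : ℂ) * (z / ‖z‖ - w / ‖w‖) = ((‖w‖ : ℂ) - ‖z‖) * (z / ‖z‖) + (z - w) := by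
    field_simp
    ring
  have habs : ‖(‖z‖ : ℂ) - ‖w‖‖ ≤ ‖z - w‖ := by
    rw [← Complex.ofReal_sub, Complex.norm_real]
    exact abs_norm_sub_norm_le z w
  have h1 : ‖((‖z‖ : ℂ) - ‖w‖) * (F (z / ‖z‖) - z / ‖z‖)‖ ≤ ‖z - w‖ * (1 / 64) := by
    rw [norm_mul]
    have := h.near _ (Ann_mono (by linarith [h.pos]) (hm z hz))
    gcongr
    linarith [h.small, h.le_one]
  have h2 : ‖(‖w‖ : ℂ) * (z / ‖z‖ - w / ‖w‖)‖ ≤ 2 * ‖z - w‖ := by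
    rw [e2]
    refine (norm_add_le _ _).trans ?_
    have hn : ‖z / ‖z‖‖ = 1 := by simp [hz]
    rw [norm_mul, hn, mul_one, norm_sub_rev (‖w‖ : ℂ)]
    linarith
  have h3 : ‖(‖w‖ : ℂ) * ((F (z / ‖z‖) - z / ‖z‖) - (F (w / ‖w‖) - w / ‖w‖))‖ ≤
      ‖z - w‖ / 8 := by
    rw [norm_mul] at h2 ⊢
    have := h.lipschitz (hm z hz) (hm w hw)
    calc _ ≤ ‖(‖w‖ : ℂ)‖ * (‖z / ‖z‖ - w / ‖w‖‖ / 16) := by gcongr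
      _ ≤ _ := by linarith
  rw [e]
  refine (norm_add_le _ _).trans ?_
  linarith [norm_nonneg (z - w)]

/-- The radial extension as a homeomorphism of the plane. -/
theorem exists_homeomorph (h : NearId a ε F) : ∃ Ψ : ℂ ≃ₜ ℂ, ∀ z, Ψ z = radialExt F z := by
  have happ : ApproximatesLinearOn (radialExt F)
      ((ContinuousLinearEquiv.refl ℝ ℂ : ℂ ≃L[ℝ] ℂ) : ℂ →L[ℝ] ℂ) Set.univ (1 / 2) := by
    intro z _ w _
    have := h.radialExt_lipschitz z w
    rw [show radialExt F z - radialExt F w - (((ContinuousLinearEquiv.refl ℝ ℂ : ℂ ≃L[ℝ] ℂ) :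
      ℂ →L[ℝ] ℂ) (z - w)) = (radialExt F z - z) - (radialExt F w - w) by simp; ring]
    push_cast
    linarith
  refine ⟨happ.toHomeomorph (radialExt F) (Or.inr ?_), fun z => rfl⟩
  have : ‖(((ContinuousLinearEquiv.refl ℝ ℂ).symm : ℂ ≃L[ℝ] ℂ) : ℂ →L[ℝ] ℂ)‖₊ = 1 := by
    exact ContinuousLinearMap.nnnorm_id (𝕜 := ℝ) (E := ℂ)
  rw [this, inv_one]
  exact half_lt_self one_pos

/-- The region of a deformation close to the identity is contained in a thin annulus. -/
theorem region_subset (h : NearId a ε F) {ψ : DefC} (hψ : ∀ z : Circle, ψ z = F z) :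
    ψ.region ⊆ closedAnn ε := by
  have hε := h.nonneg
  have hcurves : ψ.twoCurves ⊆ closedAnn ε := by
    rintro z (hz | ⟨w, rfl⟩)
    · rw [mem_sphere_zero_iff_norm] at hz
      exact ⟨by linarith, by linarith⟩
    · have h1 := h.near w (coe_mem_Ann h.pos w)
      rw [hψ]
      have h2 := norm_sub_norm_le (F w) w
      have h3 := norm_sub_norm_le (w : ℂ) (F w)
      rw [norm_sub_rev] at h3
      rw [Circle.norm_coe] at h2 h3
      exact ⟨by linarith, by linarith⟩
  rintro z (hz | ⟨h0, hb⟩)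
  · exact hcurves hz
  · constructor
    · by_contra! hlt
      refine h0 ?_
      -- A point inside both curves is joined to `0` by a segment in the complement; below, a point
      -- outside both escapes to infinity along its ray.
      have hseg : segment ℝ z 0 ⊆ ψ.twoCurvesᶜ := by
        intro y hy hy'
        have h1 : y ∈ Metric.closedBall (0 : ℂ) ‖z‖ :=
          (convex_closedBall (0 : ℂ) ‖z‖).segment_subset (by simp) (by simp) hy
        rw [mem_closedBall_zero_iff] at h1
        linarith [(hcurves hy').1]
      exact (convex_segment z 0).isPreconnected.subset_connectedComponentIn
        (left_mem_segment ℝ z 0) hseg (right_mem_segment ℝ z 0)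
    · by_contra! hlt
      have hz0 : 0 < ‖z‖ := by linarith
      have hray : (fun r : ℝ => (r : ℂ) * z) '' Set.Ici 1 ⊆ ψ.twoCurvesᶜ := by
        rintro _ ⟨r, hr, rfl⟩ hy'
        have h1 := (hcurves hy').2
        simp only [norm_mul, Complex.norm_real, Real.norm_eq_abs] at h1
        rw [abs_of_nonneg (zero_le_one.trans hr)] at h1
        nlinarith [Set.mem_Ici.1 hr]
      have hsub := (isPreconnected_Ici.image (fun r : ℝ => (r : ℂ) * z)
        (by fun_prop)).subset_connectedComponentIn (x := z) ⟨1, by simp, by simp⟩ hray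
      obtain ⟨R, hR⟩ := (hb.subset hsub).exists_norm_le
      have h1 := hR _ ⟨max 1 ((R + 1) / ‖z‖), Set.mem_Ici.2 (le_max_left _ _), rfl⟩
      simp only [norm_mul, Complex.norm_real, Real.norm_eq_abs] at h1
      rw [abs_of_nonneg (zero_le_one.trans (le_max_left _ _))] at h1
      have h2 : (R + 1) / ‖z‖ * ‖z‖ ≤ max 1 ((R + 1) / ‖z‖) * ‖z‖ := by gcongr; exact le_max_right _ _
      rw [div_mul_cancel₀ _ hz0.ne'] at h2
      linarith

/-- The radial segment from `ψ(1)` to the unit circle. -/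
theorem segment_subset_region (h : NearId a ε F) {ψ : DefC} (hψ : ∀ z : Circle, ψ z = F z) :
    (fun c : ℝ => (c : ℂ) * ψ 1) '' Set.uIcc 1 ‖ψ 1‖⁻¹ ⊆ ψ.region := by
  obtain ⟨Ψ, hΨ⟩ := h.exists_homeomorph
  rintro _ ⟨c, hc, rfl⟩
  by_cases hp : (c : ℂ) * ψ 1 ∈ ψ.twoCurves
  · exact Or.inl hp
  have hψ0 : 0 < ‖ψ 1‖ := norm_pos_iff.2 (ψ.2.2.1 1)
  set p : ℂ := c * ψ 1 with hpdef
  set C := connectedComponentIn ψ.twoCurvesᶜ p with hC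
  have hpC : p ∈ C := mem_connectedComponentIn hp
  have hCpre : IsPreconnected C := isPreconnected_connectedComponentIn
  have hCsub : C ⊆ ψ.twoCurvesᶜ := connectedComponentIn_subset _ _
  have hC1 : ∀ z ∈ C, ‖z‖ ≠ 1 := fun z hz h1 => hCsub hz (Or.inl (by simpa using h1))
  -- The homeomorphism carries the unit circle to `ψ(S¹)`, so the pulled-back component lies
  -- entirely inside or outside the unit circle. If `p` is inside `S¹` then `c > 1` and `p` is
  -- outside `ψ(S¹)`; if it is outside `S¹` then `c < 1` and it is inside `ψ(S¹)`. In both cases one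
  -- curve bounds the component and one separates it from `0`.
  have hS : IsPreconnected (Ψ ⁻¹' C) := Ψ.isPreconnected_preimage.2 hCpre
  have hS1 : ∀ z ∈ Ψ ⁻¹' C, ‖z‖ ≠ 1 := by
    intro z hz h1
    have h2 := hψ ⟨z, by simpa [Submonoid.unitSphere] using h1⟩
    refine hCsub hz (Or.inr ⟨_, h2.trans ?_⟩)
    rw [hΨ, radialExt_of_norm_eq_one F h1]
  have hc1 : c ≠ 1 := by
    rintro rfl
    exact hp (Or.inr ⟨1, by simp [hpdef]⟩)
  have hc0 : 0 < c := by
    rcases Set.mem_uIcc.1 hc with hc | hc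
    · linarith [hc.1]
    · exact lt_of_lt_of_le (by positivity) hc.1
  have hcS : (c : ℂ) ∈ Ψ ⁻¹' C := by
    rw [Set.mem_preimage, hΨ, radialExt_ofReal F hc0]
    have := hψ 1
    rw [Circle.coe_one] at this
    rw [← this]
    exact hpC
  have hcn : ‖(c : ℂ)‖ = c := by simp [abs_of_pos hc0]
  have hpn : ‖p‖ = c * ‖ψ 1‖ := by rw [hpdef, norm_mul, hcn]
  refine Or.inr ⟨?_, ?_⟩
  · intro h0
    rcases lt_or_gt_of_ne (hC1 p hpC) with h1 | h1
    · have hcgt : 1 < c := by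
        by_contra! hle
        rcases Set.mem_uIcc.1 hc with hc | hc
        · exact hc1 (le_antisymm hle hc.1)
        · have := mul_le_mul_of_nonneg_right hc.1 hψ0.le
          rw [inv_mul_cancel₀ hψ0.ne'] at this
          linarith
      have := IsPreconnected.one_lt_norm hS hS1 hcS (by rwa [hcn]) 0 (by
        rw [Set.mem_preimage, hΨ, radialExt_zero]; exact h0)
      simp at this
      linarith
    · have := IsPreconnected.one_lt_norm hCpre hC1 hpC h1 0 h0
      simp at this
      linarith
  · rcases lt_or_gt_of_ne (hC1 p hpC) with h1 | h1
    · exact (Metric.isBounded_ball (x := (0 : ℂ)) (r := 1)).subset fun z hz => by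
        simpa using IsPreconnected.norm_lt_one hCpre hC1 hpC h1 z hz
    · have hclt : c < 1 := by
        by_contra! hle
        rcases Set.mem_uIcc.1 hc with hc | hc
        · have := mul_le_mul_of_nonneg_right hc.2 hψ0.le
          rw [inv_mul_cancel₀ hψ0.ne'] at this
          linarith
        · exact hc1 (le_antisymm hc.2 hle)
      have hball := IsPreconnected.norm_lt_one hS hS1 hcS (by rwa [hcn])
      refine ((isCompact_closedBall (0 : ℂ) 1).image Ψ.continuous).isBounded.subset fun z hz => ?_
      refine ⟨Ψ.symm z, ?_, Ψ.apply_symm_apply z⟩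
      have := hball (Ψ.symm z) (by rwa [Set.mem_preimage, Ψ.apply_symm_apply])
      simpa using this.le

end NearId

/-- A connected subset of the region linking the unit circle to the curve. -/
def DefC.linkage (ψ : DefC) : Set ℂ :=
  Metric.sphere 0 1 ∪ (fun c : ℝ => (c : ℂ) * ψ 1) '' Set.uIcc 1 ‖ψ 1‖⁻¹ ∪
    Set.range (ψ : Circle → ℂ)

theorem DefC.isPreconnected_linkage (ψ : DefC) : IsPreconnected ψ.linkage := by
  have hψ0 : 0 < ‖ψ 1‖ := norm_pos_iff.2 (ψ.2.2.1 1)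
  have h1 : IsPreconnected (Metric.sphere (0 : ℂ) 1) :=
    isPreconnected_sphere (by rw [Complex.rank_real_complex]; norm_num) 0 1
  have h2 : IsPreconnected ((fun c : ℝ => (c : ℂ) * ψ 1) '' Set.uIcc 1 ‖ψ 1‖⁻¹) :=
    isPreconnected_uIcc.image _ (by fun_prop)
  have h3 : IsPreconnected (Set.range (ψ : Circle → ℂ)) := by
    have e : Set.range (ψ : Circle → ℂ) = Set.range fun θ : ℝ => ψ (Circle.exp θ) := by
      refine Set.Subset.antisymm ?_ ?_
      · rintro _ ⟨z, rfl⟩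
        exact ⟨Complex.arg z, congrArg (ψ : Circle → ℂ) (Circle.exp_arg z)⟩
      · rintro _ ⟨θ, rfl⟩
        exact ⟨_, rfl⟩
    rw [e]
    exact isPreconnected_range (ψ.1.continuous.comp Circle.exp.continuous)
  refine (h1.union ((‖ψ 1‖⁻¹ : ℝ) * ψ 1) ?_ ?_ h2).union (ψ 1) ?_ ?_ h3
  · rw [mem_sphere_zero_iff_norm, norm_mul, Complex.norm_real, norm_inv, norm_norm,
      inv_mul_cancel₀ hψ0.ne']
  · exact ⟨_, Set.right_mem_uIcc, rfl⟩
  · exact Or.inr ⟨1, Set.left_mem_uIcc, by simp⟩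
  · exact ⟨1, rfl⟩

theorem NearId.linkage_subset_region {a ε : ℝ} {F : ℂ → ℂ} (h : NearId a ε F) {ψ : DefC}
    (hψ : ∀ z : Circle, ψ z = F z) : ψ.linkage ⊆ ψ.region := by
  rintro z ((hz | hz) | hz)
  · exact Or.inl (Or.inl hz)
  · exact h.segment_subset_region hψ hz
  · exact Or.inl (Or.inr hz)

/-- A deformation with an extension close to the identity. -/
def DefC.IsNear (φ : DefC) : Prop := ∃ a ε F, NearId a ε F ∧ ∀ z : Circle, φ z = F z

/-- An injective loop accumulates at each of its points, as the identity theorem requires; small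
angles supply the sequence at `f 1`. -/
theorem frequently_circle {P : ℂ → Prop} {f : Circle → ℂ} (hf : Continuous f)
    (hinj : Function.Injective f) (h : ∀ z, P (f z)) : ∃ᶠ z in 𝓝[≠] (f 1), P z := by
  have h1 : Tendsto (fun θ : ℝ => f (Circle.exp θ)) (𝓝[≠] 0) (𝓝[≠] (f 1)) := by
    refine tendsto_nhdsWithin_iff.2 ⟨?_, ?_⟩
    · have : ContinuousAt (fun θ : ℝ => f (Circle.exp θ)) 0 :=
        (hf.comp Circle.exp.continuous).continuousAt
      have h2 := this.tendsto.mono_left (nhdsWithin_le_nhds (s := {0}ᶜ))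
      simpa using h2
    · filter_upwards [eventually_mem_nhdsWithin, eventually_nhdsWithin_of_eventually_nhds
        (Metric.ball_mem_nhds (0 : ℝ) one_pos)] with θ h0 hθ e
      have e1 : Circle.exp θ = Circle.exp 0 := by rw [Circle.exp_zero]; exact hinj e
      rw [Real.dist_eq, sub_zero, abs_lt] at hθ
      have hpi := Real.pi_gt_three
      exact h0 (Circle.exp_injOn_Icc (a := -1) (b := 1) (by linarith)
        ⟨by linarith [hθ.1], by linarith [hθ.2]⟩ ⟨by norm_num, by norm_num⟩ e1)
  exact h1.frequently (Frequently.of_forall fun θ => h _)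

/-- Two extensions that agree on one of the two curves agree on the other, by the identity theorem
along the connected linkage. A composition prescribes the extension on `S¹` and uses it on `ψ(S¹)`;
an inverse does the opposite. -/
theorem DefC.IsUnivalentNear.eqOn_linkage {ψ : DefC} (hψ : ψ.IsNear) {F G : ℂ → ℂ}
    (hF : DefC.IsUnivalentNear F ψ.region) (hG : DefC.IsUnivalentNear G ψ.region) {f : Circle → ℂ}
    (hf : Continuous f) (hinj : Function.Injective f) (hfl : ∀ z, f z ∈ ψ.linkage)
    (h : ∀ z, F (f z) = G (f z)) : Set.EqOn F G ψ.linkage := by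
  obtain ⟨a, ε, E, hE, hψE⟩ := hψ
  have hsub := hE.linkage_subset_region hψE
  have key : ∀ {F : ℂ → ℂ}, DefC.IsUnivalentNear F ψ.region → AnalyticOnNhd ℂ F ψ.linkage := by
    rintro F ⟨W, hW, hKW, hF, -⟩
    exact (hF.analyticOnNhd hW).mono (hsub.trans hKW)
  exact (key hF).eqOn_of_preconnected_of_frequently_eq (key hG) ψ.isPreconnected_linkage (hfl 1)
    (frequently_circle hf hinj h)

theorem DefC.IsComp.unique {φ ψ χ χ' : DefC} (hψ : ψ.IsNear) (h : DefC.IsComp φ ψ χ)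
    (h' : DefC.IsComp φ ψ χ') : χ = χ' := by
  obtain ⟨F, hF, hFφ, hχ⟩ := h
  obtain ⟨F', hF', hFφ', hχ'⟩ := h'
  refine DefC.ext fun z => ?_
  rw [hχ, hχ']
  exact DefC.IsUnivalentNear.eqOn_linkage hψ hF hF' (f := fun z : Circle => (z : ℂ))
    continuous_subtype_val (fun _ _ h => Circle.ext h)
    (fun z => Or.inl (Or.inl (by simp [Circle.norm_coe]))) (fun z => by rw [hFφ, hFφ']) (Or.inr ⟨z, rfl⟩)

theorem DefC.IsInv.unique {φ χ χ' : DefC} (hφ : φ.IsNear) (h : DefC.IsInv φ χ)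
    (h' : DefC.IsInv φ χ') : χ = χ' := by
  obtain ⟨F, hF, hFφ, hχ⟩ := h
  obtain ⟨F', hF', hFφ', hχ'⟩ := h'
  refine DefC.ext fun z => ?_
  rw [hχ, hχ']
  exact DefC.IsUnivalentNear.eqOn_linkage hφ hF hF' (f := φ) φ.1.continuous φ.2.1
    (fun z => Or.inr ⟨z, rfl⟩) (fun z => by rw [hFφ, hFφ']) (Or.inl (Or.inl (by simp [Circle.norm_coe])))

theorem DefC.IsCommutator.unique {φ ψ φi ψi κ κ' : DefC} (hφ : φ.IsNear) (hψ : ψ.IsNear)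
    (hφi : DefC.IsInv φ φi) (hψi : DefC.IsInv ψ ψi) (hφin : φi.IsNear) (hψin : ψi.IsNear)
    (h : DefC.IsCommutator φ ψ κ) (h' : DefC.IsCommutator φ ψ κ') : κ = κ' := by
  obtain ⟨φ₁, ψ₁, a, b, h1, h2, h3, h4, h5⟩ := h
  obtain ⟨φ₁', ψ₁', a', b', h1', h2', h3', h4', h5'⟩ := h'
  obtain rfl := h1.unique hφ hφi
  obtain rfl := h1'.unique hφ h1
  obtain rfl := h2.unique hψ hψi
  obtain rfl := h2'.unique hψ h2
  obtain rfl := h3.unique hψ h3'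
  obtain rfl := h4.unique hφin h4'
  exact h5.unique hψin h5'

namespace NearId

variable {a ε b ε' : ℝ} {F G : ℂ → ℂ}

theorem isUnivalentNear (h : NearId a ε F) (hG : NearId b ε' G) {ψ : DefC}
    (hψ : ∀ z : Circle, ψ z = G z) (hε : ε' < a / 2) : DefC.IsUnivalentNear F ψ.region :=
  ⟨Ann (a / 2), isOpen_Ann _, (hG.region_subset hψ).trans (closedAnn_subset_Ann hε),
    h.hol.mono (Ann_mono (by linarith [h.pos])), h.injOn, fun _ hz => h.ne_zero hz⟩

theorem isComp (h : NearId a ε F) (hG : NearId b ε' G) {φ ψ χ : DefC}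
    (hφ : ∀ z : Circle, φ z = F z) (hψ : ∀ z : Circle, ψ z = G z)
    (hχ : ∀ z : Circle, χ z = F (G z)) (hε : ε' < a / 2) : DefC.IsComp φ ψ χ :=
  ⟨F, h.isUnivalentNear hG hψ hε, fun z => (hφ z).symm, fun z => by rw [hχ, hψ]⟩

theorem isInv (h : NearId a ε F) (hG : NearId b ε' G) {φ χ : DefC}
    (hφ : ∀ z : Circle, φ z = F z) (hχ : ∀ z : Circle, χ z = G z)
    (hGF : ∀ z : Circle, G (F z) = z) (hε : ε < b / 2) : DefC.IsInv φ χ :=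
  ⟨G, hG.isUnivalentNear h hφ hε, fun z => by rw [hφ, hGF], hχ⟩

theorem comp (h : NearId a ε F) (hG : NearId b ε' G) {c : ℝ} (hc : 0 < c) (hcb : c ≤ b)
    (hca : c + ε' ≤ a) (hs : 64 * (ε + ε') ≤ c) : NearId c (ε + ε') fun z => F (G z) := by
  have hm : Set.MapsTo G (Ann c) (Ann a) := fun z hz =>
    Ann_mono hca (hG.mapsTo hcb hz)
  refine ⟨hc, hcb.trans hG.le_one, add_nonneg h.nonneg hG.nonneg, hs,
    h.hol.comp (hG.hol.mono (Ann_mono hcb)) hm, fun z hz => ?_⟩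
  calc ‖F (G z) - z‖ = ‖(F (G z) - G z) + (G z - z)‖ := by ring_nf
    _ ≤ _ := (norm_add_le _ _).trans
      (add_le_add (h.near _ (hm hz)) (hG.near z (Ann_mono hcb hz)))

end NearId

/-! ## Inverses and compositions of families -/

section Families

variable {J : Set ℝ} {A : Set ℂ} {G : ℝ → ℂ → ℂ}

theorem SmoothFamily.comp (hG : SmoothFamily J A G) {B : Set ℂ} {H : ℝ → ℂ → ℂ}
    (hH : SmoothFamily J B H) (h : ∀ t ∈ J, Set.MapsTo (H t) B A) :
    SmoothFamily J B fun t z => G t (H t z) :=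
  ⟨fun t ht => (hG.hol t ht).comp (hH.hol t ht) (h t ht),
    hG.smooth.comp (f := fun p : ℝ × ℂ => (p.1, H p.1 p.2)) (contDiffOn_fst.prodMk hH.smooth)
      fun p hp => ⟨hp.1, h p.1 hp.1 hp.2⟩⟩

theorem smoothFamily_const {F : ℂ → ℂ} (hA : IsOpen A) (hF : DifferentiableOn ℂ F A) :
    SmoothFamily J A fun _ => F :=
  ⟨fun _ _ => hF, ((hF.contDiffOn (n := ∞) hA).restrict_scalars ℝ).comp contDiffOn_snd
    fun _ hp => hp.2⟩

theorem SmoothFamily.derivZ (hJ : IsOpen J) (hA : IsOpen A) (hG : SmoothFamily J A G) :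
    SmoothFamily J A fun t => deriv (G t) :=
  ((hG.holFamily hJ hA).derivZ hJ hA).smoothFamily hJ hA

theorem SmoothFamily.mul {H : ℝ → ℂ → ℂ} (hG : SmoothFamily J A G) (hH : SmoothFamily J A H) :
    SmoothFamily J A fun t z => G t z * H t z :=
  ⟨fun t ht => (hG.hol t ht).mul (hH.hol t ht), hG.smooth.mul hH.smooth⟩

theorem SmoothFamily.sub {H : ℝ → ℂ → ℂ} (hG : SmoothFamily J A G) (hH : SmoothFamily J A H) :
    SmoothFamily J A fun t z => G t z - H t z :=
  ⟨fun t ht => (hG.hol t ht).sub (hH.hol t ht), hG.smooth.sub hH.smooth⟩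

theorem SmoothFamily.contDiffAt (hJ : IsOpen J) (hA : IsOpen A) (hG : SmoothFamily J A G) {t : ℝ}
    (ht : t ∈ J) {z : ℂ} (hz : z ∈ A) : ContDiffAt ℝ ∞ (fun p : ℝ × ℂ => G p.1 p.2) (t, z) :=
  hG.smooth.contDiffAt ((hJ.prod hA).mem_nhds ⟨ht, hz⟩)

/-- The derivative of a smooth family along time and a complex direction. -/
theorem SmoothFamily.hasFDerivAt (hJ : IsOpen J) (hA : IsOpen A) (hG : SmoothFamily J A G) {t : ℝ}
    (ht : t ∈ J) {z : ℂ} (hz : z ∈ A) : ∃ L : ℝ × ℂ →L[ℝ] ℂ,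
      HasFDerivAt (fun p : ℝ × ℂ => G p.1 p.2) L (t, z) ∧
      ∀ σ ζ, L (σ, ζ) = σ * CircleDef.timeDeriv G t z + deriv (G t) z * ζ := by
  refine ⟨_, (hG.holFamily hJ hA).hasFDerivAt hJ hA (p := (t, z)) ⟨ht, hz⟩, fun σ ζ => ?_⟩
  simp

/-- The chain rule for `t ↦ G(t, q(t))`. -/
theorem SmoothFamily.hasDerivAt_comp (hJ : IsOpen J) (hA : IsOpen A) (hG : SmoothFamily J A G)
    {t : ℝ} (ht : t ∈ J) {q : ℝ → ℂ} {q' : ℂ} (hq : HasDerivAt q q' t) (hz : q t ∈ A) :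
    HasDerivAt (fun s => G s (q s)) (CircleDef.timeDeriv G t (q t) + deriv (G t) (q t) * q') t := by
  obtain ⟨L, hL, hLv⟩ := hG.hasFDerivAt hJ hA ht hz
  have h1 := HasFDerivAt.comp_hasDerivAt (f := fun s => (s, q s)) t hL ((hasDerivAt_id t).prodMk hq)
  refine h1.congr_deriv ?_
  rw [hLv]
  simp

/-- The differential of `(t, z) ↦ (t, G t z)` is triangular, with the nonzero complex derivative on
the diagonal. -/
theorem exists_equiv_of_triangular {L : ℝ × ℂ →L[ℝ] ℂ} {k d : ℂ} (hd : d ≠ 0)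
    (hL : ∀ (σ : ℝ) (ζ : ℂ), L (σ, ζ) = σ * k + d * ζ) :
    ∃ e : (ℝ × ℂ) ≃L[ℝ] (ℝ × ℂ), (e : ℝ × ℂ →L[ℝ] ℝ × ℂ) =
      (ContinuousLinearMap.fst ℝ ℝ ℂ).prod L := by
  have hinj : Function.Injective ((ContinuousLinearMap.fst ℝ ℝ ℂ).prod L : ℝ × ℂ →ₗ[ℝ] ℝ × ℂ) := by
    rw [← LinearMap.ker_eq_bot, LinearMap.ker_eq_bot']
    rintro ⟨σ, ζ⟩ h
    have h1 : σ = 0 := congrArg Prod.fst h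
    have h2 : L (σ, ζ) = 0 := congrArg Prod.snd h
    rw [hL, h1] at h2
    have h3 : ζ = 0 := by simpa [hd] using h2
    rw [h1, h3]
    rfl
  exact ⟨(LinearEquiv.ofInjectiveEndo _ hinj).toContinuousLinearEquiv, by ext <;> simp⟩

end Families

/-- The inverse of a function close to the identity. -/
def nearInv (a : ℝ) (F : ℂ → ℂ) : ℂ → ℂ := Function.invFunOn F (Ann (a / 2))

namespace NearId

variable {a ε : ℝ} {F : ℂ → ℂ}

theorem exists_preimage (h : NearId a ε F) {w : ℂ} (hw : w ∈ Ann (a / 4)) :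
    ∃ z ∈ Ann (a / 2), F z = w := by
  have ha := h.pos
  have hs := h.small
  have hε := h.nonneg
  -- With contraction constant `1/2`, the image of the ball of radius `2 ε` about `w` covers the
  -- ball of radius `ε` about `F w`, which contains `w`.
  have hball : Metric.closedBall w (2 * ε) ⊆ Ann (a / 2) := fun z hz =>
    Ann_mono (by linarith) (mem_Ann_of_near hw (mem_closedBall_iff_norm.1 hz))
  have happ : ApproximatesLinearOn F
      ((ContinuousLinearEquiv.refl ℝ ℂ : ℂ ≃L[ℝ] ℂ) : ℂ →L[ℝ] ℂ) (Ann (a / 2)) (1 / 2) := by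
    intro z hz w hw
    have := h.lipschitz hz hw
    rw [show F z - F w - (((ContinuousLinearEquiv.refl ℝ ℂ : ℂ ≃L[ℝ] ℂ) :
      ℂ →L[ℝ] ℂ) (z - w)) = (F z - z) - (F w - w) by simp; ring]
    push_cast
    linarith [norm_nonneg (z - w)]
  have hn : (ContinuousLinearEquiv.refl ℝ ℂ).toNonlinearRightInverse.nnnorm = 1 :=
    ContinuousLinearMap.nnnorm_id (𝕜 := ℝ) (E := ℂ)
  have hsurj := happ.surjOn_closedBall_of_nonlinearRightInverse
    (ContinuousLinearEquiv.refl ℝ ℂ).toNonlinearRightInverse (ε := 2 * ε) (b := w)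
    (by positivity) hball
  rw [hn] at hsurj
  obtain ⟨z, hz, hzw⟩ := hsurj (show w ∈ _ by
    rw [mem_closedBall_iff_norm, norm_sub_rev]
    refine (h.near w (Ann_mono (by linarith) hw)).trans ?_
    norm_num
    linarith)
  exact ⟨z, hball hz, hzw⟩

theorem nearInv_mem (h : NearId a ε F) {w : ℂ} (hw : w ∈ Ann (a / 4)) :
    nearInv a F w ∈ Ann (a / 2) := by
  obtain ⟨z, hz, e⟩ := h.exists_preimage hw
  exact Function.invFunOn_mem ⟨z, hz, e⟩

theorem apply_nearInv (h : NearId a ε F) {w : ℂ} (hw : w ∈ Ann (a / 4)) :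
    F (nearInv a F w) = w := by
  obtain ⟨z, hz, e⟩ := h.exists_preimage hw
  exact Function.invFunOn_eq ⟨z, hz, e⟩

theorem nearInv_eq (h : NearId a ε F) {z : ℂ} (hz : z ∈ Ann (a / 2)) : nearInv a F (F z) = z :=
  h.injOn (Function.invFunOn_mem ⟨z, hz, rfl⟩) hz (Function.invFunOn_eq ⟨z, hz, rfl⟩)

theorem norm_nearInv_sub_le (h : NearId a ε F) {w : ℂ} (hw : w ∈ Ann (a / 4)) :
    ‖nearInv a F w - w‖ ≤ ε := by
  have := h.near _ (Ann_mono (by linarith [h.pos]) (h.nearInv_mem hw))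
  rwa [h.apply_nearInv hw, norm_sub_rev] at this

theorem norm_deriv_sub_one_le (h : NearId a ε F) {z : ℂ} (hz : z ∈ Ann (a / 2)) :
    ‖deriv F z - 1‖ ≤ 1 / 16 := by
  have hd : HasDerivAt (fun z => F z - z) (deriv F z - 1) z :=
    ((h.hol.differentiableAt ((isOpen_Ann a).mem_nhds
      (Ann_mono (by linarith [h.pos]) hz))).hasDerivAt).sub (hasDerivAt_id z)
  refine hd.le_of_lip' (by norm_num) ?_
  filter_upwards [(isOpen_Ann (a / 2)).mem_nhds hz] with w hw
  linarith [h.lipschitz hw hz]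

theorem deriv_ne_zero (h : NearId a ε F) {z : ℂ} (hz : z ∈ Ann (a / 2)) : deriv F z ≠ 0 := by
  intro e
  have := h.norm_deriv_sub_one_le hz
  rw [e, zero_sub, norm_neg, norm_one] at this
  norm_num at this

end NearId

/-! ### Inverses of families depend smoothly on time -/

section InverseFamily

variable {J : Set ℝ} {a ε : ℝ} {G : ℝ → ℂ → ℂ}

/-- The inverse function theorem is applied to `(t, z) ↦ (t, G t z)`; injectivity on the half
annulus identifies its local inverse with the globally chosen one. -/
theorem SmoothFamily.contDiffAt_nearInv (hJ : IsOpen J) (hG : SmoothFamily J (Ann a) G)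
    (h : ∀ t ∈ J, NearId a ε (G t)) {t : ℝ} (ht : t ∈ J) {w : ℂ} (hw : w ∈ Ann (a / 4)) :
    ContDiffAt ℝ ∞ (fun p : ℝ × ℂ => nearInv a (G p.1) p.2) (t, w) := by
  have hN := h t ht
  set z := nearInv a (G t) w with hzdef
  have hz2 : z ∈ Ann (a / 2) := hN.nearInv_mem hw
  have hz : z ∈ Ann a := Ann_mono (by linarith [hN.pos]) hz2
  have hzw : G t z = w := hN.apply_nearInv hw
  obtain ⟨L, hL, hLv⟩ := hG.hasFDerivAt hJ (isOpen_Ann a) ht hz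
  obtain ⟨e, he⟩ := exists_equiv_of_triangular (hN.deriv_ne_zero hz2) hLv
  let P : ℝ × ℂ → ℝ × ℂ := fun p => (p.1, G p.1 p.2)
  have hPs : ContDiffAt ℝ ∞ P (t, z) :=
    contDiffAt_fst.prodMk (hG.contDiffAt hJ (isOpen_Ann a) ht hz)
  have hPd : HasFDerivAt P (e : ℝ × ℂ →L[ℝ] ℝ × ℂ) (t, z) := by
    rw [he]
    exact hasFDerivAt_fst.prodMk hL
  have hloc := hPs.to_localInverse hPd (by simp)
  have hP0 : P (t, z) = (t, w) := by simp [P, hzw]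
  rw [hP0] at hloc
  have hrinv : ∀ᶠ q in 𝓝 (t, w), P (hPs.localInverse hPd (by simp) q) = q := by
    have := (hPs.hasStrictFDerivAt' hPd (by simp)).eventually_right_inverse
    rwa [hP0] at this
  have hval : hPs.localInverse hPd (by simp) (t, w) = (t, z) := by
    rw [← hP0]
    exact hPs.localInverse_apply_image hPd (by simp)
  have hmem : ∀ᶠ q in 𝓝 (t, w), hPs.localInverse hPd (by simp) q ∈ J ×ˢ Ann (a / 2) := by
    refine hloc.continuousAt.eventually_mem ?_
    rw [hval]
    exact (hJ.prod (isOpen_Ann _)).mem_nhds ⟨ht, hz2⟩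
  refine (contDiffAt_snd.comp (t, w) hloc).congr_of_eventuallyEq ?_
  filter_upwards [hrinv, hmem] with q hq hqm
  have h1 := congrArg Prod.fst hq
  have h2 := congrArg Prod.snd hq
  simp only [P] at h1 h2
  rw [Function.comp, ← h2, ← h1]
  exact (h _ hqm.1).nearInv_eq hqm.2

theorem SmoothFamily.nearInv (hJ : IsOpen J) (hG : SmoothFamily J (Ann a) G)
    (h : ∀ t ∈ J, NearId a ε (G t)) : SmoothFamily J (Ann (a / 4)) fun t => nearInv a (G t) := by
  refine ⟨fun t ht w hw => ?_, fun p hp =>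
    (hG.contDiffAt_nearInv hJ h hp.1 hp.2).contDiffWithinAt⟩
  have hN := h t ht
  have hz2 := hN.nearInv_mem hw
  have hcont : ContinuousAt (CircleDef.nearInv a (G t)) w :=
    (hG.contDiffAt_nearInv hJ h ht hw).continuousAt.comp (f := fun w => (t, w)) (by fun_prop)
  have hd := ((hN.hol.differentiableAt ((isOpen_Ann a).mem_nhds
    (Ann_mono (by linarith [hN.pos]) hz2))).hasDerivAt)
  refine (HasDerivAt.of_local_left_inverse hcont hd (hN.deriv_ne_zero hz2)
    ?_).differentiableAt.differentiableWithinAt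
  filter_upwards [(isOpen_Ann (a / 4)).mem_nhds hw] with y hy using hN.apply_nearInv hy

theorem SmoothFamily.nearId_nearInv (hJ : IsOpen J) (hG : SmoothFamily J (Ann a) G)
    (h : ∀ t ∈ J, NearId a ε (G t)) (hs : 256 * ε ≤ a) {t : ℝ} (ht : t ∈ J) :
    NearId (a / 4) ε (CircleDef.nearInv a (G t)) := by
  have hN := h t ht
  have := hN.pos
  have := hN.le_one
  exact ⟨by linarith, by linarith, hN.nonneg, by linarith, (hG.nearInv hJ h).hol t ht,
    fun w hw => hN.norm_nearInv_sub_le hw⟩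

/-- The time derivative of the inverse family. -/
theorem SmoothFamily.hasDerivAt_nearInv (hJ : IsOpen J) (hG : SmoothFamily J (Ann a) G)
    (h : ∀ t ∈ J, NearId a ε (G t)) {t : ℝ} (ht : t ∈ J) {w : ℂ} (hw : w ∈ Ann (a / 4)) :
    ∃ d, HasDerivAt (fun s => CircleDef.nearInv a (G s) w) d t ∧
      CircleDef.timeDeriv G t (CircleDef.nearInv a (G t) w) +
        deriv (G t) (CircleDef.nearInv a (G t) w) * d = 0 := by
  have h1 := (hG.nearInv hJ h).hasDerivAt hJ (isOpen_Ann _) ht hw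
  refine ⟨_, h1, ?_⟩
  have hN := h t ht
  have h2 := hG.hasDerivAt_comp hJ (isOpen_Ann a) ht h1
    (Ann_mono (by linarith [hN.pos]) (hN.nearInv_mem hw))
  refine h2.unique ((hasDerivAt_const t w).congr_of_eventuallyEq ?_)
  filter_upwards [hJ.mem_nhds ht] with s hs using (h s hs).apply_nearInv hw

end InverseFamily

/-! ## Rooted curves of deformations as families close to the identity -/

/-- Hadamard's lemma gives `G t z = z + t H t z`, which makes the distance to the identity linear in
`|t|`. -/
theorem exists_family (γ : RootedCurve DefC.id) : ∃ (a : ℝ) (G : ℝ → ℂ → ℂ) (C : ℝ), 0 < a ∧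
    0 < C ∧ SmoothFamily Set.univ (Ann a) G ∧ (∀ z, G 0 z = z) ∧
    (∀ t, |t| ≤ 1 → ∀ z ∈ Ann a, ‖G t z - z‖ ≤ |t| * C) ∧
    ∀ t, |t| ≤ 1 → ∀ z : Circle, γ.1 t z = G t z := by
  obtain ⟨g, hg, hγ⟩ := exists_hadamard_curve (mem_curves_DefC_iff.1 γ.2.1)
  obtain ⟨n, H, hH, hgH⟩ := (scalarSmooth_of_mem_curves hg).exists_smoothFamily 0
  have hn : (0 : ℝ) < 1 / ((n : ℝ) + 1) := by positivity
  set a : ℝ := 1 / ((n : ℝ) + 1) / 2 with ha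
  have hsub : closedAnn a ⊆ annulus n := closedAnn_subset_Ann (b := 1 / ((n : ℝ) + 1)) (by
    linarith)
  have hsub' : Ann a ⊆ annulus n := (Ann_subset_closedAnn a).trans hsub
  obtain ⟨C, hC⟩ := ((isCompact_closedBall (0 : ℝ) 1).prod
    (isCompact_closedAnn a)).exists_bound_of_continuousOn
    (hH.smooth.continuousOn.mono (Set.prod_mono (Set.subset_univ _) hsub))
  refine ⟨a, fun t z => z + t * H t z, max C 1, by positivity,
    lt_of_lt_of_le one_pos (le_max_right _ _), ⟨fun t _ => ?_, ?_⟩, fun z => by simp,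
    fun t ht z hz => ?_, fun t ht z => ?_⟩
  · exact differentiableOn_id.add (((hH.hol t trivial).mono hsub').const_mul _)
  · refine contDiffOn_snd.add (ContDiffOn.mul ?_
      (hH.smooth.mono (Set.prod_mono (Set.subset_univ _) hsub')))
    exact (Complex.ofRealCLM.contDiff.comp contDiff_fst).contDiffOn
  · rw [add_sub_cancel_left, norm_mul, Complex.norm_real, Real.norm_eq_abs]
    gcongr
    exact (hC (t, z) ⟨by simpa [Real.dist_eq] using ht, Ann_subset_closedAnn a hz⟩).trans
      (le_max_left _ _)
  · have h1 := hγ t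
    rw [γ.2.2] at h1
    have h2 := congrArg (fun f : OS1 => f z) h1
    refine h2.trans ?_
    rw [OS1.add_apply, OS1.real_smul_apply, hgH t (by simpa using ht)]
    rfl

/-- After cutting off the time, a rooted curve is a family of functions arbitrarily close to the
identity. -/
theorem exists_nearId_family (γ : RootedCurve DefC.id) : ∃ a₀ > 0, ∀ a, 0 < a → a ≤ a₀ → a ≤ 1 →
    ∀ ε, 0 < ε → 64 * ε ≤ a → ∃ G : ℝ → ℂ → ℂ, SmoothFamily Set.univ (Ann a) G ∧
      (∀ z, G 0 z = z) ∧ (∀ t, NearId a ε (G t)) ∧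
      ∀ᶠ t in 𝓝 0, ∀ z : Circle, γ.1 t z = G t z := by
  obtain ⟨a₀, G, C, ha₀, hC, hG, hG0, hGC, hγ⟩ := exists_family γ
  refine ⟨a₀, ha₀, fun a ha haa ha1 ε hε hεa => ?_⟩
  obtain ⟨ρ, hρ, hρ0, hρδ⟩ := exists_cutoff (δ := min 1 (ε / C)) (by positivity)
  have h1 : ∀ t, |ρ t| ≤ 1 := fun t => (hρδ t).le.trans (min_le_left _ _)
  have h2 : ∀ t, |ρ t| * C ≤ ε := fun t => by
    rw [← le_div_iff₀ hC]
    exact (hρδ t).le.trans (min_le_right _ _)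
  have hG' : SmoothFamily Set.univ (Ann a) fun t => G (ρ t) :=
    (hG.mono subset_rfl (Ann_mono haa)).reparam hρ fun _ => trivial
  refine ⟨fun t => G (ρ t), hG', fun z => ?_, fun t => ⟨ha, ha1, hε.le, hεa, hG'.hol t trivial,
    fun z hz => (hGC _ (h1 t) z (Ann_mono haa hz)).trans (h2 t)⟩, ?_⟩
  · change G (ρ 0) z = z
    rw [cutoff_zero hρ0, hG0]
  · filter_upwards [hρ0] with t ht z
    have := hγ (ρ t) (h1 t) z
    rwa [ht] at this ⊢

/-- Families of functions close to the identity define curves of deformations. -/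
theorem exists_curve_of_family {a ε : ℝ} {G : ℝ → ℂ → ℂ}
    (hG : SmoothFamily Set.univ (Ann a) G) (hN : ∀ t, NearId a ε (G t))
    (h0 : ∀ z ∈ Ann a, G 0 z = z) : ∃ γ : RootedCurve DefC.id, ∀ t (z : Circle), γ.1 t z = G t z := by
  have ha : 0 < a := (hN 0).pos
  obtain ⟨n, hn⟩ := exists_annulus_subset ha
  have hG' := hG.mono subset_rfl hn
  let c : ℝ → OS1 := fun t => OS1.ofHol (hG'.hol t trivial)
  have hc : ∀ t, (DefC.ofOS1 (c t)).1 = c t := fun t => (hN t).coe_ofOS1 fun _ => rfl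
  refine ⟨⟨fun t => DefC.ofOS1 (c t), ?_, DefC.ext fun z => ?_⟩, fun t z => ?_⟩
  · rw [mem_curves_DefC_iff]
    simp_rw [hc]
    exact hG'.mem_curves fun _ _ => rfl
  · change (DefC.ofOS1 (c 0)).1 z = z
    rw [hc]
    exact h0 z (coe_mem_Ann ha z)
  · change (DefC.ofOS1 (c t)).1 z = _
    rw [hc]
    rfl

/-! ## Commutators -/

theorem NearId.exists_defC {a ε : ℝ} {F : ℂ → ℂ} (h : NearId a ε F) :
    ∃ φ : DefC, ∀ z : Circle, φ z = F z := by
  obtain ⟨n, hn⟩ := exists_annulus_subset h.pos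
  refine ⟨DefC.ofOS1 (OS1.ofHol (h.hol.mono hn)), fun z => ?_⟩
  rw [h.coe_ofOS1 fun _ => rfl]
  rfl

/-! ### Commutators of two fixed deformations -/

section Static

variable {a ε : ℝ} {F H Fi Hi : ℂ → ℂ}

/-- The widths shrink to leave room for the displacement `ε` of each factor. The fourfold
composition needs `64 · 4 ε ≤ a / 16`, which is where `4096` comes from. -/
theorem NearId.comp_comm (hF : NearId a ε F) (hH : NearId a ε H) (hFi : NearId (a / 4) ε Fi)
    (hHi : NearId (a / 4) ε Hi) (hs : 4096 * ε ≤ a) :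
    NearId (a / 2) (ε + ε) (fun z => F (H z)) ∧
    NearId (a / 8) (ε + ε + ε) (fun z => F (H (Fi z))) ∧
    NearId (a / 16) (ε + ε + ε + ε) (fun z => F (H (Fi (Hi z)))) := by
  have ha := hF.pos
  have hε := hF.nonneg
  have h1 := hF.comp hH (c := a / 2) (by linarith) (by linarith) (by linarith) (by linarith)
  have h2 := h1.comp hFi (c := a / 8) (by linarith) (by linarith) (by linarith) (by linarith)
  exact ⟨h1, h2, h2.comp hHi (c := a / 16) (by linarith) (by linarith) (by linarith) (by linarith)⟩

/-- The explicit extensions realize one commutator, and uniqueness of inverses and compositions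
excludes any other. -/
theorem DefC.isCommutator_iff (hF : NearId a ε F) (hH : NearId a ε H)
    (hFi : NearId (a / 4) ε Fi) (hHi : NearId (a / 4) ε Hi) (hs : 4096 * ε ≤ a)
    (hFF : ∀ z ∈ Ann (a / 2), Fi (F z) = z) (hHH : ∀ z ∈ Ann (a / 2), Hi (H z) = z) {φ ψ κ : DefC}
    (hφ : ∀ z : Circle, φ z = F z) (hψ : ∀ z : Circle, ψ z = H z) :
    DefC.IsCommutator φ ψ κ ↔ ∀ z : Circle, κ z = F (H (Fi (Hi z))) := by
  have ha := hF.pos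
  have hε := hF.nonneg
  obtain ⟨h1, h2, h3⟩ := hF.comp_comm hH hFi hHi hs
  obtain ⟨φi, hφi⟩ := hFi.exists_defC
  obtain ⟨ψi, hψi⟩ := hHi.exists_defC
  obtain ⟨α, hα⟩ := h1.exists_defC
  obtain ⟨β, hβ⟩ := h2.exists_defC
  have hc : ∀ z : Circle, (z : ℂ) ∈ Ann (a / 2) := coe_mem_Ann (by linarith)
  have i1 : DefC.IsInv φ φi := hF.isInv hFi hφ hφi (fun z => hFF z (hc z)) (by linarith)
  have i2 : DefC.IsInv ψ ψi := hH.isInv hHi hψ hψi (fun z => hHH z (hc z)) (by linarith)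
  have hcomm : ∀ κ : DefC, (∀ z : Circle, κ z = F (H (Fi (Hi z)))) → DefC.IsCommutator φ ψ κ :=
    fun κ hκ => ⟨φi, ψi, α, β, i1, i2, hF.isComp hH hφ hψ hα (by linarith),
      h1.isComp hFi hα hφi hβ (by linarith), h2.isComp hHi hβ hψi hκ (by linarith)⟩
  refine ⟨fun h z => ?_, hcomm κ⟩
  obtain ⟨κ', hκ'⟩ := h3.exists_defC
  rw [h.unique ⟨a, ε, F, hF, hφ⟩ ⟨a, ε, H, hH, hψ⟩ i1 i2 ⟨_, ε, Fi, hFi, hφi⟩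
    ⟨_, ε, Hi, hHi, hψi⟩ (hcomm κ' hκ'), hκ']

end Static

/-! ### Velocities of commutators -/

section Dynamic

variable {a ε : ℝ} {G H : ℝ → ℂ → ℂ}

theorem timeDeriv_differentiableOn (hH : SmoothFamily Set.univ (Ann a) H) :
    DifferentiableOn ℂ (timeDeriv H 0) (Ann a) :=
  (hH.timeDeriv isOpen_univ (isOpen_Ann a)).hol 0 trivial

theorem nearInv_zero (hN : NearId a ε (G 0)) (h0 : ∀ z, G 0 z = z) {z : ℂ}
    (hz : z ∈ Ann (a / 2)) : nearInv a (G 0) z = z := by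
  have := hN.nearInv_eq hz
  rwa [h0] at this

theorem hasDerivAt_nearInv_zero (hG : SmoothFamily Set.univ (Ann a) G)
    (hN : ∀ t, NearId a ε (G t)) (h0 : ∀ z, G 0 z = z) {z : ℂ} (hz : z ∈ Ann (a / 4)) :
    HasDerivAt (fun t => nearInv a (G t) z) (-timeDeriv G 0 z) 0 := by
  obtain ⟨d, hd, he⟩ := hG.hasDerivAt_nearInv isOpen_univ (fun t _ => hN t)
    (Set.mem_univ (0 : ℝ)) hz
  have hid : G 0 = fun z => z := funext h0
  rw [nearInv_zero (hN 0) h0 (Ann_mono (by linarith [(hN 0).pos]) hz), hid, deriv_id'', one_mul]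
    at he
  rwa [← eq_neg_of_add_eq_zero_right he]

/-- The adjoint action of `F` on the vector field `v`, minus `v`. -/
def adjointSub (a : ℝ) (F v : ℂ → ℂ) (z : ℂ) : ℂ :=
  deriv F (nearInv a F z) * v (nearInv a F z) - v z

theorem smoothFamily_adjointSub (hG : SmoothFamily Set.univ (Ann a) G)
    (hN : ∀ t, NearId a ε (G t)) {v : ℂ → ℂ} (hv : DifferentiableOn ℂ v (Ann a)) :
    SmoothFamily Set.univ (Ann (a / 4)) fun s => adjointSub a (G s) v := by
  have ha := (hN 0).pos
  have hi := hG.nearInv isOpen_univ fun t _ => hN t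
  have hm : ∀ t ∈ Set.univ, Set.MapsTo (nearInv a (G t)) (Ann (a / 4)) (Ann a) :=
    fun t _ z hz => Ann_mono (by linarith) ((hN t).nearInv_mem hz)
  have hc := smoothFamily_const (J := Set.univ) (isOpen_Ann a) hv
  exact (((hG.derivZ isOpen_univ (isOpen_Ann a)).comp hi hm).mul (hc.comp hi hm)).sub
    (hc.mono subset_rfl (Ann_mono (by linarith)))

/-- The velocity of the commutator. -/
theorem hasDerivAt_commutator (hG : SmoothFamily Set.univ (Ann a) G)
    (hGN : ∀ t, NearId a ε (G t)) (hH : SmoothFamily Set.univ (Ann a) H)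
    (hHN : ∀ t, NearId a ε (H t)) (hH0 : ∀ z, H 0 z = z) (s : ℝ) {z : ℂ} (hz : z ∈ Ann (a / 4)) :
    HasDerivAt (fun t => G s (H t (nearInv a (G s) (nearInv a (H t) z))))
      (adjointSub a (G s) (timeDeriv H 0) z) 0 := by
  have ha := (hGN 0).pos
  have hN := hGN s
  have hHid : H 0 = fun z => z := funext hH0
  have hi : nearInv a (H 0) z = z := nearInv_zero (hHN 0) hH0 (Ann_mono (by linarith) hz)
  have h1 := hasDerivAt_nearInv_zero hH hHN hH0 hz
  have hdi : HasDerivAt (nearInv a (G s)) (deriv (nearInv a (G s)) z) z :=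
    (((hG.nearInv isOpen_univ fun t _ => hGN t).hol s trivial).differentiableAt
      ((isOpen_Ann _).mem_nhds hz)).hasDerivAt
  have hm : nearInv a (G s) z ∈ Ann a := Ann_mono (by linarith) (hN.nearInv_mem hz)
  have hdG : HasDerivAt (G s) (deriv (G s) (nearInv a (G s) z)) (nearInv a (G s) z) :=
    ((hN.hol).differentiableAt ((isOpen_Ann _).mem_nhds hm)).hasDerivAt
  -- The derivatives of `G s` and its inverse cancel, so the factor `(H t)⁻¹` contributes exactly
  -- `-v(z)`.
  have hone : deriv (G s) (nearInv a (G s) z) * deriv (nearInv a (G s)) z = 1 := by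
    refine (hdG.comp z hdi).unique ((hasDerivAt_id z).congr_of_eventuallyEq ?_)
    filter_upwards [(isOpen_Ann (a / 4)).mem_nhds hz] with w hw using hN.apply_nearInv hw
  have h2 : HasDerivAt (fun t => nearInv a (G s) (nearInv a (H t) z))
      (deriv (nearInv a (G s)) z * -timeDeriv H 0 z) 0 :=
    HasDerivAt.comp (0 : ℝ) (h₂ := nearInv a (G s)) (by rwa [hi]) h1
  have h3 := hH.hasDerivAt_comp isOpen_univ (isOpen_Ann a) trivial h2 (by rwa [hi])
  rw [hi, hHid, deriv_id'', one_mul] at h3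
  have h4 := HasDerivAt.comp (0 : ℝ) (h₂ := G s)
    (h₂' := deriv (G s) (nearInv a (G s) z)) (by rwa [hi, hH0]) h3
  refine h4.congr_deriv ?_
  rw [mul_add, ← mul_assoc, hone, adjointSub]
  ring

/-- The velocity of the adjoint action is the Lie bracket. -/
theorem hasDerivAt_adjointSub (hG : SmoothFamily Set.univ (Ann a) G)
    (hN : ∀ t, NearId a ε (G t)) (hG0 : ∀ z, G 0 z = z) {v : ℂ → ℂ}
    (hv : DifferentiableOn ℂ v (Ann a)) {z : ℂ} (hz : z ∈ Ann (a / 4)) :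
    HasDerivAt (fun s => adjointSub a (G s) v z)
      (deriv (timeDeriv G 0) z * v z - timeDeriv G 0 z * deriv v z) 0 := by
  have ha := (hN 0).pos
  have hza : z ∈ Ann a := Ann_mono (by linarith) hz
  have hGid : G 0 = fun z => z := funext hG0
  have hi : nearInv a (G 0) z = z := nearInv_zero (hN 0) hG0 (Ann_mono (by linarith) hz)
  have h1 := hasDerivAt_nearInv_zero hG hN hG0 hz
  have h2 := (hG.derivZ isOpen_univ (isOpen_Ann a)).hasDerivAt_comp isOpen_univ (isOpen_Ann a)
    trivial h1 (by rwa [hi])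
  have h3 := ((hG.holFamily isOpen_univ (isOpen_Ann a)).derivZ isOpen_univ (isOpen_Ann a)).deriv 0 0
    trivial z hza
  have h4 := (hG.derivZ isOpen_univ (isOpen_Ann a)).hasDerivAt isOpen_univ (isOpen_Ann a)
    (Set.mem_univ (0 : ℝ)) hza
  -- Time and complex derivatives commute; this produces the term `u' v` of the bracket, while
  -- moving the argument of `v` produces `-u v'`.
  have h5 : timeDeriv (fun t => deriv (G t)) 0 z = deriv (timeDeriv G 0) z := h4.unique h3
  have hdv : HasDerivAt v (deriv v z) z :=
    (hv.differentiableAt ((isOpen_Ann _).mem_nhds hza)).hasDerivAt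
  have h6 := HasDerivAt.comp (0 : ℝ) (h₂ := v) (h₂' := deriv v z) (by rwa [hi]) h1
  have h7 := (h2.mul h6).sub_const (v z)
  refine h7.congr_deriv ?_
  simp only [Function.comp]
  rw [hi, h5, hGid, deriv_id'']
  simp
  ring

end Dynamic

theorem OS1.d_ofHol {n : ℕ} {F : ℂ → ℂ} (hF : DifferentiableOn ℂ F (annulus n)) (z : Circle) :
    (OS1.ofHol hF).d z = deriv F z :=
  ((OS1.isExtension_ofHol hF).hasDerivAt z).deriv.symm

/-- For small `s` the inner class has velocity `D s`, the adjoint action minus the identity applied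
to the velocity of `η`. The outer class is then the derivative of `D` at `0`. Neither step depends
on how the auxiliary curves continue beyond small times. -/
theorem commutator_curves (γ η : RootedCurve DefC.id) : ∃ u v : OS1,
    Tangent.mk γ = tangentOf u ∧ Tangent.mk η = tangentOf v ∧
    (∃ c, DefC.IsCommutatorCurve γ η c) ∧ ∀ c, DefC.IsCommutatorCurve γ η c →
      Tangent.xi DefC.id (tangentOf (v * u.d - u * v.d)) = Tangent.mk c := by
  obtain ⟨a₁, ha₁, h₁⟩ := exists_nearId_family γ
  obtain ⟨a₂, ha₂, h₂⟩ := exists_nearId_family η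
  obtain ⟨a, ha, haa⟩ : ∃ a : ℝ, 0 < a ∧ a ≤ min (min a₁ a₂) 1 :=
    ⟨min (min a₁ a₂) 1, by positivity, le_rfl⟩
  have ha1 : a ≤ 1 := haa.trans (min_le_right _ _)
  obtain ⟨ε, hε, hεa⟩ : ∃ ε : ℝ, 0 < ε ∧ 4096 * ε ≤ a := ⟨a / 4096, by positivity, by linarith⟩
  obtain ⟨G, hG, hG0, hGN, hγ⟩ := h₁ a ha (haa.trans ((min_le_left _ _).trans (min_le_left _ _)))
    ha1 ε hε (by linarith)
  obtain ⟨H, hH, hH0, hHN, hη⟩ := h₂ a ha (haa.trans ((min_le_left _ _).trans (min_le_right _ _)))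
    ha1 ε hε (by linarith)
  have hGi : ∀ s, NearId (a / 4) ε (nearInv a (G s)) := fun s =>
    hG.nearId_nearInv isOpen_univ (fun t _ => hGN t) (by linarith) trivial
  have hHi : ∀ s, NearId (a / 4) ε (nearInv a (H s)) := fun s =>
    hH.nearId_nearInv isOpen_univ (fun t _ => hHN t) (by linarith) trivial
  obtain ⟨n, hn⟩ := exists_annulus_subset (a := a / 4) (by linarith)
  have hna : annulus n ⊆ Ann a := hn.trans (Ann_mono (by linarith))
  have hu := timeDeriv_differentiableOn hG
  have hv := timeDeriv_differentiableOn hH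
  have hD := (smoothFamily_adjointSub hG hGN hv).mono subset_rfl hn
  have hc4 : ∀ z : Circle, (z : ℂ) ∈ Ann (a / 4) := coe_mem_Ann (by linarith)
  have hca : ∀ z : Circle, (z : ℂ) ∈ Ann a := coe_mem_Ann ha
  let D : ℝ → OS1 := fun s => OS1.ofHol (hD.hol s trivial)
  have hvel : ∀ (γ : RootedCurve DefC.id) (G : ℝ → ℂ → ℂ) (hG : SmoothFamily Set.univ (Ann a) G),
      (∀ᶠ t in 𝓝 0, ∀ z : Circle, γ.1 t z = G t z) →
      Tangent.mk γ = tangentOf (OS1.ofHol ((timeDeriv_differentiableOn hG).mono hna)) := by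
    intro γ G hG hγ
    refine mk_eq_tangentOf_of_hasDerivAt γ fun z => ?_
    exact (hG.hasDerivAt isOpen_univ (isOpen_Ann a) trivial (hca z)).congr_of_eventuallyEq
      (hγ.mono fun t ht => ht z)
  have hcomm : ∀ᶠ s in 𝓝 0, ∀ᶠ t in 𝓝 0, ∀ κ : DefC, DefC.IsCommutator (γ.1 s) (η.1 t) κ ↔
      ∀ z : Circle, κ z = G s (H t (nearInv a (G s) (nearInv a (H t) z))) := by
    filter_upwards [hγ] with s hs
    filter_upwards [hη] with t ht κ
    exact DefC.isCommutator_iff (hGN s) (hHN t) (hGi s) (hHi t) hεa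
      (fun z hz => (hGN s).nearInv_eq hz) (fun z hz => (hHN t).nearInv_eq hz) hs ht
  have hmk : ∀ (κ : RootedCurve DefC.id) (s : ℝ), (∀ᶠ t in 𝓝 0, ∀ z : Circle,
      κ.1 t z = G s (H t (nearInv a (G s) (nearInv a (H t) z)))) →
      Tangent.mk κ = tangentOf (D s) := by
    intro κ s hκ
    refine mk_eq_tangentOf_of_hasDerivAt κ fun z => ?_
    exact (hasDerivAt_commutator hG hGN hH hHN hH0 s (hc4 z)).congr_of_eventuallyEq
      (hκ.mono fun t ht => ht z)
  refine ⟨_, _, hvel γ G hG hγ, hvel η H hH hη, ?_, fun c hc => ?_⟩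
  · have hD0 : D 0 = 0 := by
      refine OS1.ext fun z => ?_
      change adjointSub a (G 0) _ z = 0
      have hGid : G 0 = fun z => z := funext hG0
      rw [adjointSub, nearInv_zero (hGN 0) hG0 (Ann_mono (by linarith) (hc4 z)), hGid, deriv_id'']
      simp
    refine ⟨⟨fun s => tangentOf (D s), frSmooth_tangentOf _ (hD.mem_curves fun _ _ => rfl),
      (congrArg tangentOf hD0).trans tangentOf_zero⟩, ?_⟩
    filter_upwards [hcomm] with s hs
    have ha16 : a / 16 ≤ a / 4 := by linarith
    have hK : SmoothFamily Set.univ (Ann (a / 16))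
        fun t z => G s (H t (nearInv a (G s) (nearInv a (H t) z))) := by
      have f1 := (hH.nearInv isOpen_univ fun t _ => hHN t).mono subset_rfl (Ann_mono ha16)
      have f2 := smoothFamily_const (J := Set.univ) (isOpen_Ann (a / 4)) (hGi s).hol
      have f3 := smoothFamily_const (J := Set.univ) (isOpen_Ann a) (hGN s).hol
      have f4 := f2.comp f1 fun t _ z hz => Ann_mono (by linarith) ((hHi t).mapsTo ha16 hz)
      have f5 := hH.comp f4 fun t _ z hz => Ann_mono (by linarith) ((hGi s).mapsTo
        (b := a / 16 + ε) (by linarith) ((hHi t).mapsTo ha16 hz))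
      exact f3.comp f5 fun t _ z hz => Ann_mono (by linarith) ((hHN t).mapsTo
        (b := a / 16 + ε + ε) (by linarith) ((hGi s).mapsTo
        (b := a / 16 + ε) (by linarith) ((hHi t).mapsTo ha16 hz)))
    obtain ⟨κ, hκ⟩ := exists_curve_of_family hK
      (fun t => ((hGN s).comp_comm (hHN t) (hGi s) (hHi t) hεa).2.2) fun z hz => by
        have hz4 := Ann_mono ha16 hz
        rw [nearInv_zero (hHN 0) hH0 (Ann_mono (by linarith) hz4), hH0, (hGN s).apply_nearInv hz4]
    exact ⟨κ, hs.mono fun t ht => (ht _).2 (hκ t), hmk κ s (Eventually.of_forall hκ)⟩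
  · have hcs : ∀ᶠ s in 𝓝 0, c.1 s = tangentOf (D s) := by
      filter_upwards [hc, hcomm] with s ⟨κ, hκ, hκc⟩ hs
      rw [← hκc]
      refine hmk κ s ?_
      filter_upwards [hκ, hs] with t h1 h2 using (h2 _).1 h1
    -- The curve `c` agrees with the classes of `D s` only near `0`; its velocities at all times are
    -- obtained through the inverse of `tangentEquiv`, and only their derivative at `0` is compared
    -- with that of `D`.
    refine xi_eq_mk_of_hasDerivAt c (a := fun s => tangentEquiv.symm (c.1 s)) (fun s => ?_)
      fun z => ?_
    · exact (tangentEquiv.apply_symm_apply (c.1 s)).symm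
    · have h1 := hasDerivAt_adjointSub hG hGN hG0 hv (hc4 z)
      refine (h1.congr_of_eventuallyEq ?_).congr_deriv ?_
      · filter_upwards [hcs] with s hs
        rw [hs, ← tangentEquiv_apply, Equiv.symm_apply_apply]
        rfl
      · rw [← OS1.d_ofHol (hu.mono hna), ← OS1.d_ofHol (hv.mono hna), mul_comm]
        rfl

/-! ## Flows -/

/-- The iterates of the identity under the derivation `W ∂_z`. -/
def lieIter (W : ℂ → ℂ) : ℕ → ℂ → ℂ
  | 0 => fun z => z
  | n + 1 => fun z => W z * deriv (lieIter W n) z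

section LieSeries

variable {W : ℂ → ℂ} {a M : ℝ}

theorem lieIter_differentiableOn (hW : DifferentiableOn ℂ W (Ann a)) (n : ℕ) :
    DifferentiableOn ℂ (lieIter W n) (Ann a) := by
  induction n with
  | zero => exact differentiableOn_id
  | succ n ih => exact hW.mul (ih.deriv (isOpen_Ann a))

/-- The loss of width `d` is divided equally among the `n` differentiations, each estimated by
Cauchy's inequality on a disc of radius `d / n`. For `n = 0` the bound `2` comes from `|z| < 1 + a`;
no loss is needed there, and the step to `n = 1` indeed uses up all of `d`. -/
theorem norm_lieIter_le (hW : DifferentiableOn ℂ W (Ann a)) (ha1 : a ≤ 1) (hM : 0 ≤ M)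
    (hWM : ∀ z ∈ Ann a, ‖W z‖ ≤ M) (n : ℕ) : ∀ d : ℝ, 0 ≤ d → (0 < n → 0 < d) →
      ∀ z ∈ Ann (a - d), ‖lieIter W n z‖ ≤ 2 * (n * M / d) ^ n := by
  induction n with
  | zero =>
    intro d hd _ z hz
    simp only [lieIter, pow_zero, mul_one]
    linarith [hz.2]
  | succ n ih =>
    intro d _ hd0 z hz
    have hd : 0 < d := hd0 n.succ_pos
    have hn : (0 : ℝ) < n + 1 := by positivity
    set R : ℝ := d / (n + 1) with hR
    have hR0 : 0 < R := by positivity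
    have hdR : d - R = n * d / (n + 1) := by rw [hR]; field_simp; ring
    have hsub : Metric.closedBall z R ⊆ Ann (a - (d - R)) := fun y hy => by
      have := mem_Ann_of_near hz (mem_closedBall_iff_norm.1 hy)
      rwa [show a - (d - R) = a - d + R by ring]
    have hdR0 : 0 ≤ d - R := by rw [hdR]; positivity
    have hcauchy := Complex.norm_deriv_le_of_forall_mem_sphere_norm_le (f := lieIter W n) hR0
      (((lieIter_differentiableOn hW n).mono ((hsub.trans (Ann_mono (by linarith))))).diffContOnCl_ball
        subset_rfl)
      (fun y hy => ih (d - R) hdR0 (fun hn0 => by rw [hdR]; positivity) y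
        (hsub (Metric.sphere_subset_closedBall hy)))
    have hpow : ((n : ℝ) * M / (d - R)) ^ n = ((n + 1) * M / d) ^ n := by
      rcases Nat.eq_zero_or_pos n with rfl | hn0
      · simp
      · have : (0 : ℝ) < n := Nat.cast_pos.2 hn0
        rw [hdR]
        congr 1
        field_simp
    rw [hpow] at hcauchy
    have hWz := hWM z (Ann_mono (by linarith) hz)
    simp only [lieIter]
    rw [norm_mul]
    calc _ ≤ M * (2 * ((n + 1) * M / d) ^ n / R) := by gcongr
      _ = _ := by rw [hR, pow_succ]; push_cast; field_simp

/-- The inequality `nⁿ ≤ eⁿ n!` turns the Cauchy estimate into one that the factorials of the Lie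
series compensate. -/
theorem exists_lieIter_bound (hW : DifferentiableOn ℂ W (Ann a)) (ha : 0 < a) (ha1 : a ≤ 1)
    (hM : 0 ≤ M) (hWM : ∀ z ∈ Ann a, ‖W z‖ ≤ M) : ∃ K : ℝ, 0 < K ∧ ∀ n, ∀ z ∈ Ann (a / 2),
      ‖lieIter W n z‖ ≤ 2 * (n.factorial * K ^ n) := by
  refine ⟨Real.exp 1 * (2 * M / a) + 1, by positivity, fun n z hz => ?_⟩
  refine (norm_lieIter_le hW ha1 hM hWM n (a / 2) (by positivity) (fun _ => by positivity) z
    (by rwa [sub_half])).trans ?_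
  have h1 := Real.pow_div_factorial_le_exp (n : ℝ) (Nat.cast_nonneg n) n
  rw [div_le_iff₀ (by positivity), ← Real.exp_one_pow] at h1
  have h2 : ((n : ℝ) * M / (a / 2)) ^ n = (n : ℝ) ^ n * (2 * M / a) ^ n := by
    rw [← mul_pow]; congr 1; field_simp
  have h3 : (Real.exp 1 * (2 * M / a)) ^ n ≤ (Real.exp 1 * (2 * M / a) + 1) ^ n := by
    gcongr; linarith
  rw [h2]
  calc _ ≤ 2 * (Real.exp 1 ^ n * n.factorial * (2 * M / a) ^ n) := by gcongr
    _ = 2 * (n.factorial * (Real.exp 1 * (2 * M / a)) ^ n) := by rw [mul_pow]; ring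
    _ ≤ _ := by gcongr

/-- The terms of the Lie series of the flow and its time derivatives. -/
def lieTerm (W : ℂ → ℂ) (j n : ℕ) (t : ℝ) (z : ℂ) : ℂ :=
  ((t ^ n / n.factorial : ℝ) : ℂ) * lieIter W (n + j) z

/-- The Lie series of the flow and its time derivatives. -/
def lieSeries (W : ℂ → ℂ) (j : ℕ) (t : ℝ) (z : ℂ) : ℂ := ∑' n, lieTerm W j n t z

/-- A majorant of the Lie series. -/
def lieMajorant (K : ℝ) (j n : ℕ) : ℝ := 2 * K ^ j * ((n + j).descFactorial j * (1 / 2) ^ n)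

theorem summable_lieMajorant (K : ℝ) (j : ℕ) : Summable (lieMajorant K j) :=
  (summable_descFactorial_mul_geometric_of_norm_lt_one (R := ℝ) j (r := 1 / 2)
    (by norm_num)).mul_left _

theorem norm_lieTerm_le {K : ℝ} (hK : 0 < K) {z : ℂ}
    (hb : ∀ n, ‖lieIter W n z‖ ≤ 2 * (n.factorial * K ^ n)) (j n : ℕ) {t : ℝ}
    (ht : t ∈ Metric.ball (0 : ℝ) (1 / (2 * K))) : ‖lieTerm W j n t z‖ ≤ lieMajorant K j n := by
  rw [mem_ball_zero_iff, Real.norm_eq_abs] at ht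
  have hf : ((n + j).descFactorial j : ℝ) * n.factorial = (n + j).factorial := by
    have := Nat.factorial_mul_descFactorial (Nat.le_add_left j n)
    rw [Nat.add_sub_cancel] at this
    rw [mul_comm]
    exact_mod_cast this
  have hn : (0 : ℝ) < n.factorial := by positivity
  rw [lieTerm, norm_mul, Complex.norm_real, Real.norm_eq_abs, abs_div, abs_pow, abs_of_pos hn]
  calc _ ≤ (1 / (2 * K)) ^ n / n.factorial * (2 * ((n + j).factorial * K ^ (n + j))) := by
        gcongr
        exact hb _
    _ = lieMajorant K j n := by
        rw [lieMajorant, ← hf, pow_add, one_div_pow, mul_pow, one_div_pow]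
        field_simp

theorem hasDerivAt_lieTerm_succ (j n : ℕ) (t : ℝ) (z : ℂ) :
    HasDerivAt (fun t => lieTerm W j (n + 1) t z) (lieTerm W (j + 1) n t z) t := by
  have h1 : HasDerivAt (fun t : ℝ => t ^ (n + 1) / (n + 1).factorial) (t ^ n / n.factorial) t := by
    refine ((hasDerivAt_pow (n + 1) t).div_const _).congr_deriv ?_
    rw [Nat.factorial_succ]
    push_cast
    field_simp
  have h2 := h1.ofReal_comp.mul_const (lieIter W (n + 1 + j) z)
  rw [lieTerm, show n + (j + 1) = n + 1 + j by ring]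
  exact h2

/-- Differentiation sends term `n + 1` of one series to term `n` of the next and kills term `0`,
which is constant in time. -/
theorem hasDerivAt_lieSeries {K : ℝ} (hK : 0 < K) {z : ℂ}
    (hb : ∀ n, ‖lieIter W n z‖ ≤ 2 * (n.factorial * K ^ n)) (j : ℕ) {t : ℝ}
    (ht : t ∈ Metric.ball (0 : ℝ) (1 / (2 * K))) :
    HasDerivAt (fun t => lieSeries W j t z) (lieSeries W (j + 1) t z) t := by
  have hsum : ∀ t ∈ Metric.ball (0 : ℝ) (1 / (2 * K)), ∀ j, Summable fun n => lieTerm W j n t z :=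
    fun t ht j => Summable.of_norm_bounded (summable_lieMajorant K j)
      fun n => norm_lieTerm_le hK hb j n ht
  have h1 := hasDerivAt_tsum_of_isPreconnected
    (g := fun n t => lieTerm W j (n + 1) t z) (g' := fun n t => lieTerm W (j + 1) n t z)
    (summable_lieMajorant K (j + 1)) Metric.isOpen_ball
    (convex_ball (0 : ℝ) (1 / (2 * K))).isPreconnected
    (fun n y _ => hasDerivAt_lieTerm_succ j n y z)
    (fun n y hy => norm_lieTerm_le hK hb (j + 1) n hy) ht
    ((summable_nat_add_iff 1).2 (hsum t ht j)) ht
  have h2 := h1.const_add (lieIter W j z)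
  refine h2.congr_of_eventuallyEq ?_
  filter_upwards [Metric.isOpen_ball.mem_nhds ht] with s hs
  rw [lieSeries, (hsum s hs j).tsum_eq_zero_add]
  simp [lieTerm]

theorem holFamily_lieSeries {A : Set ℂ} (hA : IsOpen A) {K : ℝ} (hK : 0 < K)
    (hd : ∀ n, DifferentiableOn ℂ (lieIter W n) A)
    (hb : ∀ n, ∀ z ∈ A, ‖lieIter W n z‖ ≤ 2 * (n.factorial * K ^ n)) :
    HolFamily (Metric.ball 0 (1 / (2 * K))) A (lieSeries W) where
  hol j t ht := Complex.differentiableOn_tsum_of_summable_norm (summable_lieMajorant K j)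
    (fun n => (hd (n + j)).const_mul _) hA
    fun n z hz => norm_lieTerm_le hK (fun n => hb n z hz) j n ht
  deriv j t ht z hz := hasDerivAt_lieSeries hK (fun n => hb n z hz) j ht
  cont j := continuousOn_tsum (fun n => ContinuousOn.mul
      (Continuous.continuousOn (by fun_prop))
      ((hd (n + j)).continuousOn.comp continuousOn_snd fun p hp => hp.2))
    (summable_lieMajorant K j)
    fun n p hp => norm_lieTerm_le hK (fun n => hb n p.2 hp.2) j n hp.1

/-- Applying `W ∂_z` termwise raises the index of every iterate by one, and this is also what the
time derivative does; hence the series solves the right flow equation. -/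
theorem lieSeries_one {A : Set ℂ} (hA : IsOpen A) {K : ℝ} (hK : 0 < K)
    (hd : ∀ n, DifferentiableOn ℂ (lieIter W n) A)
    (hb : ∀ n, ∀ z ∈ A, ‖lieIter W n z‖ ≤ 2 * (n.factorial * K ^ n)) {t : ℝ}
    (ht : t ∈ Metric.ball (0 : ℝ) (1 / (2 * K))) {z : ℂ} (hz : z ∈ A) :
    lieSeries W 1 t z = W z * deriv (lieSeries W 0 t) z := by
  have h := Complex.hasSum_deriv_of_summable_norm (F := fun n z => lieTerm W 0 n t z)
    (summable_lieMajorant K 0) (fun n => (hd (n + 0)).const_mul _) hA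
    (fun n z hz => norm_lieTerm_le hK (fun n => hb n z hz) 0 n ht) hz
  refine Eq.trans ?_ (h.mul_left (W z)).tsum_eq
  refine tsum_congr fun n => ?_
  have h1 := (((hd n).differentiableAt (hA.mem_nhds hz)).hasDerivAt.const_mul
    ((t ^ n / n.factorial : ℝ) : ℂ)).deriv
  simp only [lieTerm, add_zero]
  rw [h1]
  simp only [lieIter]
  ring

theorem lieSeries_zero (z : ℂ) : lieSeries W 0 0 z = z := by
  rw [lieSeries, tsum_eq_single 0 fun n hn => by simp [lieTerm, hn]]
  simp [lieTerm, lieIter]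

end LieSeries

/-- The right-trivializing flow of a vector field as a family of functions close to the identity. -/
theorem exists_right_flow_family (w : OS1) : ∃ (n : ℕ) (W : ℂ → ℂ) (b ε : ℝ) (G : ℝ → ℂ → ℂ),
    IsExtension n W w ∧ Ann b ⊆ annulus n ∧ 256 * ε ≤ b ∧ SmoothFamily Set.univ (Ann b) G ∧
    (∀ t, NearId b ε (G t)) ∧ (∀ z, G 0 z = z) ∧
    ∀ᶠ t in 𝓝 0, ∀ z ∈ Ann b, HasDerivAt (fun s => G s z) (W z * deriv (G t) z) t := by
  obtain ⟨n, W, hW⟩ := w.2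
  have hn : (0 : ℝ) < 1 / ((n : ℝ) + 1) := by positivity
  have hn1 : 1 / ((n : ℝ) + 1) ≤ 1 := by
    rw [div_le_one (by positivity)]; linarith [(Nat.cast_nonneg n : (0 : ℝ) ≤ n)]
  set a : ℝ := 1 / ((n : ℝ) + 1) / 2 with ha
  have ha0 : 0 < a := by positivity
  have hsub : closedAnn a ⊆ annulus n := closedAnn_subset_Ann (b := 1 / ((n : ℝ) + 1)) (by
    linarith)
  have hsub' : Ann a ⊆ annulus n := (Ann_subset_closedAnn a).trans hsub
  obtain ⟨M, hM⟩ := (isCompact_closedAnn a).exists_bound_of_continuousOn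
    (hW.1.continuousOn.mono hsub)
  have hM0 : 0 ≤ M := (norm_nonneg _).trans (hM _ (Ann_subset_closedAnn a (coe_mem_Ann ha0 1)))
  have hWa := hW.1.mono hsub'
  obtain ⟨K, hK, hb⟩ := exists_lieIter_bound hWa ha0 (by linarith) hM0
    fun z hz => hM z (Ann_subset_closedAnn a hz)
  have hd : ∀ n, DifferentiableOn ℂ (lieIter W n) (Ann (a / 2)) := fun n =>
    (lieIter_differentiableOn hWa n).mono (Ann_mono (by linarith))
  have hA := isOpen_Ann (a / 2)
  have hfam := holFamily_lieSeries hA hK hd hb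
  have hT : (0 : ℝ) ∈ Metric.ball (0 : ℝ) (1 / (2 * K)) := Metric.mem_ball_self (by positivity)
  set b := a / 4 with hbdef
  set ε := b / 256 with hε
  -- The series tends to the identity uniformly on a compact annulus as `t → 0`, so cutting off time
  -- keeps it within `ε` of the identity for all times.
  have hu := (tendstoLocallyUniformlyOn_iff_forall_isCompact hA).1
    (hfam.tendstoLocallyUniformlyOn_nhds Metric.isOpen_ball hA 0 hT) (closedAnn b)
    (closedAnn_subset_Ann (by linarith)) (isCompact_closedAnn b)
  have hev := (Metric.tendstoUniformlyOn_iff.1 hu ε (by positivity)).and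
    (Metric.isOpen_ball.mem_nhds hT)
  obtain ⟨δ, hδ, hball⟩ := Metric.eventually_nhds_iff_ball.1 hev
  obtain ⟨ρ, hρ, hρ0, hρδ⟩ := exists_cutoff hδ
  have hρb : ∀ t, ρ t ∈ Metric.ball (0 : ℝ) δ := fun t => by
    rw [mem_ball_zero_iff]; exact hρδ t
  have hbA : Ann b ⊆ Ann (a / 2) := Ann_mono (by linarith)
  have hG : SmoothFamily Set.univ (Ann b) fun t => lieSeries W 0 (ρ t) :=
    ((hfam.smoothFamily Metric.isOpen_ball hA).mono subset_rfl hbA).reparam hρ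
      fun t => (hball _ (hρb t)).2
  refine ⟨n, W, b, ε, fun t => lieSeries W 0 (ρ t), hW,
    (Ann_mono (by linarith)).trans hsub', by linarith, hG, fun t => ⟨by positivity, by linarith,
      by positivity, by linarith, hG.hol t trivial, fun z hz => ?_⟩, fun z => ?_, ?_⟩
  · have := (hball _ (hρb t)).1 z (Ann_subset_closedAnn b hz)
    rw [lieSeries_zero, dist_comm, dist_eq_norm] at this
    exact this.le
  · change lieSeries W 0 (ρ 0) z = z
    rw [cutoff_zero hρ0, lieSeries_zero]
  · filter_upwards [hρ0.eventually_nhds] with t ht z hz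
    have htρ := ht.self_of_nhds
    have htb := (hball _ (hρb t)).2
    rw [htρ] at htb ⊢
    rw [← lieSeries_one hA hK hd hb htb (hbA hz)]
    refine (hfam.deriv 0 t htb z (hbA hz)).congr_of_eventuallyEq ?_
    filter_upwards [ht] with s hs
    rw [hs]

theorem OS1.d_eq_deriv {a : ℝ} (ha : 0 < a) {F : ℂ → ℂ} (hF : DifferentiableOn ℂ F (Ann a))
    {f : OS1} (hf : ∀ z : Circle, f z = F z) (z : Circle) : f.d z = deriv F z := by
  obtain ⟨n, hn⟩ := exists_annulus_subset ha
  have h : IsExtension n F f := ⟨hF.mono hn, fun z => (hf z).symm⟩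
  exact (h.hasDerivAt z).deriv.symm

theorem exists_isRightFlow (w : VectC) : ∃ γ, DefC.IsRightFlow w γ := by
  obtain ⟨n, W, b, ε, G, hW, hb, hε, hG, hN, hG0, hflow⟩ := exists_right_flow_family w.coeff
  have hb0 := (hN 0).pos
  obtain ⟨γ, hγ⟩ := exists_curve_of_family hG hN fun z _ => hG0 z
  refine ⟨γ, ?_⟩
  filter_upwards [hflow] with t ht z
  simp_rw [hγ]
  rw [OS1.d_eq_deriv hb0 (hG.hol t trivial) (hγ t), ← hW.2, mul_comm]
  exact ht z (coe_mem_Ann hb0 z)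

/-- The inverse of the right flow at time `-t` is used. Differentiating `G (-t)` composed with its
inverse gives `G' (d - W) = 0`, where `d` is the velocity of the inverse and `W` is taken at its
value; since `G'` does not vanish, `d = W`. -/
theorem exists_isLeftFlow (w : VectC) : ∃ γ, DefC.IsLeftFlow w γ := by
  obtain ⟨n, W, b, ε, G, hW, hb, hε, hG, hN, hG0, hflow⟩ := exists_right_flow_family w.coeff
  have hb0 := (hN 0).pos
  have hR : SmoothFamily Set.univ (Ann b) fun t => G (-t) :=
    hG.reparam contDiff_neg fun _ => trivial
  have hRN : ∀ t ∈ Set.univ, NearId b ε (G (-t)) := fun t _ => hN (-t)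
  obtain ⟨γ, hγ⟩ := exists_curve_of_family (hR.nearInv isOpen_univ hRN)
    (fun t => hR.nearId_nearInv isOpen_univ hRN hε trivial) fun z hz => by
      rw [neg_zero]
      exact nearInv_zero (hN 0) hG0 (Ann_mono (by linarith) hz)
  refine ⟨γ, n, W, hW, ?_⟩
  have hneg : Tendsto (fun t : ℝ => -t) (𝓝 0) (𝓝 0) := by
    simpa using (continuous_neg (G := ℝ)).tendsto 0
  filter_upwards [hneg.eventually hflow] with t ht z
  have hz : (z : ℂ) ∈ Ann (b / 4) := coe_mem_Ann (by linarith) z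
  have hm : nearInv b (G (-t)) z ∈ Ann b :=
    Ann_mono (by linarith) ((hRN t trivial).nearInv_mem hz)
  simp_rw [hγ]
  refine ⟨hb hm, ?_⟩
  obtain ⟨d, hd, he⟩ := hR.hasDerivAt_nearInv isOpen_univ hRN (Set.mem_univ t) hz
  refine hd.congr_deriv ?_
  have h1 := hR.hasDerivAt isOpen_univ (isOpen_Ann b) (Set.mem_univ t) hm
  have h2 := (ht _ hm).scomp t (hasDerivAt_neg t)
  rw [h1.unique h2, neg_one_smul] at he
  have h3 : deriv (G (-t)) (nearInv b (G (-t)) z) * (d - W (nearInv b (G (-t)) z)) = 0 := by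
    rw [← he]; ring
  rcases mul_eq_zero.1 h3 with h | h
  · exact absurd h ((hRN t trivial).deriv_ne_zero ((hRN t trivial).nearInv_mem hz))
  · exact sub_eq_zero.1 h

/-- At time `0` the flow is the identity with complex derivative `1`, so the equation at that single
time already gives the velocity `w`. -/
theorem DefC.IsRightFlow.mk_eq {w : VectC} {γ : RootedCurve DefC.id} (h : DefC.IsRightFlow w γ) :
    Tangent.mk γ = tangentOf w.coeff := by
  refine mk_eq_tangentOf_of_hasDerivAt γ fun z => ?_
  have h1 := h.self_of_nhds z
  rwa [γ.2.2, OS1.d_eq_deriv one_pos differentiableOn_id fun z => DefC.id_apply z, deriv_id,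
    one_mul] at h1

theorem DefC.IsLeftFlow.mk_eq {w : VectC} {γ : RootedCurve DefC.id} (h : DefC.IsLeftFlow w γ) :
    Tangent.mk γ = tangentOf w.coeff := by
  obtain ⟨n, W, hW, h⟩ := h
  refine mk_eq_tangentOf_of_hasDerivAt γ fun z => ?_
  have h1 := (h.self_of_nhds z).2
  rwa [γ.2.2, DefC.id_apply, hW.2] at h1

/-! ## The Lie algebra of the complex deformations -/

/-- The tangent space at the identity as the space of analytic vector fields. -/
def vectEquiv : VectC ≃ Tangent DefC.id := tangentEquiv

/-- The Lie ring structure on the tangent space at the identity. -/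
@[reducible] def tangentLieRing : LieRing (Tangent DefC.id) :=
  { vectEquiv.symm.addCommGroup with
    bracket := fun x y => vectEquiv ⁅vectEquiv.symm x, vectEquiv.symm y⁆
    add_lie := fun x y z => by
      change vectEquiv ⁅vectEquiv.symm (vectEquiv _), _⁆ =
        vectEquiv (vectEquiv.symm (vectEquiv _) + vectEquiv.symm (vectEquiv _))
      simp only [Equiv.symm_apply_apply]
      exact congrArg vectEquiv (add_lie _ _ _)
    lie_add := fun x y z => by
      change vectEquiv ⁅_, vectEquiv.symm (vectEquiv _)⁆ =
        vectEquiv (vectEquiv.symm (vectEquiv _) + vectEquiv.symm (vectEquiv _))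
      simp only [Equiv.symm_apply_apply]
      exact congrArg vectEquiv (lie_add _ _ _)
    lie_self := fun x => congrArg vectEquiv (lie_self (vectEquiv.symm x))
    leibniz_lie := fun x y z => by
      change vectEquiv ⁅_, vectEquiv.symm (vectEquiv _)⁆ =
        vectEquiv (vectEquiv.symm (vectEquiv ⁅vectEquiv.symm (vectEquiv _), _⁆) +
          vectEquiv.symm (vectEquiv ⁅_, vectEquiv.symm (vectEquiv _)⁆))
      simp only [Equiv.symm_apply_apply]
      exact congrArg vectEquiv (leibniz_lie _ _ _) }

/-- The Lie algebra structure on the tangent space at the identity. -/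
@[reducible] def tangentLieAlgebra :
    letI := tangentLieRing
    LieAlgebra ℝ (Tangent DefC.id) :=
  letI := tangentLieRing
  { vectEquiv.symm.module ℝ with
    lie_smul := fun r x y => by
      change vectEquiv ⁅_, vectEquiv.symm (vectEquiv _)⁆ =
        vectEquiv (r • vectEquiv.symm (vectEquiv _))
      simp only [Equiv.symm_apply_apply]
      exact congrArg vectEquiv (lie_smul _ _ _) }

/-- The isomorphism of Lie algebras between vector fields and tangent vectors. -/
def vectLieEquiv :
    letI := tangentLieRing
    letI := tangentLieAlgebra
    VectC ≃ₗ⁅ℝ⁆ Tangent DefC.id :=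
  letI := tangentLieRing
  letI := tangentLieAlgebra
  { vectEquiv with
    map_add' := fun v w => by
      change vectEquiv _ = vectEquiv (vectEquiv.symm (vectEquiv v) + vectEquiv.symm (vectEquiv w))
      simp only [Equiv.symm_apply_apply]
    map_smul' := fun r v => by
      change vectEquiv _ = vectEquiv (r • vectEquiv.symm (vectEquiv v))
      simp only [Equiv.symm_apply_apply]
    map_lie' := fun {v w} => by
      change vectEquiv _ = vectEquiv ⁅vectEquiv.symm (vectEquiv v), vectEquiv.symm (vectEquiv w)⁆
      simp only [Equiv.symm_apply_apply] }

theorem tangentOf_add (x y : OS1) :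
    letI := tangentLieRing
    tangentOf x + tangentOf y = tangentOf (x + y) := by
  let _ := tangentLieRing
  let _ := tangentLieAlgebra
  exact (vectLieEquiv.map_add (show VectC from x) (show VectC from y)).symm

theorem smul_tangentOf (r : ℝ) (x : OS1) :
    letI := tangentLieRing
    letI := tangentLieAlgebra
    r • tangentOf x = tangentOf (r • x) := by
  let _ := tangentLieRing
  let _ := tangentLieAlgebra
  exact (vectLieEquiv.toLinearEquiv.map_smul r (show VectC from x)).symm

theorem tangentOf_lie (x y : OS1) :
    letI := tangentLieRing
    ⁅tangentOf x, tangentOf y⁆ = tangentOf (y * x.d - x * y.d) := by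
  let _ := tangentLieRing
  let _ := tangentLieAlgebra
  exact (vectLieEquiv.map_lie (show VectC from x) (show VectC from y)).symm

end CircleDef

end

theorem mainTheorem10 :
    Function.Bijective (CircleDef.Tangent.xi CircleDef.DefC.id) ∧
    ∃ (_ : LieRing (CircleDef.Tangent CircleDef.DefC.id))
      (_ : LieAlgebra ℝ (CircleDef.Tangent CircleDef.DefC.id)),
      (∀ (u v : CircleDef.Tangent CircleDef.DefC.id) (f : CircleDef.Functions CircleDef.DefC),
        CircleDef.Tangent.act f (u + v) =
          CircleDef.Tangent.act f u + CircleDef.Tangent.act f v) ∧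
      (∀ (r : ℝ) (v : CircleDef.Tangent CircleDef.DefC.id), r • v = v.scale r) ∧
      (∀ γ η : CircleDef.RootedCurve CircleDef.DefC.id,
        (∃ c, CircleDef.DefC.IsCommutatorCurve γ η c) ∧
        ∀ c, CircleDef.DefC.IsCommutatorCurve γ η c →
          CircleDef.Tangent.xi CircleDef.DefC.id
            ⁅CircleDef.Tangent.mk γ, CircleDef.Tangent.mk η⁆ = CircleDef.Tangent.mk c) ∧
      ∃ Θ : CircleDef.VectC ≃ₗ⁅ℝ⁆ CircleDef.Tangent CircleDef.DefC.id,
        (∀ w : CircleDef.VectC,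
          (∃ γ, CircleDef.DefC.IsRightFlow w γ) ∧
          (∀ γ, CircleDef.DefC.IsRightFlow w γ → CircleDef.Tangent.mk γ = Θ w) ∧
          (∃ γ, CircleDef.DefC.IsLeftFlow w γ) ∧
          (∀ γ, CircleDef.DefC.IsLeftFlow w γ → CircleDef.Tangent.mk γ = Θ w)) ∧
        CircleDef.FrSmooth Θ ∧ CircleDef.FrSmooth Θ.symm := by
  refine ⟨CircleDef.xi_bijective, CircleDef.tangentLieRing, CircleDef.tangentLieAlgebra,
    fun u v f => ?_, fun r v => ?_, fun γ η => ?_, CircleDef.vectLieEquiv, fun w => ?_,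
    CircleDef.frSmooth_tangentOf, CircleDef.frSmooth_tangentEquiv_symm⟩
  · obtain ⟨x, rfl⟩ := CircleDef.tangentEquiv.surjective u
    obtain ⟨y, rfl⟩ := CircleDef.tangentEquiv.surjective v
    exact (congrArg (CircleDef.Tangent.act f) (CircleDef.tangentOf_add x y)).trans
      (CircleDef.act_tangentOf_add f x y)
  · obtain ⟨x, rfl⟩ := CircleDef.tangentEquiv.surjective v
    exact (CircleDef.smul_tangentOf r x).trans (CircleDef.tangentOf_smul r x)
  · obtain ⟨u, v, hu, hv, hex, hall⟩ := CircleDef.commutator_curves γ η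
    refine ⟨hex, fun c hc => ?_⟩
    rw [← hall c hc, hu, hv]
    exact congrArg _ (CircleDef.tangentOf_lie u v)
  · exact ⟨CircleDef.exists_isRightFlow w, fun γ h => h.mk_eq, CircleDef.exists_isLeftFlow w,
      fun γ h => h.mk_eq⟩
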